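/- A constant power circuit $\mathcal P$ is a finite directed acyclic graph without multiple edges, with vertex set $V(\mathcal P)$, in which every edge $e$ carries a label $\mu(e)\in\{1,-1\}$, together with a non-empty set $M\subseteq V(\mathcal P)$ of marked vertices, each with a sign $\nu(v)\in\{1,-1\}$. Put $\mathcal E(v)=0$ if $v$ is a leaf (a zero vertex), and $\mathcal E(v)=2^{\sum_{e} \mu(e)\mathcal E(\beta(e))}\in\mathbb R$ otherwise, where the sum is over the edges $e$ leaving $v$ and $\beta(e)$ is the terminus of $e$; put $\mathcal E(\mathcal P)=\sum_{v\in M}\nu(v)\mathcal E(v)$. Two constant circuits are equivalent if their values $\mathcal E(\cdot)$ agree, and $\mathcal P$ is proper if $\mathcal E(v)\in\mathbb N=\{0,1,2,\dots\}$ for all $v\in V(\mathcal P)$. A circuit is standard if every vertex is reachable from a marked vertex and either the circuit has just one vertex, or it has exactly one zero vertex, this vertex is unmarked, and an edge into it is always the only edge leaving its origin. It is reduced if it is standard, distinct vertices have distinct values, and there are no two edges $v\to v_1$, $v\to v_2$ with opposite labels and $\mathcal E(v_1)=\mathcal E(v_2)$ or $\mathcal E(v_1)=2\mathcal E(v_2)$.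 A binary sum $\sum_{i=1}^k\varepsilon_i2^{q_i}$ ($\varepsilon_i=\pm1$, $q_i\in\mathbb N$) is compact if $q_i\ge q_{i+1}+2$ for $1\le i<k$. A circuit is normal if it is proper and reduced, and the sum $\sum_{v\in M}\nu(v)\mathcal E(v)$ and, for each vertex $v$, the sum $\sum_e\mu(e)\mathcal E(\beta(e))$ over the edges leaving $v$ are compact after reordering (terms of zero vertices, being $0$, are disregarded). An isomorphism of circuits is a graph isomorphism that maps marked vertices onto marked vertices and preserves labels and signs. The labels of edges into zero vertices and the signs of marked zero vertices, which do not influence any value, are called zero signs. Theorem. There is an algorithm which, given a constant proper power circuit $\mathcal P$, computes in time $O(|V(\mathcal P)|^3)$ an equivalent proper normal power circuit $\mathcal P'$ whose zero signs are all $+1$. The circuit $\mathcal P'$ satisfies $|V(\mathcal P')|\le 2|V(\mathcal P)|$. It is unique up to isomorphism: every normal circuit equivalent to $\mathcal P$ is isomorphic to $\mathcal P'$ by a graph isomorphism that preserves marked vertices and all labels and signs except possibly zero signs, and hence is isomorphic to $\mathcal P'$ if its zero signs are all $+1$. Here time is the number of steps of a single random access machine program with unit-cost instructions (constants, copying, addition,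 truncated subtraction, multiplication, indirect load and store, comparisons), on words bounded by a fixed polynomial in $|V(\mathcal P)|$, i.e. of $O(\log |V(\mathcal P)|)$ bits when $|V(\mathcal P)|\ge 2$. Circuits are given and output as the number of vertices, followed by the list of signs ($0$ for unmarked vertices) and the adjacency matrix of labels ($0$ for no edge). -/

import Mathlib

/-- A constant power circuit with (finite) vertex set `V`: a directed acyclic graph without multiple
edges whose edges carry labels in `{1, -1}`, together with a nonempty set of marked vertices, each
carrying a sign in `{1, -1}`.  `edge v w = 0` means that there is no edge `v → w`; otherwise
`edge v w` is its label.  `mark v = 0` means that `v` is not marked; otherwise `mark v` is its sign.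
Every leaf carries the constant `0`. -/
structure PowerCircuit (V : Type*) where
  edge : V → V → SignType
  mark : V → SignType
  acyclic : ∀ v, ¬ Relation.TransGen (fun u w => edge u w ≠ 0) v v
  marked_nonempty : ∃ v, mark v ≠ 0

namespace PowerCircuit

variable {V W : Type*}

/-- `w` is reachable from `v` along a directed path (possibly of length zero). -/
def Reachable (P : PowerCircuit V) (v w : V) : Prop :=
  Relation.ReflTransGen (fun u u' => P.edge u u' ≠ 0) v w

/-- A vertex without outgoing edges.  In a constant circuit these are exactly the zero vertices. -/
def IsZero (P : PowerCircuit V) (v : V) : Prop := ∀ w, P.edge v w = 0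

theorem wf [Finite V] (P : PowerCircuit V) : WellFounded (fun w v => P.edge v w ≠ 0) := by
  have h : WellFounded (Function.swap (Relation.TransGen (fun u w => P.edge u w ≠ 0))) := by
    have : Std.Irrefl (Function.swap (Relation.TransGen (fun u w => P.edge u w ≠ 0))) :=
      ⟨fun v hv => P.acyclic v hv⟩
    have : IsTrans V (Function.swap (Relation.TransGen (fun u w => P.edge u w ≠ 0))) :=
      ⟨fun a b c hab hbc => Relation.TransGen.trans hbc hab⟩
    exact Finite.wellFounded_of_trans_of_irrefl _
  exact Subrelation.wf (r := Function.swap (Relation.TransGen (fun u w => P.edge u w ≠ 0)))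
    (fun {_ _} hvw => Relation.TransGen.single hvw) h

open Classical in
/-- The real number `ℰ(v)` at a vertex `v`; see `eval_eq` for the recursion that defines it. -/
noncomputable def eval [Fintype V] (P : PowerCircuit V) : V → ℝ :=
  P.wf.fix fun v rec =>
    if P.IsZero v then 0
    else (2 : ℝ) ^ (∑ w, if h : P.edge v w ≠ 0 then ((P.edge v w : SignType) : ℝ) * rec w h else 0)

open Classical in
/-- `ℰ(v) = 0` if `v` is a leaf, and `ℰ(v) = 2 ^ (∑ μ(e) ℰ(β(e)))`, the sum over the edges `e`
leaving `v`, otherwise. -/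
theorem eval_eq [Fintype V] (P : PowerCircuit V) (v : V) :
    P.eval v = if P.IsZero v then 0
      else (2 : ℝ) ^ (∑ w, ((P.edge v w : SignType) : ℝ) * P.eval w) := by
  rw [eval, WellFounded.fix_eq]
  split_ifs with hv
  · rfl
  · congr 1
    refine Finset.sum_congr rfl fun w _ => ?_
    by_cases h : P.edge v w = 0
    · simp [h]
    · simp [h]

/-- The real number `ℰ(P)` represented by the circuit. -/
noncomputable def value [Fintype V] (P : PowerCircuit V) : ℝ :=
  ∑ v, ((P.mark v : SignType) : ℝ) * P.eval v

/-- Two constant circuits are equivalent if they represent the same number. -/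
def Equivalent [Fintype V] [Fintype W] (P : PowerCircuit V) (Q : PowerCircuit W) : Prop :=
  P.value = Q.value

/-- All vertices have natural numbers (including `0`) as values. -/
def Proper [Fintype V] (P : PowerCircuit V) : Prop := ∀ v, ∃ k : ℕ, P.eval v = k

def Trimmed (P : PowerCircuit V) : Prop := ∀ v, ∃ u, P.mark u ≠ 0 ∧ P.Reachable u v

/-- The edge `v → z` into a zero vertex is redundant if it is not the only edge leaving `v`. -/
def HasRedundantZeroEdge (P : PowerCircuit V) : Prop :=
  ∃ v z w, P.IsZero z ∧ P.edge v z ≠ 0 ∧ P.edge v w ≠ 0 ∧ w ≠ z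

/-- The circuit consists of a single vertex (which is marked, as some vertex is marked). -/
def Trivial (_P : PowerCircuit V) : Prop := Subsingleton V

/-- Standard form.  The trivial circuit, the only one in which the zero vertex has to be marked,
counts as standard. -/
def Standard (P : PowerCircuit V) : Prop :=
  P.Trimmed ∧
    (P.Trivial ∨
      ((∃! z, P.IsZero z) ∧ (∀ z, P.IsZero z → P.mark z = 0) ∧ ¬ P.HasRedundantZeroEdge))

/-- Two edges `v → v₁`, `v → v₂` with opposite labels and `ℰ(v₁) = ℰ(v₂)`. -/
def HasRedundantPair [Fintype V] (P : PowerCircuit V) : Prop :=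
  ∃ v v₁ v₂, P.edge v v₁ ≠ 0 ∧ P.edge v v₂ ≠ 0 ∧ P.edge v v₁ = -P.edge v v₂ ∧
    P.eval v₁ = P.eval v₂

/-- Two edges `v → v₁`, `v → v₂` with opposite labels and `ℰ(v₁) = 2 ℰ(v₂)`. -/
def HasSuperfluousPair [Fintype V] (P : PowerCircuit V) : Prop :=
  ∃ v v₁ v₂, P.edge v v₁ ≠ 0 ∧ P.edge v v₂ ≠ 0 ∧ P.edge v v₁ = -P.edge v v₂ ∧
    P.eval v₁ = 2 * P.eval v₂

def Reduced [Fintype V] (P : PowerCircuit V) : Prop :=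
  P.Standard ∧ (∀ v₁ v₂, P.eval v₁ = P.eval v₂ ↔ v₁ = v₂) ∧
    ¬ P.HasRedundantPair ∧ ¬ P.HasSuperfluousPair

/-- The exponents `q₁, q₂, …` of a compact binary sum `∑ εᵢ 2 ^ qᵢ`: strictly decreasing, and
consecutive ones differ by at least `2`. -/
def CompactExponents (q : List ℕ) : Prop := q.IsChain fun a b => b + 2 ≤ a

/-- A sum `∑_{v ∈ S} ± ℰ(v)` is a compact binary sum after a suitable enumeration of `S`.
The term of a zero vertex equals `0` and is not a term of the binary sum. -/
def CompactOn [Fintype V] (P : PowerCircuit V) (S : Set V) : Prop :=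
  ∃ (l : List V) (q : V → ℕ), l.Nodup ∧ (∀ v, v ∈ l ↔ v ∈ S ∧ ¬ P.IsZero v) ∧
    (∀ v ∈ l, P.eval v = 2 ^ q v) ∧ CompactExponents (l.map q)

/-- Normal form: proper and reduced, and the exponent sums at all vertices and the sum
`ℰ(P) = ∑_{v ∈ M} ν(v) ℰ(v)` are compact. -/
def Normal [Fintype V] (P : PowerCircuit V) : Prop :=
  (P.Proper ∧ P.Reduced) ∧ (∀ v, P.CompactOn {w | P.edge v w ≠ 0}) ∧ P.CompactOn {v | P.mark v ≠ 0}

/-- The signs that have no influence on any value (the labels of edges into zero vertices and the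
signs of marked zero vertices) are all `1`. -/
def ZeroSignsPositive (P : PowerCircuit V) : Prop :=
  ∀ z, P.IsZero z → (∀ v, P.edge v z ≠ -1) ∧ P.mark z ≠ -1

/-- Isomorphism: a graph isomorphism that preserves the marked vertices, the labels and the signs. -/
def Isomorphic (P : PowerCircuit V) (Q : PowerCircuit W) : Prop :=
  ∃ f : V ≃ W, (∀ v w, Q.edge (f v) (f w) = P.edge v w) ∧ ∀ v, Q.mark (f v) = P.mark v

/-- A graph isomorphism that preserves the marked vertices, and the labels and signs except possibly
the labels of edges into zero vertices and the signs of marked zero vertices. -/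
def IsomorphicUpToZeroSigns (P : PowerCircuit V) (Q : PowerCircuit W) : Prop :=
  ∃ f : V ≃ W,
    (∀ v w, Q.edge (f v) (f w) ≠ 0 ↔ P.edge v w ≠ 0) ∧
    (∀ v, Q.mark (f v) ≠ 0 ↔ P.mark v ≠ 0) ∧
    (∀ v w, ¬ P.IsZero w → Q.edge (f v) (f w) = P.edge v w) ∧
    ∀ v, ¬ P.IsZero v → Q.mark (f v) = P.mark v

end PowerCircuit

/-! A random access machine with unit-cost instructions, bounded machine words and structured
control flow. -/

namespace RAM

/-- A configuration: registers and memory cells, all holding natural numbers. -/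
structure Config where
  reg : ℕ → ℕ
  mem : ℕ → ℕ

/-- Write `a` into register `x`. -/
def Config.setReg (s : Config) (x a : ℕ) : Config := { s with reg := Function.update s.reg x a }

/-- Write `a` into the memory cell with address `i`. -/
def Config.setMem (s : Config) (i a : ℕ) : Config := { s with mem := Function.update s.mem i a }

/-- Tests: comparison of the contents of two registers. -/
inductive Test where
  | lt (x y : ℕ)
  | eq (x y : ℕ)

def Test.Holds (s : Config) : Test → Prop
  | .lt x y => s.reg x < s.reg y
  | .eq x y => s.reg x = s.reg y

/-- Programs.  All arguments `x y z` are (fixed) register numbers. -/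
inductive Prog where
  /-- do nothing -/
  | skip
  /-- `x := c` -/
  | const (x c : ℕ)
  /-- `x := y` -/
  | copy (x y : ℕ)
  /-- `x := y + z` -/
  | plus (x y z : ℕ)
  /-- `x := max (y - z) 0` -/
  | minus (x y z : ℕ)
  /-- `x := y * z` -/
  | times (x y z : ℕ)
  /-- `x := mem[y]` -/
  | load (x y : ℕ)
  /-- `mem[x] := y` -/
  | store (x y : ℕ)
  /-- `p; q` -/
  | seq (p q : Prog)
  /-- `if b then p else q` -/
  | branch (b : Test) (p q : Prog)
  /-- `while b do p` -/
  | loop (b : Test) (p : Prog)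

/-- `Exec B p s s' t`: started in the configuration `s`, the program `p` halts in the configuration
`s'` after exactly `t` steps, where each elementary instruction and each evaluation of a test is one
step.  No number greater than the word bound `B` is ever produced: an instruction whose result would
exceed `B` cannot be executed. -/
inductive Exec (B : ℕ) : Prog → Config → Config → ℕ → Prop where
  | skip (s) : Exec B .skip s s 1
  | const (s x c) : c ≤ B → Exec B (.const x c) s (s.setReg x c) 1
  | copy (s x y) : Exec B (.copy x y) s (s.setReg x (s.reg y)) 1
  | plus (s x y z) : s.reg y + s.reg z ≤ B →
      Exec B (.plus x y z) s (s.setReg x (s.reg y + s.reg z)) 1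
  | minus (s x y z) : Exec B (.minus x y z) s (s.setReg x (s.reg y - s.reg z)) 1
  | times (s x y z) : s.reg y * s.reg z ≤ B →
      Exec B (.times x y z) s (s.setReg x (s.reg y * s.reg z)) 1
  | load (s x y) : Exec B (.load x y) s (s.setReg x (s.mem (s.reg y))) 1
  | store (s x y) : Exec B (.store x y) s (s.setMem (s.reg x) (s.reg y)) 1
  | seq {p q s s' s'' t t'} : Exec B p s s' t → Exec B q s' s'' t' → Exec B (.seq p q) s s'' (t + t')
  | branch_true {b p q s s' t} : b.Holds s → Exec B p s s' t → Exec B (.branch b p q) s s' (t + 1)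
  | branch_false {b p q s s' t} : ¬ b.Holds s → Exec B q s s' t →
      Exec B (.branch b p q) s s' (t + 1)
  | loop_true {b p s s' s'' t t'} : b.Holds s → Exec B p s s' t → Exec B (.loop b p) s' s'' t' →
      Exec B (.loop b p) s s'' (t + t' + 1)
  | loop_false {b p s} : ¬ b.Holds s → Exec B (.loop b p) s s 1

/-- Encoding of `0`, `1`, `-1` by the numbers `0`, `1`, `2`. -/
def signCode : SignType → ℕ
  | .zero => 0
  | .pos => 1
  | .neg => 2

/-- Memory image of a circuit with vertex set `{0, …, n - 1}`: the number `n`, then the `n` signs of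
the vertices, then the `n * n` entries of the adjacency matrix row by row, then zeros. -/
def encode {n : ℕ} (P : PowerCircuit (Fin n)) (a : ℕ) : ℕ :=
  if a = 0 then n
  else if h : a - 1 < n then signCode (P.mark ⟨a - 1, h⟩)
  else if h : a - 1 - n < n * n then
    let vw := finProdFinEquiv.symm (⟨a - 1 - n, h⟩ : Fin (n * n))
    signCode (P.edge vw.1 vw.2)
  else 0

/-- The initial configuration on input `P`: all registers are `0` and the memory holds `P`. -/
def input {n : ℕ} (P : PowerCircuit (Fin n)) : Config where
  reg := fun _ => 0
  mem := encode P

/-- The circuit `Q` is the output in the configuration `s`: it is stored in memory from the address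
held by register `0` on. -/
def IsOutput {m : ℕ} (Q : PowerCircuit (Fin m)) (s : Config) : Prop :=
  ∀ a ≤ m + m * m, s.mem (s.reg 0 + a) = encode Q a

end RAM

/-! A compact binary sum is the non-adjacent form (NAF) of its value, and every integer has exactly
one NAF. In a proper circuit a nonzero vertex has value `2 ^ p` with a natural number `p`, and in a
reduced one `p` identifies the vertex. So if a normal circuit has value `x`, its marks are the
digits of the NAF of `x`, the edges leaving `2 ^ p` are the digits of the NAF of `p`, and, since
every vertex is reachable from a mark, the exponents that occur are exactly those obtained from `x`
by repeatedly passing to digit positions of NAFs (`Needed`). Everything except the zero signs is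
forced: this is `Normal.isCanonical`, and `IsCanonical.isomorphic` turns it into uniqueness.
Conversely the circuit built from these data is normal (`IsCanonical.normal`) and exists for every
integer (`RAM.canonical`).

It remains to bound the number of needed exponents and to find them, although they may be
astronomically large. Let `μ b` be the number of nonzero vertices of the given circuit with exponent
`b`. Each exponent, and the value of the circuit, is a sum whose coefficient at `2 ^ b` has absolute
value at most `μ b`. A NAF is computed from such coefficients with carries, and bounds for the
coefficients alone give bounds for the carries (`carryBound`); where both bounds vanish, the digit
is `0`. Increase `μ 0` by a padding `J` that exceeds all multiplicities, and call the other places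
positions. Since carries roughly halve from place to place, every position has the form `e + j` with
an exponent `e` and `j ≤ J` (`exists_sub_le_of_carrySupport`). But `e + j` is then the sum for `e`
with its coefficient at `1` increased by `j`, so its NAF again lives on positions: they are closed
under the step of `Needed` and contain all needed exponents (`carrySupport_of_needed`). By an
amortised count (`count_carrySupport_le_aux`) a small padding gives at most `2 * k + 1` positions
for `k` nonzero vertices. Together with the zero vertex and `k < n` this yields the bound `2 * n`.
The cruder padding `n + 1` gives the at most `4 * n + 4` positions on which the program works.

The program needs the order of the exponents, and their differences only up to a linear bound. It
treats the vertices in topological order and compares two of them by Horner's scheme for the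
difference of their exponent sums over the vertices sorted already, confining all intermediate
results to an interval of linear size (`Near.step`). With the sorted list it enumerates the
positions, computes the NAFs of the value and of all positions by carrying, propagates need from
large to small positions, and writes the circuit. It is written in a small loop language that is
compiled to the machine; loops of `O(n)` rounds nested three deep give cubic time. -/

set_option linter.constructorNameAsVariable false
set_option linter.unusedSimpArgs false

/-! ### Non-adjacent forms of integers -/

/-- The least significant digit of the non-adjacent form of `x`. -/
def nafHead (x : ℤ) : SignType := if x % 2 = 0 then 0 else if x % 4 = 1 then 1 else -1

/-- What remains of `x` after its least significant digit has been split off. -/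
def nafTail (x : ℤ) : ℤ := (x - (nafHead x : ℤ)) / 2

/-- The digit at `2 ^ i` of the non-adjacent form of `x`. -/
def naf (x : ℤ) (i : ℕ) : SignType := nafHead (nafTail^[i] x)

theorem nafHead_cast (x : ℤ) :
    ((nafHead x : SignType) : ℤ) = if x % 2 = 0 then 0 else if x % 4 = 1 then 1 else -1 := by
  unfold nafHead
  split_ifs <;> simp

theorem nafHead_eq_zero_iff (x : ℤ) : nafHead x = 0 ↔ x % 2 = 0 := by
  unfold nafHead
  split_ifs <;> simp_all

theorem nafHead_add_two_mul_nafTail (x : ℤ) : (nafHead x : ℤ) + 2 * nafTail x = x := by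
  unfold nafTail
  rw [nafHead_cast]
  split_ifs <;> omega

theorem nafTail_zero : nafTail 0 = 0 := by simp [nafTail, nafHead]

theorem nafTail_iterate_zero (i : ℕ) : nafTail^[i] 0 = 0 := by
  induction i with
  | zero => rfl
  | succ i ih => rw [Function.iterate_succ_apply, nafTail_zero, ih]

theorem naf_zero_left (i : ℕ) : naf 0 i = 0 := by
  simp [naf, nafTail_iterate_zero, nafHead]

theorem naf_zero_right (x : ℤ) : naf x 0 = nafHead x := rfl

theorem naf_succ (x : ℤ) (i : ℕ) : naf x (i + 1) = naf (nafTail x) i := by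
  simp [naf]

theorem natAbs_nafTail_lt {x : ℤ} (hx : x ≠ 0) : (nafTail x).natAbs < x.natAbs := by
  have h := nafHead_add_two_mul_nafTail x
  rw [nafHead_cast] at h
  split_ifs at h <;> omega

/-- An odd `x` gets the digit congruent to it modulo `4`, so what remains after halving is even.
This is the source of non-adjacency. -/
theorem nafHead_nafTail {x : ℤ} (hx : nafHead x ≠ 0) : nafHead (nafTail x) = 0 := by
  have h := nafHead_add_two_mul_nafTail x
  rw [Ne, nafHead_eq_zero_iff] at hx
  rw [nafHead_eq_zero_iff]
  rw [nafHead_cast] at h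
  split_ifs at h <;> omega

theorem naf_succ_eq_zero {x : ℤ} {i : ℕ} (h : naf x i ≠ 0) : naf x (i + 1) = 0 := by
  unfold naf at *
  rw [Function.iterate_succ_apply']
  exact nafHead_nafTail h

/-- Each step strictly shrinks a nonzero number. The bound is far from sharp but gives every digit
sum an explicit finite range. -/
theorem natAbs_nafTail_iterate (x : ℤ) (i : ℕ) :
    nafTail^[i] x = 0 ∨ (nafTail^[i] x).natAbs + i ≤ x.natAbs := by
  induction i with
  | zero => right; simp
  | succ i ih =>
    rw [Function.iterate_succ_apply']
    by_cases h0 : nafTail^[i] x = 0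
    · left; rw [h0, nafTail_zero]
    · have := natAbs_nafTail_lt h0
      rcases ih with ih | ih
      · exact absurd ih h0
      · right; omega

theorem lt_natAbs_of_naf_ne_zero {x : ℤ} {i : ℕ} (h : naf x i ≠ 0) : i < x.natAbs := by
  rcases natAbs_nafTail_iterate x i with h' | h'
  · exact absurd (by simp [naf, h', nafHead]) h
  · by_contra hc
    have : nafTail^[i] x = 0 := by omega
    exact h (by simp [naf, this, nafHead])

/-- Edges of a canonical circuit thus lead to smaller powers, which gives acyclicity and lets needed
exponents be found from the top downwards. -/
theorem lt_of_naf_natCast_ne_zero {b i : ℕ} (h : naf (b : ℤ) i ≠ 0) : i < b := by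
  simpa using lt_natAbs_of_naf_ne_zero h

/-- The non-adjacent form represents the number. -/
theorem sum_naf (N : ℕ) : ∀ x : ℤ, x.natAbs ≤ N →
    ∑ i ∈ Finset.range N, (naf x i : ℤ) * 2 ^ i = x := by
  induction N with
  | zero => intro x hx; simp at hx; simp [hx]
  | succ N ih =>
    intro x hx
    rw [Finset.sum_range_succ']
    by_cases h0 : x = 0
    · simp [h0, naf_zero_left]
    have h1 := natAbs_nafTail_lt h0
    have h2 := ih (nafTail x) (by omega)
    have h3 := nafHead_add_two_mul_nafTail x
    rw [naf_zero_right]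
    have : ∑ k ∈ Finset.range N, (naf x (k + 1) : ℤ) * 2 ^ (k + 1)
        = 2 * ∑ k ∈ Finset.range N, (naf (nafTail x) k : ℤ) * 2 ^ k := by
      rw [Finset.mul_sum]
      refine Finset.sum_congr rfl fun k _ => ?_
      rw [naf_succ]; ring
    rw [this, h2]
    linarith

/-- Non-adjacent forms are unique. -/
theorem naf_unique (N : ℕ) : ∀ (d : ℕ → SignType) (x : ℤ), (∀ i, d i ≠ 0 → d (i + 1) = 0) →
    (∀ i, N ≤ i → d i = 0) → ∑ i ∈ Finset.range N, (d i : ℤ) * 2 ^ i = x → ∀ i, naf x i = d i := by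
  induction N with
  | zero =>
    intro d x _ h2 h3 i
    simp at h3
    rw [h2 i (Nat.zero_le _), ← h3, naf_zero_left]
  | succ N ih =>
    intro d x h1 h2 h3
    rw [Finset.sum_range_succ'] at h3
    set y : ℤ := ∑ k ∈ Finset.range N, (d (k + 1) : ℤ) * 2 ^ k with hy
    have hsum : ∑ k ∈ Finset.range N, (d (k + 1) : ℤ) * 2 ^ (k + 1) = 2 * y := by
      rw [hy, Finset.mul_sum]
      exact Finset.sum_congr rfl fun k _ => by ring
    have hyn := ih (fun k => d (k + 1)) y (fun i => h1 (i + 1)) (fun i hi => h2 _ (by omega)) hy.symm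
    have hx : x = d 0 + 2 * y := by rw [← h3, hsum]; simp; ring
    -- After a nonzero digit the rest is even, so `x` modulo `4` determines the lowest digit.
    have hd1 : d 0 ≠ 0 → y % 2 = 0 := fun h => by
      rw [← nafHead_eq_zero_iff, ← naf_zero_right, hyn 0]; exact h1 0 h
    have hhead : nafHead x = d 0 := by
      unfold nafHead
      rcases hd : d 0 with _ | _ | _ <;> simp only [hd] at hx hd1 <;>
        simp at hx hd1 <;> split_ifs <;> first | rfl | (exfalso; omega) 
    intro i
    cases i with
    | zero => rw [naf_zero_right, hhead]
    | succ i =>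
      rw [naf_succ]
      have : nafTail x = y := by
        have := nafHead_add_two_mul_nafTail x
        rw [hhead] at this; omega
      rw [this, hyn i]

/-! ### Computing non-adjacent forms by carrying -/

/-- The carry produced by the coefficient-plus-carry `x` if `c` is the next coefficient. -/
def carryStep (x c : ℤ) : ℤ :=
  if x % 2 = 0 then x / 2 else if (x / 2 + c) % 2 = 0 then x / 2 else x / 2 + 1

/-- The digit produced by the coefficient-plus-carry `x` if `c` is the next coefficient. -/
def carryDigit (x c : ℤ) : SignType :=
  if x % 2 = 0 then 0 else if (x / 2 + c) % 2 = 0 then 1 else -1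

/-- The carries in the sum `∑ c i * 2 ^ i`. -/
def carry (c : ℕ → ℤ) : ℕ → ℤ
  | 0 => 0
  | i + 1 => carryStep (c i + carry c i) (c (i + 1))

/-- Modulo `4` only the parity of the next coefficient matters; all higher terms are hidden in `R`.
-/
theorem nafHead_eq_carryDigit (x c R : ℤ) : nafHead (x + 2 * (c + 2 * R)) = carryDigit x c := by
  unfold nafHead carryDigit
  split_ifs <;> first | rfl | omega

theorem nafTail_eq_carryStep (x c R : ℤ) :
    nafTail (x + 2 * (c + 2 * R)) = c + 2 * R + carryStep x c := by
  have h := nafHead_add_two_mul_nafTail (x + 2 * (c + 2 * R))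
  rw [nafHead_cast] at h
  unfold carryStep
  split_ifs at h ⊢ <;> omega

/-- Think of `R i` as the terms of `∑ c i * 2 ^ i` from `i` on, divided by `2 ^ i`. Splitting off
NAF digits instead of coefficients leaves an error that is exactly the carry. -/
theorem nafTail_iterate_eq {c R : ℕ → ℤ} (h : ∀ i, R i = c i + 2 * R (i + 1)) (i : ℕ) :
    nafTail^[i] (R 0) = R i + carry c i := by
  induction i with
  | zero => simp [carry]
  | succ i ih =>
    rw [Function.iterate_succ_apply', ih, carry, h i, h (i + 1), ← nafTail_eq_carryStep]
    congr 1; ring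

theorem naf_eq_carryDigit {c R : ℕ → ℤ} (h : ∀ i, R i = c i + 2 * R (i + 1)) (i : ℕ) :
    naf (R 0) i = carryDigit (c i + carry c i) (c (i + 1)) := by
  rw [naf, nafTail_iterate_eq h, ← nafHead_eq_carryDigit _ _ (R (i + 1 + 1))]
  rw [h i, h (i + 1)]; congr 1; ring

/-- A bound for the absolute values of the carries if `m` bounds those of the coefficients. -/
def carryBound (m : ℕ → ℕ) : ℕ → ℕ
  | 0 => 0
  | i + 1 => if m i + carryBound m i ≤ 1 ∧ m (i + 1) = 0 then 0 else (m i + carryBound m i + 1) / 2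

/-- Halving may round either way, which gives `(|x| + 1) / 2`. But if `x = ±1` and the next
coefficient is `0`, then `x` itself becomes the digit and no carry is left; hence the first case of
`carryBound`. -/
theorem abs_carry_le {c : ℕ → ℤ} {m : ℕ → ℕ} (h : ∀ i, |c i| ≤ m i) (i : ℕ) :
    |carry c i| ≤ carryBound m i := by
  induction i with
  | zero => simp [carry, carryBound]
  | succ i ih =>
    have h1 := h i
    have h2 := h (i + 1)
    rw [carry, carryBound, carryStep]
    rw [abs_le] at *
    split_ifs <;> push_cast <;> omega

/-- Positions at which a non-adjacent form may have a nonzero digit. -/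
def CarrySupport (m : ℕ → ℕ) (i : ℕ) : Prop := 0 < m i + carryBound m i

instance (m : ℕ → ℕ) : DecidablePred (CarrySupport m) := fun i => by
  unfold CarrySupport; infer_instance

theorem carrySupport_of_naf_ne_zero {c R : ℕ → ℤ} (h : ∀ i, R i = c i + 2 * R (i + 1))
    {m : ℕ → ℕ} (hm : ∀ i, |c i| ≤ m i) {i : ℕ} (hi : naf (R 0) i ≠ 0) : CarrySupport m i := by
  by_contra hc
  unfold CarrySupport at hc
  have h1 := hm i
  have h2 := abs_carry_le hm i
  rw [abs_le] at h1 h2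
  have h3 : c i + carry c i = 0 := by omega
  rw [naf_eq_carryDigit h, h3] at hi
  exact hi (by simp [carryDigit])

/-! ### The number of positions -/

/-- The multiplicities `μ`, increased by `J` at the position `0`. -/
def padded (μ : ℕ → ℕ) (J i : ℕ) : ℕ := μ i + if i = 0 then J else 0

theorem padded_zero (μ : ℕ → ℕ) (J : ℕ) : padded μ J 0 = μ 0 + J := by simp [padded]

theorem padded_succ (μ : ℕ → ℕ) (J i : ℕ) : padded μ J (i + 1) = μ (i + 1) := by simp [padded]

/-- The bound `J` reproduces itself: `(μ i + J + 1) / 2 ≤ J` because `μ i + 1 ≤ J`. -/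
theorem carryBound_padded_le {μ : ℕ → ℕ} {J : ℕ} (hJ : ∀ i, μ i + 1 ≤ J) (i : ℕ) :
    carryBound (padded μ J) i ≤ J := by
  induction i with
  | zero => simp [carryBound]
  | succ i ih =>
    rw [carryBound]
    have := hJ i
    cases i with
    | zero => rw [padded_zero, carryBound]; split_ifs <;> omega
    | succ i => rw [padded_succ]; split_ifs <;> omega

/-- Take for `e` the last exponent up to `b`. Right after `e` the carry bound is at most `J`, and
while no summands occur it drops by at least `1` per place, so distance plus remaining bound never
exceeds `J + 1`. -/
theorem exists_of_carrySupport {μ : ℕ → ℕ} {J : ℕ} (hJ : ∀ i, μ i + 1 ≤ J) (h0 : 0 < μ 0) (b : ℕ)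
    (hb : CarrySupport (padded μ J) b) :
    ∃ e ≤ b, 0 < μ e ∧ (e < b → b - e + carryBound (padded μ J) b ≤ J + 1 ∧
      0 < carryBound (padded μ J) b) := by
  induction b with
  | zero => exact ⟨0, le_rfl, h0, by omega⟩
  | succ b ih =>
    by_cases hμ : 0 < μ (b + 1)
    · exact ⟨b + 1, le_rfl, hμ, by omega⟩
    have hb' : 0 < carryBound (padded μ J) (b + 1) := by
      unfold CarrySupport at hb; rw [padded_succ] at hb; omega
    have hstep : carryBound (padded μ J) (b + 1) =
        if padded μ J b + carryBound (padded μ J) b ≤ 1 ∧ padded μ J (b + 1) = 0 then 0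
          else (padded μ J b + carryBound (padded μ J) b + 1) / 2 := rfl
    rw [padded_succ] at hstep
    by_cases hμb : 0 < μ b
    · have := carryBound_padded_le hJ (b + 1)
      exact ⟨b, by omega, hμb, fun _ => by omega⟩
    have hbpos : b ≠ 0 := by rintro rfl; exact hμb h0
    obtain ⟨b', rfl⟩ := Nat.exists_eq_succ_of_ne_zero hbpos
    rw [Nat.succ_eq_add_one] at *
    rw [padded_succ] at hstep
    obtain ⟨e, he, hμe, h⟩ := ih (by unfold CarrySupport; split_ifs at hstep <;> omega)
    have hne : e ≠ b' + 1 := by rintro rfl; omega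
    obtain ⟨h1, h2⟩ := h (by omega)
    refine ⟨e, by omega, hμe, fun _ => ?_⟩
    split_ifs at hstep <;> omega

/-- This makes the set of positions closed: if `e` is the sum of a row, then `e + j` is the sum of
that row with its coefficient at `1` increased by `j ≤ J`, for which the padding leaves room. -/
theorem exists_sub_le_of_carrySupport {μ : ℕ → ℕ} {J : ℕ} (hJ : ∀ i, μ i + 1 ≤ J) (h0 : 0 < μ 0)
    (b : ℕ) (hb : CarrySupport (padded μ J) b) : ∃ e j, b = e + j ∧ j ≤ J ∧ 0 < μ e := by
  obtain ⟨e, he, hμ, h⟩ := exists_of_carrySupport hJ h0 b hb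
  refine ⟨e, b - e, by omega, ?_, hμ⟩
  by_cases hlt : e < b
  · have := h hlt; omega
  · omega

/-- The carry bound acts as a credit. A place without summands is a position only if there is credit
left, and it uses up a unit; a place with `μ > 0` summands increases count plus credit by at most `μ
+ 1`. The conditional `- 1` is for the place before an exponent, where a bound `1` stays `1` instead
of vanishing; the missing unit is charged to the exponent. -/
theorem count_carrySupport_le_aux (μ : ℕ → ℕ) (J N : ℕ) :
    Nat.count (CarrySupport (padded μ J)) (N + 1) + (carryBound (padded μ J) (N + 1) -
      if 0 < μ (N + 1) ∧ 0 < carryBound (padded μ J) (N + 1) then 1 else 0) ≤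
    1 + (μ 0 + J + 1) / 2 + ∑ i ∈ Finset.range N, if 0 < μ (i + 1) then μ (i + 1) + 1 else 0 := by
  induction N with
  | zero =>
    have h1 : Nat.count (CarrySupport (padded μ J)) (0 + 1) ≤ 1 := by
      simpa using Nat.count_le (p := CarrySupport (padded μ J)) (n := 1)
    have h2 : carryBound (padded μ J) (0 + 1) ≤ (μ 0 + J + 1) / 2 := by
      rw [carryBound, padded_zero, carryBound]; split_ifs <;> omega
    simp only [Finset.range_zero, Finset.sum_empty]
    omega
  | succ N ih =>
    rw [Nat.count_succ, Finset.sum_range_succ]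
    have hstep : carryBound (padded μ J) (N + 1 + 1) =
        if padded μ J (N + 1) + carryBound (padded μ J) (N + 1) ≤ 1 ∧ padded μ J (N + 1 + 1) = 0
          then 0 else (padded μ J (N + 1) + carryBound (padded μ J) (N + 1) + 1) / 2 := rfl
    rw [padded_succ, padded_succ] at hstep
    have hs : CarrySupport (padded μ J) (N + 1) ↔
        0 < μ (N + 1) + carryBound (padded μ J) (N + 1) := by
      unfold CarrySupport; rw [padded_succ]
    simp only [hs]
    generalize carryBound (padded μ J) (N + 1 + 1) = w' at *
    generalize carryBound (padded μ J) (N + 1) = w at *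
    generalize μ (N + 1) = a at *
    generalize μ (N + 1 + 1) = a' at *
    split_ifs at * <;> omega

theorem count_carrySupport_le (μ : ℕ → ℕ) (J N : ℕ) :
    Nat.count (CarrySupport (padded μ J)) (N + 1) ≤
      1 + (μ 0 + J + 1) / 2 + 2 * ∑ i ∈ Finset.range N, μ (i + 1) := by
  have h := count_carrySupport_le_aux μ J N
  have : ∑ i ∈ Finset.range N, (if 0 < μ (i + 1) then μ (i + 1) + 1 else 0) ≤
      2 * ∑ i ∈ Finset.range N, μ (i + 1) := by
    rw [Finset.mul_sum]
    exact Finset.sum_le_sum fun i _ => by split_ifs <;> omega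
  omega

/-- With the least admissible padding there are at most twice as many positions as summands. -/
theorem count_carrySupport_le_two_mul (μ : ℕ → ℕ) (h0 : 0 < μ 0) (N : ℕ) :
    Nat.count (CarrySupport (padded μ (∑ i ∈ Finset.range (N + 1), (μ i - 1) + 2))) (N + 1) ≤
      2 * ∑ i ∈ Finset.range (N + 1), μ i + 1 := by
  have h := count_carrySupport_le_aux μ (∑ i ∈ Finset.range (N + 1), (μ i - 1) + 2) N
  -- A place with `μ > 0` summands contributes `μ + 1` to the count and `μ - 1` to the padding,
  -- together `2 * μ`, and only half of the padding enters the bound.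
  have h2 : ∑ i ∈ Finset.range N, (if 0 < μ (i + 1) then μ (i + 1) + 1 else 0) +
      ∑ i ∈ Finset.range N, (μ (i + 1) - 1) = 2 * ∑ i ∈ Finset.range N, μ (i + 1) := by
    rw [Finset.mul_sum, ← Finset.sum_add_distrib]
    exact Finset.sum_congr rfl fun i _ => by split_ifs <;> omega
  rw [Finset.sum_range_succ' (fun i => μ i)]
  rw [Finset.sum_range_succ' (fun i => μ i - 1)] at h ⊢
  omega

/-! ### Canonical circuits -/

/-- The exponents `p` for which a normal circuit of value `x` needs a vertex of value `2 ^ p`. -/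
inductive Needed (x : ℤ) : ℕ → Prop
  | base {p : ℕ} : naf x p ≠ 0 → Needed x p
  | step {b p : ℕ} : Needed x b → naf (b : ℤ) p ≠ 0 → Needed x p

theorem Needed.lt_natAbs {x : ℤ} {p : ℕ} (h : Needed x p) : p < x.natAbs := by
  induction h with
  | base h => exact lt_natAbs_of_naf_ne_zero h
  | step _ h ih => exact (lt_of_naf_natCast_ne_zero h).trans ih

theorem exists_naf_ne_zero {x : ℤ} (hx : x ≠ 0) : ∃ p, naf x p ≠ 0 := by
  by_contra! hc
  have := sum_naf x.natAbs x le_rfl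
  exact hx (by rw [← this]; exact Finset.sum_eq_zero fun i _ => by simp [hc i])

theorem exists_needed_iff {x : ℤ} : (∃ p, Needed x p) ↔ x ≠ 0 := by
  constructor
  · rintro ⟨p, hp⟩ rfl
    simpa using hp.lt_natAbs
  · intro hx
    obtain ⟨p, hp⟩ := exists_naf_ne_zero hx
    exact ⟨p, .base hp⟩

/-- Passing to a digit position decreases the exponent, so every chain ends at `0`. The vertex `2 ^
0` is the one with the edge into the zero vertex. -/
theorem Needed.zero {x : ℤ} {p : ℕ} (h : Needed x p) : Needed x 0 := by
  induction p using Nat.strong_induction_on with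
  | _ p ih =>
    by_cases hp : p = 0
    · exact hp ▸ h
    · obtain ⟨q, hq⟩ := exists_naf_ne_zero (x := (p : ℤ)) (by exact_mod_cast hp)
      exact ih q (lt_of_naf_natCast_ne_zero hq) (h.step hq)

/-- The number `2 ^ p`, or `0` if no exponent is given. -/
def powOrZero : Option ℕ → ℤ
  | none => 0
  | some p => 2 ^ p

/-- Translates sums over vertices into digit sums: vertices without exponent contribute `0`, the
others are determined by their exponents. It serves both to evaluate canonical circuits and to
recognise compact sums. -/
theorem sum_mul_powOrZero {V : Type*} [Fintype V] {f : V → Option ℕ}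
    (hf : ∀ v w p, f v = some p → f w = some p → v = w) {d : ℕ → SignType} {s : V → SignType}
    (hds : ∀ v p, f v = some p → d p = s v) (hd : ∀ p, d p ≠ 0 → ∃ v, f v = some p) {N : ℕ}
    (hN : ∀ p, d p ≠ 0 → p < N) :
    ∑ v, (s v : ℤ) * powOrZero (f v) = ∑ p ∈ Finset.range N, (d p : ℤ) * 2 ^ p := by
  have key : ∀ v, (s v : ℤ) * powOrZero (f v) ≠ 0 → ∃ p, f v = some p ∧ s v ≠ 0 := by
    intro v hv
    rcases hfv : f v with _ | p
    · simp [hfv, powOrZero] at hv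
    · exact ⟨p, rfl, by rintro h; simp [h] at hv⟩
  refine Finset.sum_bij_ne_zero (fun v _ _ => (f v).getD 0) ?_ ?_ ?_ ?_
  · intro v _ hv
    obtain ⟨p, hp, hs⟩ := key v hv
    simp only [hp, Option.getD_some, Finset.mem_range]
    exact hN p (hds v p hp ▸ hs)
  · intro v _ hv w _ hw hvw
    obtain ⟨p, hp, -⟩ := key v hv
    obtain ⟨q, hq, -⟩ := key w hw
    simp only [hp, hq, Option.getD_some] at hvw
    subst hvw
    exact hf v w p hp hq
  · intro p _ hp
    have hdp : d p ≠ 0 := by rintro h; simp [h] at hp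
    obtain ⟨v, hv⟩ := hd p hdp
    refine ⟨v, Finset.mem_univ _, ?_, by simp [hv]⟩
    rw [hv, ← hds v p hv]; exact hp
  · intro v _ hv
    obtain ⟨p, hp, -⟩ := key v hv
    simp [hp, powOrZero, hds v p hp]

namespace PowerCircuit

variable {V W : Type*}

/-- `f` identifies the vertices of `R` with the zero vertex and the needed exponents so that edges
and marks are given by non-adjacent forms, up to zero signs. -/
structure IsCanonical (R : PowerCircuit V) (x : ℤ) (f : V → Option ℕ) : Prop where
  inj : Function.Injective f
  range : ∀ p, (∃ v, f v = some p) ↔ Needed x p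
  exists_none : ∃ v, f v = none
  edge_some : ∀ v w p q, f v = some p → f w = some q → R.edge v w = naf (p : ℤ) q
  edge_none : ∀ v w p, f v = some p → f w = none → (R.edge v w ≠ 0 ↔ p = 0)
  none_edge : ∀ v w, f v = none → R.edge v w = 0
  mark_some : ∀ v p, f v = some p → R.mark v = naf x p
  mark_none : ∀ v, f v = none → (R.mark v ≠ 0 ↔ x = 0)

namespace IsCanonical

variable {R : PowerCircuit V} {x : ℤ} {f : V → Option ℕ}

/-- A vertex with exponent `p` has an outgoing edge: into the zero vertex if `p = 0`, otherwise to a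
digit position of `p`, which is needed as well. -/
theorem isZero_iff (h : R.IsCanonical x f) (v : V) : R.IsZero v ↔ f v = none := by
  refine ⟨fun hv => ?_, fun hv w => h.none_edge v w hv⟩
  rcases hfv : f v with _ | p
  · rfl
  exfalso
  by_cases hp : p = 0
  · obtain ⟨w, hw⟩ := h.exists_none
    exact (h.edge_none v w p hfv hw).2 hp (hv w)
  · obtain ⟨q, hq⟩ := exists_naf_ne_zero (x := (p : ℤ)) (by exact_mod_cast hp)
    obtain ⟨w, hw⟩ := (h.range q).2 (((h.range p).1 ⟨v, hfv⟩).step hq)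
    exact hq (h.edge_some v w p q hfv hw ▸ hv w)

theorem exists_of_naf_ne_zero (h : R.IsCanonical x f) {v : V} {p q : ℕ} (hv : f v = some p)
    (hq : naf (p : ℤ) q ≠ 0) : ∃ w, f w = some q :=
  (h.range q).2 (((h.range p).1 ⟨v, hv⟩).step hq)

theorem sum_edge [Fintype V] (h : R.IsCanonical x f) {v : V} {p : ℕ} (hv : f v = some p) :
    ∑ w, (R.edge v w : ℤ) * powOrZero (f w) = p := by
  rw [sum_mul_powOrZero (d := naf (p : ℤ)) (fun v w p hv hw => h.inj (hv.trans hw.symm))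
    (fun w q hw => (h.edge_some v w p q hv hw).symm)
    (fun q hq => h.exists_of_naf_ne_zero hv hq) (N := (p : ℤ).natAbs)
    (fun q hq => lt_natAbs_of_naf_ne_zero hq)]
  exact sum_naf _ _ le_rfl

theorem eval_eq [Fintype V] (h : R.IsCanonical x f) (v : V) : R.eval v = powOrZero (f v) := by
  induction v using R.wf.induction with
  | _ v ih =>
    rw [PowerCircuit.eval_eq]
    rcases hfv : f v with _ | p
    · rw [if_pos ((h.isZero_iff v).2 hfv)]; simp [powOrZero]
    · rw [if_neg (by rw [h.isZero_iff, hfv]; simp)]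
      have : ∑ w, ((R.edge v w : SignType) : ℝ) * R.eval w = (p : ℝ) := by
        have h1 := congrArg (Int.cast : ℤ → ℝ) (h.sum_edge hfv)
        push_cast at h1
        rw [← h1]
        refine Finset.sum_congr rfl fun w _ => ?_
        by_cases hw : R.edge v w = 0
        · simp [hw]
        · rw [ih w hw]
      rw [this, Real.rpow_natCast]
      simp [powOrZero]

theorem value_eq [Fintype V] (h : R.IsCanonical x f) : R.value = x := by
  have h1 : ∑ w, (R.mark w : ℤ) * powOrZero (f w) = x := by
    rw [sum_mul_powOrZero (d := naf x) (fun v w p hv hw => h.inj (hv.trans hw.symm))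
      (fun w q hw => (h.mark_some w q hw).symm)
      (fun q hq => (h.range q).2 (.base hq)) (N := x.natAbs)
      (fun q hq => lt_natAbs_of_naf_ne_zero hq)]
    exact sum_naf _ _ le_rfl
  rw [← h1, value]
  push_cast
  exact Finset.sum_congr rfl fun w _ => by rw [h.eval_eq w]

theorem eval_injective [Fintype V] (h : R.IsCanonical x f) : Function.Injective R.eval := by
  intro v w hvw
  apply h.inj
  rw [h.eval_eq, h.eval_eq] at hvw
  have hvw : powOrZero (f v) = powOrZero (f w) := by exact_mod_cast hvw
  rcases hv : f v with _ | p <;> rcases hw : f w with _ | q <;> rw [hv, hw] at hvw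
  · exact absurd hvw.symm (by simp [powOrZero])
  · exact absurd hvw (by simp [powOrZero])
  · simp only [powOrZero] at hvw
    rw [Int.pow_right_injective (by norm_num) hvw]

theorem eval_some [Fintype V] (h : R.IsCanonical x f) {v : V} {p : ℕ} (hv : f v = some p) :
    R.eval v = 2 ^ p := by rw [h.eval_eq, hv]; simp [powOrZero]

theorem eq_some_of_edge (h : R.IsCanonical x f) {v w : V} (he : R.edge v w ≠ 0) :
    ∃ p, f v = some p := by
  rcases hv : f v with _ | p
  · exact absurd (h.none_edge v w hv) he
  · exact ⟨p, rfl⟩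

/-- Sort the exponents that occur in `S`; since adjacent digits are never both nonzero, a strict
decrease is one by at least `2`. -/
theorem compactOn [Fintype V] (h : R.IsCanonical x f) {S : Set V} {y : ℤ}
    (hS : ∀ v p, f v = some p → (v ∈ S ↔ naf y p ≠ 0)) : R.CompactOn S := by
  classical
  let A : Finset ℕ := (Finset.range (y.natAbs)).filter
    fun p => naf y p ≠ 0 ∧ ∃ v, f v = some p
  let L : List ℕ := A.sort (· ≥ ·)
  have hA : ∀ p, p ∈ A ↔ naf y p ≠ 0 ∧ ∃ v, f v = some p := by
    intro p
    simp only [A, Finset.mem_filter, Finset.mem_range, and_iff_right_iff_imp]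
    exact fun hp => lt_natAbs_of_naf_ne_zero hp.1
  obtain ⟨z, -⟩ := h.exists_none
  -- The default `z` is never used for an exponent in the list.
  let g : ℕ → V := fun p => if hp : ∃ v, f v = some p then hp.choose else z
  have hg : ∀ p, (∃ v, f v = some p) → f (g p) = some p := fun p hp => by
    simp only [g, dif_pos hp]; exact hp.choose_spec
  have hL : ∀ p, p ∈ L ↔ p ∈ A := fun p => Finset.mem_sort _
  refine ⟨L.map g, fun v => (f v).getD 0, ?_, ?_, ?_, ?_⟩
  · refine List.Nodup.map_on ?_ (Finset.sort_nodup _ _)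
    intro p hp q hq hpq
    have h1 := hg p ((hA p).1 ((hL p).1 hp)).2
    have h2 := hg q ((hA q).1 ((hL q).1 hq)).2
    rw [hpq, h2] at h1
    exact (Option.some.inj h1).symm
  · intro v
    rw [List.mem_map, h.isZero_iff]
    constructor
    · rintro ⟨p, hp, rfl⟩
      have hp' := (hA p).1 ((hL p).1 hp)
      have h1 := hg p hp'.2
      exact ⟨(hS _ _ h1).2 hp'.1, by rw [h1]; simp⟩
    · rintro ⟨hv, hv0⟩
      rcases hfv : f v with _ | p
      · exact absurd hfv hv0
      · exact ⟨p, (hL p).2 ((hA p).2 ⟨(hS v p hfv).1 hv, v, hfv⟩),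
          h.inj ((hg p ⟨v, hfv⟩).trans hfv.symm)⟩
  · intro v hv
    obtain ⟨p, hp, rfl⟩ := List.mem_map.1 hv
    have h1 := hg p ((hA p).1 ((hL p).1 hp)).2
    rw [h.eval_some h1]; simp [h1]
  · have : (L.map g).map (fun v => (f v).getD 0) = L := by
      rw [List.map_map]
      conv_rhs => rw [← List.map_id L]
      refine List.map_congr_left fun p hp => ?_
      simp [hg p ((hA p).1 ((hL p).1 hp)).2]
    rw [this]
    unfold CompactExponents
    apply List.Pairwise.isChain
    have h1 : L.Pairwise (· > ·) := Finset.sortedGT_sort A |>.pairwise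
    refine List.Pairwise.imp_of_mem ?_ h1
    intro a b ha hb hab
    have ha' := ((hA a).1 ((hL a).1 ha)).1
    have hb' := ((hA b).1 ((hL b).1 hb)).1
    have : a ≠ b + 1 := by rintro rfl; exact ha' (naf_succ_eq_zero hb')
    have hab : b < a := hab
    omega

/-- Paths from marks mirror derivations of `Needed`. The zero vertex is reached from the vertex with
exponent `0`, or is marked itself if the value is `0`. -/
theorem trimmed (h : R.IsCanonical x f) : R.Trimmed := by
  have key : ∀ p, Needed x p → ∀ v, f v = some p → ∃ u, R.mark u ≠ 0 ∧ R.Reachable u v := by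
    intro p hp
    induction hp with
    | @base p hp =>
      intro v hv
      exact ⟨v, by rw [h.mark_some v p hv]; exact hp, .refl⟩
    | @step b p hb hp ih =>
      intro v hv
      obtain ⟨w, hw⟩ := (h.range b).2 hb
      obtain ⟨u, hu, hr⟩ := ih w hw
      exact ⟨u, hu, hr.tail (by rw [h.edge_some w v b p hw hv]; exact hp)⟩
  intro v
  rcases hv : f v with _ | p
  · by_cases hx : x = 0
    · exact ⟨v, (h.mark_none v hv).2 hx, .refl⟩
    · obtain ⟨p, hp⟩ := exists_needed_iff.2 hx
      obtain ⟨w, hw⟩ := (h.range 0).2 hp.zero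
      obtain ⟨u, hu, hr⟩ := key 0 hp.zero w hw
      exact ⟨u, hu, hr.tail ((h.edge_none w v 0 hw hv).2 rfl)⟩
  · exact key p ((h.range p).1 ⟨v, hv⟩) v hv

theorem normal [Fintype V] (h : R.IsCanonical x f) : R.Normal := by
  have hpair : ∀ v v₁ v₂, R.edge v v₁ ≠ 0 → R.edge v v₂ ≠ 0 → R.edge v v₁ = -R.edge v v₂ →
      R.eval v₁ = 2 * R.eval v₂ → False := by
    intro v v₁ v₂ h1 h2 h3 h4
    obtain ⟨p, hp⟩ := h.eq_some_of_edge h1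
    rcases hv₁ : f v₁ with _ | q₁ <;> rcases hv₂ : f v₂ with _ | q₂
    -- For zero vertices `0 = 2 * 0` does hold, but the two edges coincide and no label is its own
    -- negative.
    · have : v₁ = v₂ := h.inj (hv₁.trans hv₂.symm)
      subst this
      revert h3 h1; rcases R.edge v v₁ with _ | _ | _ <;> decide
    · rw [h.eval_eq, h.eval_some hv₂, hv₁] at h4
      simp [powOrZero] at h4
    · rw [h.eval_eq v₂, h.eval_some hv₁, hv₂] at h4
      simp [powOrZero] at h4
    · rw [h.eval_some hv₁, h.eval_some hv₂] at h4
      -- Values with ratio `2` have adjacent exponents, which are never both digit positions of `p`.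
      have h5 : (2 : ℝ) ^ q₁ = 2 ^ (q₂ + 1) := by rw [h4]; ring
      have h5 : (2 : ℕ) ^ q₁ = 2 ^ (q₂ + 1) := by exact_mod_cast h5
      have h6 := Nat.pow_right_injective le_rfl h5
      rw [h.edge_some v v₁ p q₁ hp hv₁, h6] at h1
      rw [h.edge_some v v₂ p q₂ hp hv₂] at h2
      exact h1 (naf_succ_eq_zero h2)
  refine ⟨⟨?_, ⟨h.trimmed, ?_⟩, fun v w => ⟨fun e => h.eval_injective e, fun e => by rw [e]⟩, ?_, ?_⟩,
    ?_, ?_⟩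
  · intro v
    rw [h.eval_eq]
    rcases f v with _ | p
    · exact ⟨0, by simp [powOrZero]⟩
    · exact ⟨2 ^ p, by simp [powOrZero]⟩
  · by_cases hx : x = 0
    · left
      refine ⟨fun v w => h.inj ?_⟩
      have : ∀ v, f v = none := fun v => by
        rcases hv : f v with _ | p
        · rfl
        · exact absurd hx (exists_needed_iff.1 ⟨p, (h.range p).1 ⟨v, hv⟩⟩)
      rw [this, this]
    · right
      obtain ⟨z, hz⟩ := h.exists_none
      refine ⟨⟨z, (h.isZero_iff z).2 hz, fun w hw =>
        h.inj (((h.isZero_iff w).1 hw).trans hz.symm)⟩, ?_, ?_⟩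
      · intro w hw
        by_contra hm
        exact hx ((h.mark_none w ((h.isZero_iff w).1 hw)).1 hm)
      · rintro ⟨v, z', w, hz', hvz, hvw, hne⟩
        obtain ⟨p, hp⟩ := h.eq_some_of_edge hvz
        have h0 := (h.isZero_iff z').1 hz'
        have hp0 := (h.edge_none v z' p hp h0).1 hvz
        rcases hw : f w with _ | q
        · exact hne (h.inj (hw.trans h0.symm))
        · rw [h.edge_some v w p q hp hw, hp0] at hvw
          exact hvw (naf_zero_left q)
  · rintro ⟨v, v₁, v₂, h1, h2, h3, h4⟩
    have := h.eval_injective h4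
    subst this
    revert h3 h1; rcases R.edge v v₁ with _ | _ | _ <;> decide
  · rintro ⟨v, v₁, v₂, h1, h2, h3, h4⟩
    exact hpair v v₁ v₂ h1 h2 h3 h4
  · intro v
    rcases hv : f v with _ | p
    · refine h.compactOn (y := 0) fun w q _ => ?_
      simp [h.none_edge v w hv, naf_zero_left]
    · refine h.compactOn (y := p) fun w q hw => ?_
      simp [h.edge_some v w p q hv hw]
  · refine h.compactOn (y := x) fun w q hw => ?_
    simp [h.mark_some w q hw]

/-- Both exponent maps identify the vertices with the zero vertex and the needed exponents, so
matching exponents is a bijection. Labels and signs at nonzero vertices are digits; at the zero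
vertex only their presence is determined. -/
theorem isomorphic [Finite V] {Q : PowerCircuit W} {g : W → Option ℕ} (hR : R.IsCanonical x f)
    (hQ : Q.IsCanonical x g) : R.IsomorphicUpToZeroSigns Q ∧
      (R.ZeroSignsPositive → Q.ZeroSignsPositive → R.Isomorphic Q) := by
  have hex : ∀ v, ∃ w, g w = f v := by
    intro v
    rcases hv : f v with _ | p
    · exact hQ.exists_none
    · exact (hQ.range p).2 ((hR.range p).1 ⟨v, hv⟩)
  choose φ hφ using hex
  have hbij : Function.Bijective φ := by
    constructor
    · intro v w hvw
      exact hR.inj (by rw [← hφ v, ← hφ w, hvw])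
    · intro w
      have : ∃ v, f v = g w := by
        rcases hw : g w with _ | p
        · exact hR.exists_none
        · exact (hR.range p).2 ((hQ.range p).1 ⟨w, hw⟩)
      obtain ⟨v, hv⟩ := this
      exact ⟨v, hQ.inj (by rw [hφ, hv])⟩
  have hedge : ∀ v w, f w ≠ none → Q.edge (φ v) (φ w) = R.edge v w := by
    intro v w hw
    rcases hv : f v with _ | p
    · rw [hR.none_edge v w hv, hQ.none_edge _ _ (by rw [hφ, hv])]
    · obtain ⟨q, hq⟩ := Option.ne_none_iff_exists'.1 hw
      rw [hR.edge_some v w p q hv hq, hQ.edge_some _ _ p q (by rw [hφ, hv]) (by rw [hφ, hq])]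
  have hedge0 : ∀ v w, f w = none → (Q.edge (φ v) (φ w) ≠ 0 ↔ R.edge v w ≠ 0) := by
    intro v w hw
    rcases hv : f v with _ | p
    · rw [hR.none_edge v w hv, hQ.none_edge _ _ (by rw [hφ, hv])]
    · rw [hR.edge_none v w p hv hw, hQ.edge_none _ _ p (by rw [hφ, hv]) (by rw [hφ, hw])]
  have hmark : ∀ v, f v ≠ none → Q.mark (φ v) = R.mark v := by
    intro v hv
    obtain ⟨p, hp⟩ := Option.ne_none_iff_exists'.1 hv
    rw [hR.mark_some v p hp, hQ.mark_some _ p (by rw [hφ, hp])]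
  have hmark0 : ∀ v, f v = none → (Q.mark (φ v) ≠ 0 ↔ R.mark v ≠ 0) := by
    intro v hv
    rw [hR.mark_none v hv, hQ.mark_none _ (by rw [hφ, hv])]
  -- Once `-1` is excluded, presence determines a zero sign.
  have sgn : ∀ a b : SignType, (a ≠ 0 ↔ b ≠ 0) → a ≠ -1 → b ≠ -1 → a = b := by decide
  refine ⟨⟨Equiv.ofBijective φ hbij, ?_, ?_, ?_, ?_⟩, fun pR pQ =>
    ⟨Equiv.ofBijective φ hbij, ?_, ?_⟩⟩
  · intro v w
    by_cases hw : f w = none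
    · exact hedge0 v w hw
    · exact (by rw [Equiv.ofBijective_apply, Equiv.ofBijective_apply, hedge v w hw])
  · intro v
    by_cases hv : f v = none
    · exact hmark0 v hv
    · exact (by rw [Equiv.ofBijective_apply, hmark v hv])
  · intro v w hw
    exact hedge v w (by rwa [Ne, ← hR.isZero_iff])
  · intro v hv
    exact hmark v (by rwa [Ne, ← hR.isZero_iff])
  · intro v w
    by_cases hw : f w = none
    · exact sgn _ _ (hedge0 v w hw) ((pQ _ ((hQ.isZero_iff _).2 (by
        rw [Equiv.ofBijective_apply, hφ, hw]))).1 _) ((pR w ((hR.isZero_iff w).2 hw)).1 v)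
    · exact hedge v w hw
  · intro v
    by_cases hv : f v = none
    · exact sgn _ _ (hmark0 v hv) ((pQ _ ((hQ.isZero_iff _).2 (by
        rw [Equiv.ofBijective_apply, hφ, hv]))).2) ((pR v ((hR.isZero_iff v).2 hv)).2)
    · exact hmark v hv

end IsCanonical

/-! ### Normal circuits are canonical -/

/-- The exponent of the value of a vertex, if the vertex is not a zero vertex. -/
noncomputable def exponent? [Fintype V] (R : PowerCircuit V) (v : V) : Option ℕ := by
  classical exact if R.IsZero v then none else some (Nat.log 2 ⌊R.eval v⌋₊)

theorem eval_of_isZero [Fintype V] {R : PowerCircuit V} {v : V} (h : R.IsZero v) : R.eval v = 0 := by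
  rw [eval_eq, if_pos h]

theorem exponent?_eq_none [Fintype V] {R : PowerCircuit V} {v : V} :
    R.exponent? v = none ↔ R.IsZero v := by
  unfold exponent?
  split_ifs with h <;> simp [h]

/-- At a nonzero vertex of a proper circuit the exponent is a natural number. -/
theorem Proper.exists_exponent [Fintype V] {R : PowerCircuit V} (h : R.Proper) {v : V}
    (hv : ¬ R.IsZero v) : ∃ p : ℕ, R.eval v = 2 ^ p ∧
      ∑ w, ((R.edge v w : SignType) : ℝ) * R.eval w = p := by
  choose g hg using h
  have hs : ∑ w, ((R.edge v w : SignType) : ℝ) * R.eval w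
      = ((∑ w, (R.edge v w : ℤ) * (g w : ℤ) : ℤ) : ℝ) := by
    push_cast
    exact Finset.sum_congr rfl fun w _ => by rw [hg w]
  set y : ℤ := ∑ w, (R.edge v w : ℤ) * (g w : ℤ) with hy
  have he : R.eval v = (2 : ℝ) ^ y := by
    rw [eval_eq, if_neg hv, hs, Real.rpow_intCast]
  have hpos : 0 < R.eval v := by rw [he]; positivity
  -- The exponent is an integer because all values are; a negative one would give a value strictly
  -- between `0` and `1`.
  have h0 : 0 ≤ y := by
    by_contra hneg
    have h1 : R.eval v < 1 := by
      rw [he]; exact zpow_lt_one_of_neg₀ (by norm_num) (by omega)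
    rw [hg v] at h1 hpos
    have h1 : g v < 1 := by exact_mod_cast h1
    have hpos : 0 < g v := by exact_mod_cast hpos
    omega
  obtain ⟨p, hp⟩ := Int.eq_ofNat_of_zero_le h0
  exact ⟨p, by rw [he, hp]; simp, by rw [hs, hp]; simp⟩

theorem exponent?_eq_some [Fintype V] {R : PowerCircuit V} (h : R.Proper) {v : V} {p : ℕ} :
    R.exponent? v = some p ↔ R.eval v = 2 ^ p := by
  unfold exponent?
  split_ifs with hv
  · rw [eval_of_isZero hv]
    simp [eq_comm (a := (0 : ℝ))]
  · obtain ⟨q, hq, -⟩ := h.exists_exponent hv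
    have hf : ⌊R.eval v⌋₊ = 2 ^ q := by
      rw [hq]; exact_mod_cast Nat.floor_natCast (R := ℝ) (2 ^ q)
    rw [hf, hq, Nat.log_pow (by norm_num)]
    constructor
    · intro h; rw [Option.some.inj h]
    · intro h
      have h : (2 : ℕ) ^ q = 2 ^ p := by exact_mod_cast h
      rw [Nat.pow_right_injective le_rfl h]

theorem eval_eq_powOrZero [Fintype V] {R : PowerCircuit V} (h : R.Proper) (v : V) :
    R.eval v = powOrZero (R.exponent? v) := by
  rcases hv : R.exponent? v with _ | p
  · rw [eval_of_isZero (exponent?_eq_none.1 hv)]; simp [powOrZero]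
  · rw [(exponent?_eq_some h).1 hv]; simp [powOrZero]

/-- A compact sum is the non-adjacent form of its value. -/
theorem naf_of_compactOn [Fintype V] {R : PowerCircuit V} (h : R.Proper)
    (hinj : ∀ v₁ v₂, R.eval v₁ = R.eval v₂ → v₁ = v₂) {s : V → SignType} {y : ℤ}
    (hc : R.CompactOn {v | s v ≠ 0}) (hy : ∑ v, ((s v : SignType) : ℝ) * R.eval v = y) :
    (∀ v p, R.exponent? v = some p → naf y p = s v) ∧
      ∀ p, naf y p ≠ 0 → ∃ v, R.exponent? v = some p ∧ s v ≠ 0 := by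
  classical
  obtain ⟨l, q, hl, hmem, hq, hch⟩ := hc
  -- The signs as a digit sequence indexed by exponents; distinct vertices have distinct values, so
  -- the choice is forced.
  let d : ℕ → SignType := fun p => if hp : ∃ v, R.exponent? v = some p then s hp.choose else 0
  have hinj' : ∀ v w p, R.exponent? v = some p → R.exponent? w = some p → v = w := by
    intro v w p hv hw
    rw [exponent?_eq_some h] at hv hw
    exact hinj v w (hv.trans hw.symm)
  have hds : ∀ v p, R.exponent? v = some p → d p = s v := by
    intro v p hv
    have hp : ∃ v, R.exponent? v = some p := ⟨v, hv⟩
    simp only [d, dif_pos hp]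
    rw [hinj' _ _ p hp.choose_spec hv]
  have hd : ∀ p, d p ≠ 0 → ∃ v, R.exponent? v = some p := by
    intro p hp
    by_contra hcon
    simp only [d, dif_neg hcon] at hp
    exact hp rfl
  have hql : ∀ p, d p ≠ 0 → ∃ v ∈ l, q v = p := by
    intro p hp
    obtain ⟨v, hv⟩ := hd p hp
    have hvl : v ∈ l := (hmem v).2 ⟨by rw [Set.mem_ofPred_eq, ← hds v p hv]; exact hp, fun hz => by
      rw [exponent?_eq_none.2 hz] at hv; simp at hv⟩
    refine ⟨v, hvl, ?_⟩
    have h1 := (exponent?_eq_some h).1 hv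
    rw [hq v hvl] at h1
    have h1 : (2 : ℕ) ^ q v = 2 ^ p := by exact_mod_cast h1
    exact Nat.pow_right_injective le_rfl h1
  -- Gaps of at least `2` are transitive, so the chain condition holds pairwise.
  have hpw : (l.map q).Pairwise (fun a b => b + 2 ≤ a) := by
    have : Trans (fun a b : ℕ => b + 2 ≤ a) (fun a b : ℕ => b + 2 ≤ a)
        (fun a b : ℕ => b + 2 ≤ a) := ⟨fun h1 h2 => by omega⟩
    exact List.isChain_iff_pairwise.1 hch
  have hpw' : ∀ a ∈ l.map q, ∀ b ∈ l.map q, a ≠ b → b + 2 ≤ a ∨ a + 2 ≤ b := by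
    intro a ha b hb hab
    obtain ⟨i, hi, rfl⟩ := List.getElem_of_mem ha
    obtain ⟨j, hj, rfl⟩ := List.getElem_of_mem hb
    rw [List.pairwise_iff_getElem] at hpw
    rcases lt_trichotomy i j with hij | hij | hij
    · exact Or.inl (hpw i j hi hj hij)
    · subst hij; exact absurd rfl hab
    · exact Or.inr (hpw j i hj hi hij)
  have hadj : ∀ p, d p ≠ 0 → d (p + 1) = 0 := by
    intro p hp
    by_contra hp1
    obtain ⟨v, hv, hvp⟩ := hql p hp
    obtain ⟨w, hw, hwp⟩ := hql (p + 1) hp1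
    have := hpw' (q v) (List.mem_map_of_mem hv) (q w) (List.mem_map_of_mem hw) (by omega)
    omega
  obtain ⟨N, hN⟩ : ∃ N, ∀ p, d p ≠ 0 → p < N := by
    refine ⟨(l.map q).sum + 1, fun p hp => ?_⟩
    obtain ⟨v, hv, rfl⟩ := hql p hp
    exact Nat.lt_succ_of_le (List.single_le_sum (by simp) _ (List.mem_map_of_mem hv))
  have hsum := sum_mul_powOrZero hinj' hds hd hN
  have hyd : ∑ p ∈ Finset.range N, (d p : ℤ) * 2 ^ p = y := by
    rw [← hsum]
    have : ((∑ v, (s v : ℤ) * powOrZero (R.exponent? v) : ℤ) : ℝ) = y := by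
      rw [← hy]; push_cast
      exact Finset.sum_congr rfl fun v _ => by rw [eval_eq_powOrZero h v]
    exact_mod_cast this
  have hnaf := naf_unique N d y hadj (fun i hi => by
    by_contra hc; exact absurd (hN i hc) (by omega)) hyd
  refine ⟨fun v p hv => by rw [hnaf, hds v p hv], fun p hp => ?_⟩
  rw [hnaf] at hp
  obtain ⟨v, hv⟩ := hd p hp
  exact ⟨v, hv, by rw [← hds v p hv]; exact hp⟩

theorem exists_isZero [Finite V] (R : PowerCircuit V) : ∃ v, R.IsZero v := by
  obtain ⟨u, -⟩ := R.marked_nonempty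
  obtain ⟨v, -, hv⟩ := R.wf.has_min Set.univ ⟨u, trivial⟩
  exact ⟨v, fun w => by by_contra hw; exact hv w trivial hw⟩

/-- By `naf_of_compactOn` compactness turns the exponent sums and the sum of the marks into NAFs.
Distinct values make the exponents injective, reachability from marks restricts them to the needed
ones, and standard form settles edges and marks at the zero vertex. -/
theorem Normal.isCanonical [Fintype V] {R : PowerCircuit V} (h : R.Normal) {x : ℤ}
    (hx : R.value = x) : R.IsCanonical x R.exponent? := by
  obtain ⟨⟨hprop, ⟨htrim, hstd⟩, hval, -, -⟩, hedge, hmark⟩ := h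
  have hinj : ∀ v₁ v₂, R.eval v₁ = R.eval v₂ → v₁ = v₂ := fun v w => (hval v w).1
  have hm := naf_of_compactOn hprop hinj hmark hx
  have he : ∀ v p, R.exponent? v = some p →
      (∀ w q, R.exponent? w = some q → naf (p : ℤ) q = R.edge v w) ∧
      ∀ q, naf (p : ℤ) q ≠ 0 → ∃ w, R.exponent? w = some q ∧ R.edge v w ≠ 0 := by
    intro v p hv
    have hz : ¬ R.IsZero v := fun hz => by rw [exponent?_eq_none.2 hz] at hv; simp at hv
    obtain ⟨q, hq, hs⟩ := hprop.exists_exponent hz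
    rw [← exponent?_eq_some hprop, hv] at hq
    rw [Option.some.inj hq]
    exact naf_of_compactOn hprop hinj (hedge v) (by rw [hs]; simp)
  have hex : ∀ v, ¬ R.IsZero v → ∃ p, R.exponent? v = some p := fun v hv => by
    rw [← exponent?_eq_none] at hv
    exact Option.ne_none_iff_exists'.1 hv
  have hzero : ∀ z z', R.IsZero z → R.IsZero z' → z = z' := fun z z' hz hz' =>
    hinj z z' (by rw [eval_of_isZero hz, eval_of_isZero hz'])
  refine ⟨?_, ?_, ?_, ?_, ?_, ?_, ?_, ?_⟩
  · intro v w hvw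
    apply hinj
    rw [eval_eq_powOrZero hprop, eval_eq_powOrZero hprop, hvw]
  · intro p
    constructor
    · have key : ∀ u v, R.mark u ≠ 0 → R.Reachable u v → ∀ p, R.exponent? v = some p →
          Needed x p := by
        intro u v hu hr
        induction hr with
        | refl => intro p hp; exact .base (by rw [hm.1 u p hp]; exact hu)
        | @tail b c _ hbc ih =>
          intro p hp
          obtain ⟨q, hq⟩ := hex b fun hz => hbc (hz c)
          exact (ih q hq).step (by rw [(he b q hq).1 c p hp]; exact hbc)
      rintro ⟨v, hv⟩
      obtain ⟨u, hu, hr⟩ := htrim v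
      exact key u v hu hr p hv
    · intro hp
      induction hp with
      | base hp => obtain ⟨v, hv, -⟩ := hm.2 _ hp; exact ⟨v, hv⟩
      | step _ hp ih =>
        obtain ⟨v, hv⟩ := ih
        obtain ⟨w, hw, -⟩ := (he v _ hv).2 _ hp
        exact ⟨w, hw⟩
  · obtain ⟨z, hz⟩ := R.exists_isZero
    exact ⟨z, exponent?_eq_none.2 hz⟩
  · intro v w p q hv hw
    exact ((he v p hv).1 w q hw).symm
  · intro v w p hv hw
    rw [exponent?_eq_none] at hw
    have hvz : ¬ R.IsZero v := fun hz => by rw [exponent?_eq_none.2 hz] at hv; simp at hv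
    have hvw : v ≠ w := by rintro rfl; exact hvz hw
    constructor
    · intro hvwe
      -- For `p ≠ 0` there is also an edge to a digit position of `p`, so the edge into `w` would be
      -- redundant.
      by_contra hp
      obtain ⟨q, hq⟩ := exists_naf_ne_zero (x := (p : ℤ)) (by exact_mod_cast hp)
      obtain ⟨w', hw', hew'⟩ := (he v p hv).2 q hq
      rcases hstd with htriv | ⟨-, -, hred⟩
      · exact hvw (htriv.elim v w)
      · refine hred ⟨v, w, w', hw, hvwe, hew', ?_⟩
        rintro rfl
        rw [exponent?_eq_none.2 hw] at hw'; simp at hw'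
    -- All digits of `0` vanish, so without the edge into `w` the vertex `v` would be a zero vertex.
    · rintro rfl
      by_contra hvwe
      refine hvz fun w' => ?_
      by_cases hw' : R.IsZero w'
      · rw [hzero w' w hw' hw]; exact hvwe
      · obtain ⟨q, hq⟩ := hex w' hw'
        rw [← (he v 0 hv).1 w' q hq]; exact naf_zero_left q
  · intro v w hv
    exact exponent?_eq_none.1 hv w
  · intro v p hv
    exact (hm.1 v p hv).symm
  · intro v hv
    rw [exponent?_eq_none] at hv
    constructor
    · intro hmv
      rcases hstd with htriv | ⟨-, hunm, -⟩
      · have h0 : R.value = 0 := Finset.sum_eq_zero fun w _ => by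
          rw [htriv.elim w v, eval_of_isZero hv, mul_zero]
        rw [hx] at h0
        exact_mod_cast h0
      · exact absurd (hunm v hv) hmv
    · rintro rfl
      obtain ⟨u, hu⟩ := R.marked_nonempty
      by_cases huz : R.IsZero u
      · rwa [hzero v u hv huz]
      · obtain ⟨p, hp⟩ := hex u huz
        rw [← hm.1 u p hp] at hu
        exact absurd (naf_zero_left p) hu

end PowerCircuit

/-! ### A small programming language on top of the random access machine -/


namespace RAM

/-- The variables of the normal form program. -/
inductive Reg
  | n | k | bg | bh | bp | bz | tb | u | u1 | m | sz | rnd | i | j | v | w | s | cand | flag | nzf | acc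
  | p | q | a | b | pos | cnt | g | y | z | t | kx | dig | cx
  deriving DecidableEq

/-- The arrays of the normal form program. -/
inductive Arr
  | inp | done | nz | ord | dif | pw | hf | par | ur | uj | ui | adj | co | dg | nd | idx | out
  deriving DecidableEq

/-- The machine register that holds a variable. -/
def Reg.code (x : Reg) : ℕ := x.ctorIdx + 2

/-- The residue modulo `32` of the relative addresses of the cells of an array. -/
def Arr.code (a : Arr) : ℕ := a.ctorIdx

theorem Reg.code_inj {x y : Reg} (h : x.code = y.code) : x = y := by
  have h : x.ctorIdx = y.ctorIdx := by unfold Reg.code at h; omega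
  rw [← Reg.ofNat_ctorIdx x, h, Reg.ofNat_ctorIdx]

theorem Reg.code_lt (x : Reg) : x.code < 64 := by cases x <;> decide

theorem Reg.two_le_code (x : Reg) : 2 ≤ x.code := by unfold Reg.code; omega

theorem Arr.code_inj {x y : Arr} (h : x.code = y.code) : x = y := by
  rw [← Arr.ofNat_ctorIdx x, show x.ctorIdx = y.ctorIdx from h, Arr.ofNat_ctorIdx]

theorem Arr.code_lt (x : Arr) : x.code < 32 := by cases x <;> decide

/-- The values of all variables and arrays. -/
structure St where
  r : Reg → ℕ
  a : Arr → ℕ → ℕ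

/-- Assign to a variable. -/
def St.set (σ : St) (x : Reg) (c : ℕ) : St := ⟨fun y => if y = x then c else σ.r y, σ.a⟩

/-- Assign to an entry of an array. -/
def St.put (σ : St) (b : Arr) (i c : ℕ) : St :=
  ⟨σ.r, fun b' i' => if b' = b ∧ i' = i then c else σ.a b' i'⟩

@[simp] theorem St.set_r (σ : St) (x c y) : (σ.set x c).r y = if y = x then c else σ.r y := rfl
@[simp] theorem St.set_a (σ : St) (x c) : (σ.set x c).a = σ.a := rfl
@[simp] theorem St.put_r (σ : St) (b i c) : (σ.put b i c).r = σ.r := rfl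
@[simp] theorem St.put_a (σ : St) (b i c b' i') :
    (σ.put b i c).a b' i' = if b' = b ∧ i' = i then c else σ.a b' i' := rfl

/-- Expressions. -/
inductive Ex
  | lit (c : ℕ)
  | var (x : Reg)
  | add (e f : Ex)
  | sub (e f : Ex)
  | mul (e f : Ex)
  | get (a : Arr) (e : Ex)

namespace Ex

instance : Add Ex := ⟨add⟩
instance : Sub Ex := ⟨sub⟩
instance : Mul Ex := ⟨mul⟩
instance (c : ℕ) : OfNat Ex c := ⟨lit c⟩

/-- The value of an expression. -/
def eval (σ : St) : Ex → ℕ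
  | lit c => c
  | var x => σ.r x
  | add e f => e.eval σ + f.eval σ
  | sub e f => e.eval σ - f.eval σ
  | mul e f => e.eval σ * f.eval σ
  | get a e => σ.a a (e.eval σ)

@[simp] theorem eval_lit (σ : St) (c : ℕ) : (no_index (OfNat.ofNat c : Ex)).eval σ = OfNat.ofNat c := rfl
@[simp] theorem eval_var (σ : St) (x) : (var x).eval σ = σ.r x := rfl
@[simp] theorem eval_add (σ : St) (e f : Ex) : (e + f).eval σ = e.eval σ + f.eval σ := rfl
@[simp] theorem eval_sub (σ : St) (e f : Ex) : (e - f).eval σ = e.eval σ - f.eval σ := rfl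
@[simp] theorem eval_mul (σ : St) (e f : Ex) : (e * f).eval σ = e.eval σ * f.eval σ := rfl
@[simp] theorem eval_get (σ : St) (a e) : (get a e).eval σ = σ.a a (e.eval σ) := rfl

/-- The number of nodes of an expression. -/
def size : Ex → ℕ
  | lit _ => 1
  | var _ => 1
  | add e f => e.size + f.size + 1
  | sub e f => e.size + f.size + 1
  | mul e f => e.size + f.size + 1
  | get _ e => e.size + 1

/-- All constants in the expression are at most `1000`. -/
def small : Ex → Bool
  | lit c => c ≤ 1000
  | var _ => true
  | add e f => e.small && f.small
  | sub e f => e.small && f.small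
  | mul e f => e.small && f.small
  | get _ e => e.small

/-- Compute the value of an expression in register `64 + k`, using the registers from there on. -/
def comp : Ex → ℕ → Prog
  | lit c, k => .const (64 + k) c
  | var x, k => .copy (64 + k) x.code
  | add e f, k => .seq (e.comp k) (.seq (f.comp (k + 1)) (.plus (64 + k) (64 + k) (64 + (k + 1))))
  | sub e f, k => .seq (e.comp k) (.seq (f.comp (k + 1)) (.minus (64 + k) (64 + k) (64 + (k + 1))))
  | mul e f, k => .seq (e.comp k) (.seq (f.comp (k + 1)) (.times (64 + k) (64 + k) (64 + (k + 1))))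
  | get a e, k => .seq (e.comp k) (.seq (.const (64 + (k + 1)) 32)
      (.seq (.times (64 + k) (64 + k) (64 + (k + 1))) (.seq (.plus (64 + k) 1 (64 + k))
      (.seq (.const (64 + (k + 1)) a.code) (.seq (.plus (64 + k) (64 + k) (64 + (k + 1)))
      (.load (64 + k) (64 + k)))))))

end Ex

/-- All values are at most `V`. -/
def St.Bdd (V : ℕ) (σ : St) : Prop := (∀ x, σ.r x ≤ V) ∧ ∀ a i, σ.a a i ≤ V

/-- The machine configuration `s` represents the values `σ`; the arrays are stored from the address
`N` on. -/
structure Rel (N : ℕ) (σ : St) (s : Config) : Prop where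
  out : s.reg 0 = 0
  base : s.reg 1 = N
  reg : ∀ x : Reg, s.reg x.code = σ.r x
  mem : ∀ (a : Arr) (i : ℕ), s.mem (N + 32 * i + a.code) = σ.a a i

theorem Rel.congr {N : ℕ} {σ : St} {s s' : Config} (h : Rel N σ s)
    (hr : ∀ r < 64, s'.reg r = s.reg r) (hm : s'.mem = s.mem) : Rel N σ s' :=
  ⟨by rw [hr 0 (by omega), h.out], by rw [hr 1 (by omega), h.base],
    fun x => by rw [hr _ x.code_lt, h.reg], fun a i => by rw [hm, h.mem]⟩

/-- For `A, B ≥ 1` both `A + B` and `A * B` are at most `A * B * (V + 2)`, so one factor `V + 2` per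
node suffices; entries read from arrays are bounded by `V` anyway. -/
theorem Ex.eval_le {V : ℕ} {σ : St} (hV : 1000 ≤ V) (hb : σ.Bdd V) (e : Ex) (he : e.small = true) :
    e.eval σ ≤ (V + 2) ^ e.size := by
  have hmul : ∀ a b A B : ℕ, 1 ≤ A → 1 ≤ B → a ≤ A → b ≤ B →
      a + b ≤ A * B * (V + 2) ∧ a * b ≤ A * B * (V + 2) := by
    intro a b A B hA hB ha hb
    have h1 : A ≤ A * B := Nat.le_mul_of_pos_right _ hB
    have h2 : B ≤ A * B := Nat.le_mul_of_pos_left _ hA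
    have h3 : A * B * 2 ≤ A * B * (V + 2) := Nat.mul_le_mul_left _ (by omega)
    have h4 : a * b ≤ A * B := Nat.mul_le_mul ha hb
    constructor <;> omega
  have hpos : ∀ m, 1 ≤ (V + 2) ^ m := fun m => Nat.one_le_pow _ _ (by omega)
  induction e with
  | lit c => simp only [small, decide_eq_true_eq] at he; simp only [eval, size, pow_one]; omega
  | var x => have := hb.1 x; simp only [eval, size, pow_one]; omega
  | add e f ihe ihf =>
    simp only [small, Bool.and_eq_true] at he
    simp only [eval, size, pow_succ, pow_add]
    exact (hmul _ _ _ _ (hpos _) (hpos _) (ihe he.1) (ihf he.2)).1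
  | sub e f ihe ihf =>
    simp only [small, Bool.and_eq_true] at he
    simp only [eval, size, pow_succ, pow_add]
    exact (Nat.sub_le _ _).trans ((Nat.le_add_right _ _).trans
      (hmul _ _ _ _ (hpos _) (hpos _) (ihe he.1) (ihf he.2)).1)
  | mul e f ihe ihf =>
    simp only [small, Bool.and_eq_true] at he
    simp only [eval, size, pow_succ, pow_add]
    exact (hmul _ _ _ _ (hpos _) (hpos _) (ihe he.1) (ihf he.2)).2
  | get a e ih =>
    simp only [eval, size, pow_succ]
    have := hb.2 a (e.eval σ)
    have := Nat.mul_le_mul_right (V + 2) (hpos e.size)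
    omega

/-- Stack discipline: registers below `64 + k`, which hold the variables and pending intermediate
results, are left alone. The factor `64` leaves room for addresses, in which an index is multiplied
by `32`. -/
theorem Ex.exec_comp {B V N : ℕ} {σ : St} (hV : 1000 ≤ V) (hb : σ.Bdd V) (e : Ex) :
    ∀ (k : ℕ) (s : Config), e.small = true → N + 64 * (V + 2) ^ e.size + 64 ≤ B → Rel N σ s →
    ∃ s' t, Exec B (e.comp k) s s' t ∧ t ≤ 10 * e.size ∧ s'.reg (64 + k) = e.eval σ ∧
      (∀ r < 64 + k, s'.reg r = s.reg r) ∧ s'.mem = s.mem := by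
  have hmono : ∀ a b, a ≤ b → (V + 2) ^ a ≤ (V + 2) ^ b := fun a b hab =>
    Nat.pow_le_pow_right (by omega) hab
  -- The three binary operations differ only in their final machine instruction.
  have hbin : ∀ (e f : Ex) (op : ℕ → ℕ → ℕ) (pr : ℕ → Prog) (k : ℕ) (s : Config),
      (∀ (k : ℕ) (s : Config), e.small = true → N + 64 * (V + 2) ^ e.size + 64 ≤ B → Rel N σ s →
        ∃ s' t, Exec B (e.comp k) s s' t ∧ t ≤ 10 * e.size ∧ s'.reg (64 + k) = e.eval σ ∧
        (∀ r < 64 + k, s'.reg r = s.reg r) ∧ s'.mem = s.mem) →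
      (∀ (k : ℕ) (s : Config), f.small = true → N + 64 * (V + 2) ^ f.size + 64 ≤ B → Rel N σ s →
        ∃ s' t, Exec B (f.comp k) s s' t ∧ t ≤ 10 * f.size ∧ s'.reg (64 + k) = f.eval σ ∧
        (∀ r < 64 + k, s'.reg r = s.reg r) ∧ s'.mem = s.mem) →
      (∀ s', s'.reg (64 + k) = e.eval σ → s'.reg (64 + (k + 1)) = f.eval σ →
        Exec B (pr k) s' (s'.setReg (64 + k) (op (e.eval σ) (f.eval σ))) 1) →
      e.small && f.small → N + 64 * (V + 2) ^ (e.size + f.size + 1) + 64 ≤ B → Rel N σ s →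
      ∃ s' t, Exec B (.seq (e.comp k) (.seq (f.comp (k + 1)) (pr k))) s s' t ∧
        t ≤ 10 * (e.size + f.size + 1) ∧ s'.reg (64 + k) = op (e.eval σ) (f.eval σ) ∧
        (∀ r < 64 + k, s'.reg r = s.reg r) ∧ s'.mem = s.mem := by
    intro e f op pr k s he hf hpr hsm hB hrel
    simp only [Bool.and_eq_true] at hsm
    have h1 := hmono e.size (e.size + f.size + 1) (by omega)
    have h2 := hmono f.size (e.size + f.size + 1) (by omega)
    obtain ⟨s₁, t₁, ex₁, ht₁, hv₁, hr₁, hm₁⟩ := he k s hsm.1 (by omega) hrel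
    obtain ⟨s₂, t₂, ex₂, ht₂, hv₂, hr₂, hm₂⟩ := hf (k + 1) s₁ hsm.2 (by omega)
      (hrel.congr (fun r hr => hr₁ r (by omega)) hm₁)
    refine ⟨_, _, ex₁.seq (ex₂.seq (hpr s₂ ?_ hv₂)), by omega, ?_, ?_, ?_⟩
    · rw [hr₂ _ (by omega), hv₁]
    · simp [Config.setReg]
    · intro r hr
      simp only [Config.setReg, Function.update_of_ne (show r ≠ 64 + k by omega)]
      rw [hr₂ r (by omega), hr₁ r hr]
    · simp only [Config.setReg]; rw [hm₂, hm₁]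
  induction e with
  | lit c =>
    intro k s hsm hB hrel
    simp only [small, decide_eq_true_eq] at hsm
    simp only [size, pow_one] at hB
    refine ⟨_, _, .const s _ c (by omega), by simp [size], by simp [Config.setReg, eval], ?_, rfl⟩
    intro r hr
    simp [Config.setReg, Function.update_of_ne (show r ≠ 64 + k by omega)]
  | var x =>
    intro k s hsm hB hrel
    refine ⟨_, _, .copy s _ x.code, by simp [size], by simp [Config.setReg, eval, hrel.reg], ?_, rfl⟩
    intro r hr
    simp [Config.setReg, Function.update_of_ne (show r ≠ 64 + k by omega)]
  | add e f ihe ihf =>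
    intro k s hsm hB hrel
    refine hbin e f (· + ·) (fun k => .plus (64 + k) (64 + k) (64 + (k + 1))) k s ihe ihf ?_ hsm hB
      hrel
    intro s' h1 h2
    simp only [small, Bool.and_eq_true] at hsm
    have := Ex.eval_le hV hb (.add e f) (by simp [small, hsm])
    simp only [eval] at this
    simp only [← h1, ← h2]
    exact .plus _ _ _ _ (by rw [h1, h2]; omega)
  | sub e f ihe ihf =>
    intro k s hsm hB hrel
    refine hbin e f (· - ·) (fun k => .minus (64 + k) (64 + k) (64 + (k + 1))) k s ihe ihf ?_ hsm hB
      hrel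
    intro s' h1 h2
    simp only [← h1, ← h2]
    exact .minus _ _ _ _
  | mul e f ihe ihf =>
    intro k s hsm hB hrel
    refine hbin e f (· * ·) (fun k => .times (64 + k) (64 + k) (64 + (k + 1))) k s ihe ihf ?_ hsm hB
      hrel
    intro s' h1 h2
    simp only [small, Bool.and_eq_true] at hsm
    have := Ex.eval_le hV hb (.mul e f) (by simp [small, hsm])
    simp only [eval] at this
    simp only [← h1, ← h2]
    exact .times _ _ _ _ (by rw [h1, h2]; omega)
  | get a e ih =>
    intro k s hsm hB hrel
    simp only [size] at hB
    have h1 := hmono e.size (e.size + 1) (by omega)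
    obtain ⟨s₁, t₁, ex₁, ht₁, hv₁, hr₁, hm₁⟩ := ih k s hsm (by omega) hrel
    have hle := Ex.eval_le hV hb e hsm
    have hac := a.code_lt
    have hbase : s₁.reg 1 = N := by rw [hr₁ 1 (by omega), hrel.base]
    refine ⟨_, _, ex₁.seq ((Exec.const _ _ _ (by omega)).seq ((Exec.times _ _ _ _ ?_).seq
      ((Exec.plus _ _ _ _ ?_).seq ((Exec.const _ _ _ (by omega)).seq ((Exec.plus _ _ _ _ ?_).seq
      (Exec.load _ _ _)))))), by simp only [size]; omega, ?_, ?_, ?_⟩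
    · simp [Config.setReg, hv₁]; omega
    · simp [Config.setReg, hv₁, Function.update_of_ne (show (1 : ℕ) ≠ 64 + k by omega),
        Function.update_of_ne (show (1 : ℕ) ≠ 64 + (k + 1) by omega), hbase]; omega
    · simp [Config.setReg, hv₁, Function.update_of_ne (show (1 : ℕ) ≠ 64 + k by omega),
        Function.update_of_ne (show (1 : ℕ) ≠ 64 + (k + 1) by omega), hbase]; omega
    · simp only [Config.setReg, Function.update_self, eval,
        Function.update_of_ne (show (1 : ℕ) ≠ 64 + k by omega),
        Function.update_of_ne (show (1 : ℕ) ≠ 64 + (k + 1) by omega),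
        Function.update_of_ne (show 64 + k ≠ 64 + (k + 1) by omega), hbase, hv₁, hm₁]
      rw [mul_comm, hrel.mem]
    · intro r hr
      simp only [Config.setReg, Function.update_of_ne (show r ≠ 64 + k by omega),
        Function.update_of_ne (show r ≠ 64 + (k + 1) by omega)]
      exact hr₁ r hr
    · exact hm₁

/-- Conditions. -/
inductive Cn
  | lt (e f : Ex)
  | eq (e f : Ex)

namespace Cn

/-- The truth of a condition. -/
def Holds (σ : St) : Cn → Prop
  | lt e f => e.eval σ < f.eval σ
  | eq e f => e.eval σ = f.eval σ

@[simp] theorem holds_lt (σ : St) (e f : Ex) : (lt e f).Holds σ ↔ e.eval σ < f.eval σ := Iff.rfl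
@[simp] theorem holds_eq (σ : St) (e f : Ex) : (eq e f).Holds σ ↔ e.eval σ = f.eval σ := Iff.rfl

instance (σ : St) (c : Cn) : Decidable (c.Holds σ) := by
  cases c <;> unfold Holds <;> infer_instance

/-- The left hand side. -/
def lhs : Cn → Ex
  | lt e _ => e
  | eq e _ => e

/-- The right hand side. -/
def rhs : Cn → Ex
  | lt _ f => f
  | eq _ f => f

/-- The machine test for a condition whose sides are in the registers `64` and `65`. -/
def test : Cn → Test
  | lt _ _ => .lt 64 65
  | eq _ _ => .eq 64 65

theorem test_holds {σ : St} {s : Config} (c : Cn) (h1 : s.reg 64 = c.lhs.eval σ)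
    (h2 : s.reg 65 = c.rhs.eval σ) : c.test.Holds s ↔ c.Holds σ := by
  cases c <;> simp_all [test, Test.Holds, lhs, rhs]

end Cn

/-- Commands. -/
inductive Cmd
  | skip
  /-- assignment to a variable -/
  | asg (x : Reg) (e : Ex)
  /-- assignment to an entry of an array -/
  | sto (a : Arr) (e f : Ex)
  | seq (p q : Cmd)
  | ite (c : Cn) (p q : Cmd)
  /-- execute `p` for `i = 0, …, b - 1` -/
  | loop (i b : Reg) (p : Cmd)

infixr:30 " ;; " => Cmd.seq

namespace Cmd

/-- The command may modify the variable. -/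
def modR (x : Reg) : Cmd → Bool
  | skip => false
  | asg y _ => x = y
  | sto _ _ _ => false
  | seq p q => p.modR x || q.modR x
  | ite _ p q => p.modR x || q.modR x
  | loop i _ p => x = i || p.modR x

/-- The command may modify the array. -/
def modA (a : Arr) : Cmd → Bool
  | skip => false
  | asg _ _ => false
  | sto b _ _ => a = b
  | seq p q => p.modA a || q.modA a
  | ite _ p q => p.modA a || q.modA a
  | loop _ _ p => p.modA a

/-- The size bound for the expressions in a command. -/
def okEx (e : Ex) : Bool := e.small && e.size ≤ 40

/-- Syntactic well-formedness. -/
def wf : Cmd → Bool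
  | skip => true
  | asg _ e => okEx e
  | sto _ e f => okEx e && okEx f
  | seq p q => p.wf && q.wf
  | ite c p q => okEx c.lhs && okEx c.rhs && p.wf && q.wf
  | loop i b p => p.wf && !p.modR i && !p.modR b && !decide (b = i)

/-- The effect of a command. -/
def run : Cmd → St → St
  | skip, σ => σ
  | asg x e, σ => σ.set x (e.eval σ)
  | sto a e f, σ => σ.put a (e.eval σ) (f.eval σ)
  | seq p q, σ => q.run (p.run σ)
  | ite c p q, σ => if c.Holds σ then p.run σ else q.run σ
  | loop i b p, σ => (fun τ => (p.run τ).set i ((p.run τ).r i + 1))^[σ.r b] (σ.set i 0)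

/-- All values that are assigned are at most `V` and all loops have at most `L` rounds. -/
def Ok (V L : ℕ) : Cmd → St → Prop
  | skip, _ => True
  | asg _ e, σ => e.eval σ ≤ V
  | sto _ _ f, σ => f.eval σ ≤ V
  | seq p q, σ => p.Ok V L σ ∧ q.Ok V L (p.run σ)
  | ite c p q, σ => (c.Holds σ → p.Ok V L σ) ∧ (¬ c.Holds σ → q.Ok V L σ)
  | loop i b p, σ => σ.r b ≤ L ∧ ∀ j < σ.r b,
      p.Ok V L ((fun τ => (p.run τ).set i ((p.run τ).r i + 1))^[j] (σ.set i 0))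

/-- A bound for the running time if all loops have at most `L` rounds. -/
def time (L : ℕ) : Cmd → ℕ
  | skip => 1
  | asg _ _ => 1000
  | sto _ _ _ => 1000
  | seq p q => p.time L + q.time L
  | ite _ p q => 1000 + p.time L + q.time L
  | loop _ _ p => 2000 + L * (p.time L + 2000)

/-- The loop nesting depth. -/
def depth : Cmd → ℕ
  | skip => 0
  | asg _ _ => 0
  | sto _ _ _ => 0
  | seq p q => max p.depth q.depth
  | ite _ p q => max p.depth q.depth
  | loop _ _ p => p.depth + 1

/-- Up to constants each enclosing loop costs one factor `L + 1`. -/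
theorem exists_time_le (p : Cmd) : ∃ c, ∀ L, p.time L ≤ c * (L + 1) ^ p.depth := by
  have hmono : ∀ L a b, a ≤ b → (L + 1) ^ a ≤ (L + 1) ^ b := fun L a b hab =>
    Nat.pow_le_pow_right (by omega) hab
  have hpos : ∀ L m, 1 ≤ (L + 1) ^ m := fun L m => Nat.one_le_pow _ _ (by omega)
  induction p with
  | skip => exact ⟨1, fun L => by simp [time, depth]⟩
  | asg => exact ⟨1000, fun L => by simp [time, depth]⟩
  | sto => exact ⟨1000, fun L => by simp [time, depth]⟩
  | seq p q hp hq =>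
    obtain ⟨c, hc⟩ := hp
    obtain ⟨d, hd⟩ := hq
    refine ⟨c + d, fun L => ?_⟩
    have h1 := Nat.mul_le_mul_left c (hmono L _ _ (le_max_left p.depth q.depth))
    have h2 := Nat.mul_le_mul_left d (hmono L _ _ (le_max_right p.depth q.depth))
    have h3 := hc L
    have h4 := hd L
    simp only [time, depth, add_mul]
    omega
  | ite b p q hp hq =>
    obtain ⟨c, hc⟩ := hp
    obtain ⟨d, hd⟩ := hq
    refine ⟨1000 + c + d, fun L => ?_⟩
    have h1 := Nat.mul_le_mul_left c (hmono L _ _ (le_max_left p.depth q.depth))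
    have h2 := Nat.mul_le_mul_left d (hmono L _ _ (le_max_right p.depth q.depth))
    have h3 := hc L
    have h4 := hd L
    have h5 := hpos L (max p.depth q.depth)
    simp only [time, depth, add_mul]
    omega
  | loop i b p hp =>
    obtain ⟨c, hc⟩ := hp
    refine ⟨2000 + (c + 2000), fun L => ?_⟩
    have h1 := hc L
    have h2 := hpos L p.depth
    simp only [time, depth, pow_succ]
    set A := (L + 1) ^ p.depth
    have h3 : p.time L + 2000 ≤ (c + 2000) * A := by
      rw [add_mul]; omega
    have h4 := Nat.mul_le_mul_left L h3
    have h5 : 1 ≤ A * (L + 1) := Nat.mul_pos h2 (by omega)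
    have h6 : L * ((c + 2000) * A) ≤ (c + 2000) * (A * (L + 1)) := by
      have : (c + 2000) * (A * (L + 1)) = L * ((c + 2000) * A) + (c + 2000) * A := by ring
      omega
    rw [add_mul 2000]
    omega

/-- Translation to machine programs. -/
def comp : Cmd → Prog
  | skip => .skip
  | asg x e => .seq (e.comp 0) (.copy x.code 64)
  | sto a e f => .seq (e.comp 0) (.seq (f.comp 1) (.seq (.const 66 32) (.seq (.times 64 64 66)
      (.seq (.plus 64 1 64) (.seq (.const 66 a.code) (.seq (.plus 64 64 66) (.store 64 65)))))))
  | seq p q => .seq p.comp q.comp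
  | ite c p q => .seq (c.lhs.comp 0) (.seq (c.rhs.comp 1) (.branch c.test p.comp q.comp))
  | loop i b p => .seq (.const i.code 0) (.loop (.lt i.code b.code)
      (.seq p.comp (.seq (.const 64 1) (.plus i.code i.code 64))))

theorem run_r {x : Reg} : ∀ {p : Cmd} {σ : St}, p.modR x = false → (p.run σ).r x = σ.r x := by
  intro p
  induction p with
  | skip => intros; rfl
  | asg y e => intro σ h; simp only [modR, decide_eq_false_iff_not] at h; simp [run, h]
  | sto => intros; rfl
  | seq p q hp hq =>
    intro σ h
    simp only [modR, Bool.or_eq_false_iff] at h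
    rw [run, hq h.2, hp h.1]
  | ite c p q hp hq =>
    intro σ h
    simp only [modR, Bool.or_eq_false_iff] at h
    rw [run]; split_ifs
    · exact hp h.1
    · exact hq h.2
  | loop i b p hp =>
    intro σ h
    simp only [modR, Bool.or_eq_false_iff, decide_eq_false_iff_not] at h
    rw [run]
    generalize σ.r b = N
    induction N with
    | zero => simp [h.1]
    | succ N ih => rw [Function.iterate_succ_apply', St.set_r, if_neg h.1, hp h.2, ih]

theorem run_a {a : Arr} : ∀ {p : Cmd} {σ : St}, p.modA a = false → (p.run σ).a a = σ.a a := by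
  intro p
  induction p with
  | skip => intros; rfl
  | asg y e => intros; rfl
  | sto => intro σ h; simp only [modA, decide_eq_false_iff_not] at h; funext i; simp [run, h]
  | seq p q hp hq =>
    intro σ h
    simp only [modA, Bool.or_eq_false_iff] at h
    rw [run, hq h.2, hp h.1]
  | ite c p q hp hq =>
    intro σ h
    simp only [modA, Bool.or_eq_false_iff] at h
    rw [run]; split_ifs
    · exact hp h.1
    · exact hq h.2
  | loop i b p hp =>
    intro σ h
    simp only [modA] at h
    rw [run]
    generalize σ.r b = N
    induction N with
    | zero => simp
    | succ N ih => rw [Function.iterate_succ_apply', St.set_a, hp h, ih]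

theorem bdd_set {V : ℕ} {σ : St} (hb : σ.Bdd V) {x : Reg} {c : ℕ} (hc : c ≤ V) :
    (σ.set x c).Bdd V :=
  ⟨fun y => by rw [St.set_r]; split_ifs; exacts [hc, hb.1 y], hb.2⟩

theorem bdd_put {V : ℕ} {σ : St} (hb : σ.Bdd V) {a : Arr} {i c : ℕ} (hc : c ≤ V) :
    (σ.put a i c).Bdd V :=
  ⟨hb.1, fun b j => by rw [St.put_a]; split_ifs; exacts [hc, hb.2 b j]⟩

theorem Rel.setReg {N : ℕ} {σ : St} {s : Config} (h : Rel N σ s) (x : Reg) (c : ℕ) :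
    Rel N (σ.set x c) (s.setReg x.code c) := by
  have hx := x.two_le_code
  refine ⟨?_, ?_, fun y => ?_, fun a i => h.mem a i⟩
  · simp only [Config.setReg, Function.update_of_ne (show 0 ≠ x.code by omega), h.out]
  · simp only [Config.setReg, Function.update_of_ne (show 1 ≠ x.code by omega), h.base]
  · rw [St.set_r]
    split_ifs with hy
    · simp [Config.setReg, hy]
    · simp only [Config.setReg, Function.update_of_ne (fun hc => hy (Reg.code_inj hc)), h.reg]

theorem Rel.setMem {N : ℕ} {σ : St} {s : Config} (h : Rel N σ s) (a : Arr) (i c : ℕ) :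
    Rel N (σ.put a i c) (s.setMem (N + 32 * i + a.code) c) := by
  refine ⟨h.out, h.base, fun y => h.reg y, fun b j => ?_⟩
  rw [St.put_a]
  split_ifs with hy
  · obtain ⟨rfl, rfl⟩ := hy; simp [Config.setMem]
  · have h1 := a.code_lt
    have h2 := b.code_lt
    have : N + 32 * j + b.code ≠ N + 32 * i + a.code := fun hc =>
      hy ⟨Arr.code_inj (by omega), by omega⟩
    simp only [Config.setMem, Function.update_of_ne this, h.mem]

/-- Simulation of commands by machine programs. The exponent `40` is the size bound that `wf`
imposes on expressions. -/
theorem exec_comp {B V N L : ℕ} (hV : 1000 ≤ V) (hB : N + 64 * (V + 2) ^ 40 + 64 ≤ B) :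
    ∀ (p : Cmd) (σ : St) (s : Config), p.wf = true → σ.Bdd V → p.Ok V L σ → Rel N σ s →
    ∃ s' t, Exec B p.comp s s' t ∧ t ≤ p.time L ∧ Rel N (p.run σ) s' ∧ (p.run σ).Bdd V := by
  have hex : ∀ (e : Ex) (k : ℕ) (σ : St) (s : Config), σ.Bdd V → okEx e = true → Rel N σ s →
      ∃ s' t, Exec B (e.comp k) s s' t ∧ t ≤ 400 ∧ s'.reg (64 + k) = e.eval σ ∧
      (∀ r < 64 + k, s'.reg r = s.reg r) ∧ s'.mem = s.mem := by
    intro e k σ s hb hok hrel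
    simp only [okEx, Bool.and_eq_true, decide_eq_true_eq] at hok
    have := Nat.pow_le_pow_right (show 0 < V + 2 by omega) hok.2
    obtain ⟨s', t, h1, h2, h3⟩ := Ex.exec_comp hV hb e k s hok.1 (N := N) (B := B) (by omega) hrel
    exact ⟨s', t, h1, by omega, h3⟩
  intro p
  induction p with
  | skip => intro σ s _ hb _ hrel; exact ⟨s, 1, .skip s, le_rfl, hrel, hb⟩
  | asg x e =>
    intro σ s hwf hb hok hrel
    obtain ⟨s₁, t₁, ex₁, ht₁, hv₁, hr₁, hm₁⟩ := hex e 0 σ s hb hwf hrel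
    refine ⟨_, _, ex₁.seq (.copy _ _ _), by simp only [time]; omega, ?_, bdd_set hb hok⟩
    rw [run, ← hv₁]
    exact Rel.setReg (hrel.congr hr₁ hm₁) x _
  | sto a e f =>
    intro σ s hwf hb hok hrel
    simp only [wf, Bool.and_eq_true] at hwf
    obtain ⟨s₁, t₁, ex₁, ht₁, hv₁, hr₁, hm₁⟩ := hex e 0 σ s hb hwf.1 hrel
    obtain ⟨s₂, t₂, ex₂, ht₂, hv₂, hr₂, hm₂⟩ := hex f 1 σ s₁ hb hwf.2 (hrel.congr hr₁ hm₁)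
    have hrel₂ := (hrel.congr hr₁ hm₁).congr (fun r hr => hr₂ r (by omega)) hm₂
    have h64 : s₂.reg 64 = e.eval σ := by rw [hr₂ 64 (by omega)]; exact hv₁
    have h65 : s₂.reg 65 = f.eval σ := hv₂
    have h1 : s₂.reg 1 = N := hrel₂.base
    simp only [okEx, Bool.and_eq_true, decide_eq_true_eq] at hwf
    have hle := Ex.eval_le hV hb e hwf.1.1
    have := Nat.pow_le_pow_right (show 0 < V + 2 by omega) hwf.1.2
    have hac := a.code_lt
    refine ⟨_, _, ex₁.seq (ex₂.seq ((Exec.const _ _ _ (by omega)).seq ((Exec.times _ _ _ _ ?_).seq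
      ((Exec.plus _ _ _ _ ?_).seq ((Exec.const _ _ _ (by omega)).seq ((Exec.plus _ _ _ _ ?_).seq
      (Exec.store _ _ _))))))), by simp only [time]; omega, ?_, bdd_put hb hok⟩
    · simp [Config.setReg, h64]; omega
    · simp [Config.setReg, h64, h1]; omega
    · simp [Config.setReg, h64, h1]; omega
    · simp only [run]
      have := Rel.setMem hrel₂ a (e.eval σ) (f.eval σ)
      refine this.congr ?_ ?_
      · intro r hr
        simp [Config.setMem, Config.setReg, Function.update_of_ne (show r ≠ 66 by omega),
          Function.update_of_ne (show r ≠ 64 by omega)]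
      · simp [Config.setMem, Config.setReg, h64, h65, h1, mul_comm]
  | seq p q hp hq =>
    intro σ s hwf hb hok hrel
    simp only [wf, Bool.and_eq_true] at hwf
    obtain ⟨s₁, t₁, ex₁, ht₁, hr₁, hb₁⟩ := hp σ s hwf.1 hb hok.1 hrel
    obtain ⟨s₂, t₂, ex₂, ht₂, hr₂, hb₂⟩ := hq _ s₁ hwf.2 hb₁ hok.2 hr₁
    exact ⟨_, _, ex₁.seq ex₂, by simp only [time]; omega, hr₂, hb₂⟩
  | ite c p q hp hq =>
    intro σ s hwf hb hok hrel
    simp only [wf, Bool.and_eq_true] at hwf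
    obtain ⟨s₁, t₁, ex₁, ht₁, hv₁, hr₁, hm₁⟩ := hex c.lhs 0 σ s hb hwf.1.1.1 hrel
    obtain ⟨s₂, t₂, ex₂, ht₂, hv₂, hr₂, hm₂⟩ := hex c.rhs 1 σ s₁ hb hwf.1.1.2 (hrel.congr hr₁ hm₁)
    have hrel₂ := (hrel.congr hr₁ hm₁).congr (fun r hr => hr₂ r (by omega)) hm₂
    have htest := c.test_holds (σ := σ) (s := s₂) (by rw [hr₂ 64 (by omega)]; exact hv₁) hv₂
    rw [run]
    by_cases hc : c.Holds σ
    · obtain ⟨s₃, t₃, ex₃, ht₃, hr₃, hb₃⟩ := hp σ s₂ hwf.1.2 hb (hok.1 hc) hrel₂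
      rw [if_pos hc]
      exact ⟨_, _, ex₁.seq (ex₂.seq (.branch_true (htest.2 hc) ex₃)), by simp only [time]; omega,
        hr₃, hb₃⟩
    · obtain ⟨s₃, t₃, ex₃, ht₃, hr₃, hb₃⟩ := hq σ s₂ hwf.2 hb (hok.2 hc) hrel₂
      rw [if_neg hc]
      exact ⟨_, _, ex₁.seq (ex₂.seq (.branch_false (fun h => hc (htest.1 h)) ex₃)),
        by simp only [time]; omega, hr₃, hb₃⟩
  | loop i b p hp =>
    intro σ s hwf hb hok hrel
    simp only [wf, Bool.and_eq_true, Bool.not_eq_true', decide_eq_false_iff_not] at hwf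
    obtain ⟨⟨⟨hwfp, hi⟩, hbm⟩, hbi⟩ := hwf
    obtain ⟨hL, hok⟩ := hok
    set M := σ.r b with hM
    have hMV : M ≤ V := hb.1 b
    set F : St → St := fun τ => (p.run τ).set i ((p.run τ).r i + 1) with hF
    have hFi : ∀ j, (F^[j] (σ.set i 0)).r i = j ∧ (F^[j] (σ.set i 0)).r b = M := by
      intro j
      induction j with
      | zero => simp [hbi, hM]
      | succ j ih =>
        rw [Function.iterate_succ_apply']
        simp only [hF, St.set_r, if_true, if_neg hbi]
        rw [run_r hi, run_r hbm]
        exact ⟨by rw [ih.1], ih.2⟩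
    -- Induction on the number `d` of rounds that are left.
    have key : ∀ d j s, j + d = M → Rel N (F^[j] (σ.set i 0)) s → (F^[j] (σ.set i 0)).Bdd V →
        ∃ s' t, Exec B (.loop (.lt i.code b.code)
          (.seq p.comp (.seq (.const 64 1) (.plus i.code i.code 64)))) s s' t ∧
          t ≤ 1 + d * (p.time L + 2000) ∧ Rel N (F^[M] (σ.set i 0)) s' ∧
          (F^[M] (σ.set i 0)).Bdd V := by
      intro d
      induction d with
      | zero =>
        intro j s hj hrel hb
        obtain rfl : j = M := by omega
        refine ⟨s, 1, .loop_false ?_, by omega, hrel, hb⟩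
        simp only [Test.Holds, hrel.reg, (hFi M).1, (hFi M).2]
        omega
      | succ d ih =>
        intro j s hj hrel hb
        obtain ⟨s₁, t₁, ex₁, ht₁, hr₁, hb₁⟩ := hp _ s hwfp hb (hok j (by omega)) hrel
        have hri : s₁.reg i.code = j := by rw [hr₁.reg, run_r hi, (hFi j).1]
        have hi64 := i.code_lt
        have hrel' : Rel N (F^[j + 1] (σ.set i 0))
            ((s₁.setReg 64 1).setReg i.code (j + 1)) := by
          rw [Function.iterate_succ_apply']
          have h1 : Rel N (p.run (F^[j] (σ.set i 0))) (s₁.setReg 64 1) :=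
            hr₁.congr (fun r hr => by simp [Config.setReg,
              Function.update_of_ne (show r ≠ 64 by omega)]) rfl
          have h2 := Rel.setReg h1 i (j + 1)
          simp only [hF]
          rwa [run_r hi, (hFi j).1]
        have hb' : (F^[j + 1] (σ.set i 0)).Bdd V := by
          rw [Function.iterate_succ_apply']
          refine bdd_set hb₁ ?_
          rw [run_r hi, (hFi j).1]; omega
        obtain ⟨s₂, t₂, ex₂, ht₂, hr₂, hb₂⟩ := ih (j + 1) _ (by omega) hrel' hb'
        have hplus : Exec B (.plus i.code i.code 64) (s₁.setReg 64 1)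
            ((s₁.setReg 64 1).setReg i.code (j + 1)) 1 := by
          have h := Exec.plus (B := B) (s₁.setReg 64 1) i.code i.code 64
          simp only [Config.setReg, Function.update_of_ne (show i.code ≠ 64 by omega),
            Function.update_self, hri] at h ⊢
          exact h (by
            have := Nat.le_self_pow (show 40 ≠ 0 by norm_num) (V + 2)
            omega)
        refine ⟨s₂, _, .loop_true ?_ (ex₁.seq ((Exec.const _ 64 1 (by omega)).seq hplus)) ex₂, ?_,
          hr₂, hb₂⟩
        · simp only [Test.Holds, hrel.reg, (hFi j).1, (hFi j).2]; omega
        · have : (d + 1) * (p.time L + 2000) = d * (p.time L + 2000) + (p.time L + 2000) := by ring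
          omega
    obtain ⟨s₁, t₁, ex₁, ht₁, hr₁, hb₁⟩ := key M 0 _ (by omega) (Rel.setReg hrel i 0)
      (bdd_set hb (Nat.zero_le _))
    refine ⟨s₁, _, (Exec.const _ _ _ (Nat.zero_le _)).seq ex₁, ?_, hr₁, hb₁⟩
    have := Nat.mul_le_mul_right (p.time L + 2000) hL
    simp only [time]; omega

/-! ### Weakest preconditions -/

/-- The command respects the bounds and establishes `Q`. -/
def WP (V L : ℕ) (p : Cmd) (σ : St) (Q : St → Prop) : Prop := p.Ok V L σ ∧ Q (p.run σ)

variable {V L : ℕ} {σ : St} {Q : St → Prop}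

@[simp] theorem wp_skip : WP V L skip σ Q ↔ Q σ := by simp [WP, Ok, run]

@[simp] theorem wp_asg {x e} : WP V L (asg x e) σ Q ↔ e.eval σ ≤ V ∧ Q (σ.set x (e.eval σ)) := Iff.rfl

@[simp] theorem wp_sto {a e f} :
    WP V L (sto a e f) σ Q ↔ f.eval σ ≤ V ∧ Q (σ.put a (e.eval σ) (f.eval σ)) := Iff.rfl

@[simp] theorem wp_seq {p q} : WP V L (seq p q) σ Q ↔ WP V L p σ fun τ => WP V L q τ Q := by
  simp only [WP, Ok, run, and_assoc]

@[simp] theorem wp_ite {c p q} :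
    WP V L (ite c p q) σ Q ↔ (c.Holds σ → WP V L p σ Q) ∧ (¬ c.Holds σ → WP V L q σ Q) := by
  simp only [WP, Ok, run]
  by_cases h : c.Holds σ <;> simp [h]

theorem WP.mono {p : Cmd} {Q' : St → Prop} (h : WP V L p σ Q) (hQ : ∀ τ, Q τ → Q' τ) :
    WP V L p σ Q' := ⟨h.1, hQ _ h.2⟩

/-- `τ` and `σ` agree except for what `p` may modify. -/
def Frame (p : Cmd) (σ τ : St) : Prop :=
  (∀ x, p.modR x = false → τ.r x = σ.r x) ∧ ∀ a, p.modA a = false → τ.a a = σ.a a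

/-- Specifications need only mention what a command changes; everything it cannot modify
syntactically is available for free. -/
theorem WP.frame {p : Cmd} {Q' : St → Prop} (h : WP V L p σ Q)
    (hQ : ∀ τ, Q τ → Frame p σ τ → Q' τ) : WP V L p σ Q' :=
  ⟨h.1, hQ _ h.2 ⟨fun _ hx => run_r hx, fun _ ha => run_a ha⟩⟩

/-- The body modifies neither the counter nor the bound, so the number of rounds is known in
advance. The invariant refers to the state after the counter has been advanced. -/
theorem wp_loop {i b : Reg} {p : Cmd} (Inv : ℕ → St → Prop) (hwf : (loop i b p).wf = true)
    (hL : σ.r b ≤ L) (h0 : Inv 0 (σ.set i 0))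
    (hs : ∀ j τ, j < σ.r b → Inv j τ → τ.r i = j → Frame (loop i b p) σ τ →
      WP V L p τ fun τ' => Inv (j + 1) (τ'.set i (j + 1)))
    (hQ : ∀ τ, Inv (σ.r b) τ → Frame (loop i b p) σ τ → Q τ) : WP V L (loop i b p) σ Q := by
  simp only [wf, Bool.and_eq_true, Bool.not_eq_true', decide_eq_false_iff_not] at hwf
  obtain ⟨⟨⟨hwfp, hi⟩, hbm⟩, hbi⟩ := hwf
  set F : St → St := fun τ => (p.run τ).set i ((p.run τ).r i + 1) with hF
  have hfr : ∀ j, Frame (loop i b p) σ (F^[j] (σ.set i 0)) := by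
    intro j
    induction j with
    | zero =>
      refine ⟨fun x hx => ?_, fun a _ => rfl⟩
      simp only [modR, Bool.or_eq_false_iff, decide_eq_false_iff_not] at hx
      simp [hx.1]
    | succ j ih =>
      rw [Function.iterate_succ_apply']
      refine ⟨fun x hx => ?_, fun a ha => ?_⟩
      · rw [← ih.1 x hx]
        simp only [modR, Bool.or_eq_false_iff, decide_eq_false_iff_not] at hx
        simp only [hF, St.set_r, if_neg hx.1]
        exact run_r hx.2
      · rw [← ih.2 a ha]
        exact run_a ha
  have hFi : ∀ j, (F^[j] (σ.set i 0)).r i = j := by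
    intro j
    induction j with
    | zero => simp
    | succ j ih =>
      rw [Function.iterate_succ_apply']
      simp only [hF, St.set_r, if_true]
      rw [run_r hi, ih]
  have hInv : ∀ j ≤ σ.r b, Inv j (F^[j] (σ.set i 0)) := by
    intro j
    induction j with
    | zero => intro _; exact h0
    | succ j ih =>
      intro hj
      have h := (hs j _ (by omega) (ih (by omega)) (hFi j) (hfr j)).2
      rw [Function.iterate_succ_apply']
      simp only [hF]
      rwa [run_r hi, hFi j]
  exact ⟨⟨hL, fun j hj => (hs j _ hj (hInv j hj.le) (hFi j) (hfr j)).1⟩,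
    hQ _ (hInv _ le_rfl) (hfr _)⟩

end Cmd

end RAM

/-! ### The normal form program -/

namespace RAM

open Ex (var get)

/-- The code of the label in row `r` and column `w`; row `0` consists of the marks. -/
def labE (r w : Ex) : Ex := get .inp (1 + r * var .n + w)

/-- The sign in row `r` and column `w`, increased by `1`. -/
def signE (r w : Ex) : Ex := (labE r w + 1) - 3 * (labE r w - 1)

namespace Cmd

/-- Constants and tables. -/
def init : Cmd :=
  -- Differences of exponents are exact up to `bg`, which is also the offset that keeps coefficients
  -- and carries nonnegative. In comparisons `bh` confines intermediate sums and `bp` caps powers;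
  -- `bz` is `bh * bp + 4`, an offset for their products.
  asg .bg (4 * var .n + 8) ;;
  asg .bh (6 * var .n + 8) ;;
  asg .bp (6 * var .n + 10) ;;
  asg .bz (36 * (var .n * var .n) + 108 * var .n + 84) ;;
  -- The machine cannot divide, so halves and parities are tabulated.
  asg .tb (16 * var .n + 32) ;;
  sto .pw 0 1 ;;
  loop .i .bg (
    asg .t (2 * get .pw (var .i)) ;;
    ite (.lt (var .bp) (var .t)) (asg .t (var .bp)) skip ;;
    sto .pw (var .i + 1) (var .t)) ;;
  sto .par 1 1 ;;
  loop .i .tb (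
    sto .hf (var .i + 2) (get .hf (var .i) + 1) ;;
    sto .par (var .i + 2) (get .par (var .i)))

/-- Find a vertex that is not done but whose successors are all done. -/
def find : Cmd :=
  asg .cand (var .n) ;;
  loop .v .n (
    asg .flag (get .done (var .v)) ;;
    loop .w .n (
      ite (.eq (labE (var .v + 1) (var .w)) 0) skip
        (ite (.eq (get .done (var .w)) 0) (asg .flag 1) skip)) ;;
    ite (.eq (var .flag) 0) (asg .cand (var .v)) skip)

/-- Confine the number `acc - bz` to the interval `[-h, h]`. -/
def clamp (h : Reg) : Cmd :=
  ite (.lt (var .bz + var h) (var .acc)) (asg .acc (var .bz + var h)) skip ;;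
  ite (.lt (var .acc + var h) (var .bz)) (asg .acc (var .bz - var h)) skip

/-- Compute the difference of the exponents of `cand` and `s`, confined to `[-bg, bg]`. -/
def compare : Cmd :=
  asg .acc (var .bz) ;;
  loop .j .k (
    asg .q (get .ord (var .k - 1 - var .j)) ;;
    -- For `j = 0` the entry `ord k` is meaningless, but the sum accumulated so far is then `0` and
    -- the factor does not matter.
    asg .p (get .pw (get .dif (get .ord (var .k - var .j) * var .n + var .q) - var .bg)) ;;
    asg .a (signE (var .cand + 1) (var .q)) ;;
    asg .b (signE (var .s + 1) (var .q)) ;;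
    -- With `acc = bz + x` this is `bz + (x * p + a - b)`; the shifts by `1` in `a` and `b` cancel.
    asg .acc (var .acc * var .p + var .bz + var .a - (var .bz * var .p + var .b)) ;;
    clamp .bh) ;;
  clamp .bg

/-- Compare `cand` with all vertices in the sorted list. -/
def compareAll : Cmd :=
  loop .i .k (
    asg .s (get .ord (var .i)) ;;
    compare ;;
    sto .dif (var .cand * var .n + var .s) (var .acc + var .bg - var .bz) ;;
    sto .dif (var .s * var .n + var .cand) (var .bz + var .bg - var .acc))

/-- Insert `cand` into the sorted list. -/
def place : Cmd :=
  asg .pos (var .k) ;;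
  loop .j .k (
    ite (.lt (get .dif (var .cand * var .n + get .ord (var .pos - 1))) (var .bg))
      (sto .ord (var .pos) (get .ord (var .pos - 1)) ;; asg .pos (var .pos - 1)) skip) ;;
  sto .ord (var .pos) (var .cand) ;;
  asg .k (var .k + 1)

/-- Decide whether `cand` is a zero vertex. -/
def testZero : Cmd :=
  asg .nzf 0 ;;
  loop .w .n (ite (.eq (labE (var .cand + 1) (var .w)) 0) skip (asg .nzf 1))

/-- Sort the nonzero vertices by their values. -/
def sort : Cmd :=
  asg .k 0 ;;
  loop .rnd .n (
    find ;;
    testZero ;;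
    ite (.eq (var .nzf) 0) skip (compareAll ;; place) ;;
    sto .done (var .cand) 1 ;;
    sto .nz (var .cand) (var .nzf))

/-- Record a position. -/
def emit : Cmd :=
  sto .ur (var .t) (var .v + 1) ;;
  sto .uj (var .t) (var .j) ;;
  asg .z (get .hf (var .y + 1)) ;;
  -- Here `y` is coefficient bound plus carry bound. For `j + 1 < g` no summand occurs at the next
  -- place, so this is the first case of `carryBound`, and the next place is a position only if `z ≠
  -- 0`.
  ite (.lt (var .j + 1) (var .g)) (ite (.lt (var .y) 2) (asg .z 0) skip) skip ;;
  asg .a 1 ;;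
  ite (.lt (var .j + 1) (var .g)) (ite (.eq (var .z) 0) (asg .a 0) skip) skip ;;
  sto .adj (var .t) (var .a) ;;
  asg .t (var .t + 1) ;;
  asg .y (var .z)

/-- Record all positions from the current exponent on, up to the next exponent. -/
def block : Cmd :=
  asg .y (var .y + var .cnt) ;;
  asg .cnt 0 ;;
  loop .j .bg (ite (.lt (var .j) (var .g)) (ite (.lt 0 (var .y)) emit skip) skip)

/-- List the positions. -/
def positions : Cmd :=
  asg .t 0 ;;
  asg .y 0 ;;
  asg .cnt (var .n + 1) ;;
  loop .i .k (
    asg .v (get .ord (var .i)) ;;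
    sto .ui (var .v) (var .t) ;;
    asg .cnt (var .cnt + 1) ;;
    asg .g (var .bg) ;;
    ite (.lt (var .i + 1) (var .k))
      (asg .g (get .dif (get .ord (var .i + 1) * var .n + var .v) - var .bg)) skip ;;
    ite (.eq (var .g) 0) skip block) ;;
  asg .u (var .t) ;;
  asg .u1 (var .t + 1) ;;
  -- The additional row stands for the sum of the marks.
  sto .ur (var .t) 0 ;;
  sto .uj (var .t) 0

/-- Collect the coefficients of a sum. -/
def coefficients : Cmd :=
  loop .s .u1 (sto .co (var .s) (var .bg)) ;;
  loop .w .n (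
    ite (.eq (get .nz (var .w)) 0) skip (
      asg .a (signE (get .ur (var .t)) (var .w)) ;;
      sto .co (get .ui (var .w)) (get .co (get .ui (var .w)) + var .a - 1))) ;;
  sto .co 0 (get .co 0 + get .uj (var .t))

/-- Compute the digits of a non-adjacent form. -/
def digits : Cmd :=
  asg .kx (var .bg) ;;
  loop .s .u (
    asg .acc (get .co (var .s) + var .kx) ;;
    asg .dig 0 ;;
    asg .kx (get .hf (var .acc)) ;;
    ite (.eq (get .par (var .acc)) 0) skip (
      asg .q (var .bg) ;;
      -- If the next place is not a position, its coefficient is `0`, which is encoded by `bg`.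
      ite (.eq (get .adj (var .s)) 1) (asg .q (get .co (var .s + 1))) skip ;;
      ite (.eq (get .par (var .kx + var .q)) 0) (asg .dig 1)
        (asg .dig 2 ;; asg .kx (var .kx + 1))) ;;
    sto .dg (var .t * var .u + var .s) (var .dig))

/-- Compute all digits. -/
def rows : Cmd := loop .t .u1 (coefficients ;; digits)

/-- Find out which positions are needed. -/
def need : Cmd :=
  loop .s .u (
    asg .a 0 ;;
    ite (.eq (get .dg (var .u * var .u + var .s)) 0) skip (asg .a 1) ;;
    sto .nd (var .s) (var .a)) ;;
  loop .i .u (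
    -- Downwards: apart from the digits of the value, only larger positions can make a position
    -- needed.
    asg .t (var .u - 1 - var .i) ;;
    ite (.eq (get .nd (var .t)) 0) skip (
      loop .s .u (ite (.eq (get .dg (var .t * var .u + var .s)) 0) skip (sto .nd (var .s) 1))))

/-- Number the needed positions. -/
def number : Cmd :=
  asg .m 1 ;;
  loop .s .u (
    ite (.eq (get .nd (var .s)) 0) skip (sto .idx (var .s) (var .m) ;; asg .m (var .m + 1)))

/-- Write the output. -/
def write : Cmd :=
  sto .out 0 (var .m) ;;
  -- Only the value `0` gets a single vertex, which must then be marked.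
  ite (.eq (var .m) 1) (sto .out 1 1) (
    loop .s .u (
      ite (.eq (get .nd (var .s)) 0) skip (
        sto .out (1 + get .idx (var .s)) (get .dg (var .u * var .u + var .s)) ;;
        loop .i .u (
          ite (.eq (get .dg (var .s * var .u + var .i)) 0) skip
            (sto .out (1 + var .m + get .idx (var .s) * var .m + get .idx (var .i))
              (get .dg (var .s * var .u + var .i)))))) ;;
    -- The edge from the vertex of value `1` into the zero vertex, which has the number `0`.
    sto .out (1 + var .m + get .idx 0 * var .m) 1) ;;
  asg .sz (1 + var .m + var .m * var .m)

/-- Compute the normal form of the circuit in the array `inp` and put it into the array `out`. -/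
def normalForm : Cmd :=
  init ;; sort ;; positions ;; rows ;; need ;; number ;; write

theorem normalForm_wf : normalForm.wf = true := by decide

/-- The nesting depth is the exponent in the running time. -/
theorem normalForm_depth : normalForm.depth = 3 := by decide

end Cmd

/-! ### Abstract instances -/

/-- The sign with a given code. -/
def sgn (c : ℕ) : ℤ := if c = 1 then 1 else if c = 2 then -1 else 0

/-- A circuit given by codes of labels (row `v + 1` belongs to the vertex `v`, row `0` holds the
marks) together with the exponents of its vertices. -/
structure Inst where
  n : ℕ
  lab : ℕ → ℕ → ℕ
  lab_le : ∀ r w, lab r w ≤ 2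
  -- A rank that decreases along edges and thereby witnesses acyclicity.
  ht : ℕ → ℕ
  ht_lt : ∀ v w, v < n → w < n → lab (v + 1) w ≠ 0 → ht w < ht v
  e : ℕ → ℕ

namespace Inst

variable (I : Inst)

/-- The vertex `v` is not a zero vertex. -/
def NZ (v : ℕ) : Prop := ∃ w < I.n, I.lab (v + 1) w ≠ 0

open Classical in
/-- The sum in a row. -/
noncomputable def rowSum (r : ℕ) : ℤ :=
  ∑ w ∈ (Finset.range I.n).filter I.NZ, sgn (I.lab r w) * 2 ^ I.e w

/-- The exponents fit the circuit. -/
def Fits : Prop := ∀ v < I.n, (I.e v : ℤ) = I.rowSum (v + 1)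

/-- The input is given in the variable `n` and the array `inp`. -/
structure Input (σ : St) : Prop where
  n_eq : σ.r .n = I.n
  inp_eq : ∀ r w, r ≤ I.n → w < I.n → σ.a .inp (1 + r * I.n + w) = I.lab r w

/-- The constants and tables are set up. -/
structure Setup (σ : St) : Prop extends I.Input σ where
  bg_eq : σ.r .bg = 4 * I.n + 8
  bh_eq : σ.r .bh = 6 * I.n + 8
  bp_eq : σ.r .bp = 6 * I.n + 10
  bz_eq : σ.r .bz = 36 * (I.n * I.n) + 108 * I.n + 84
  tb_eq : σ.r .tb = 16 * I.n + 32
  pw_eq : ∀ g ≤ 4 * I.n + 8, σ.a .pw g = min (2 ^ g) (6 * I.n + 10)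
  pw_le : ∀ g, σ.a .pw g ≤ 6 * I.n + 10
  hf_eq : ∀ x ≤ 16 * I.n + 32, σ.a .hf x = x / 2
  par_eq : ∀ x ≤ 16 * I.n + 32, σ.a .par x = x % 2

/-- The command does not touch the input, the constants and the tables. -/
def keepsSetup (p : Cmd) : Bool :=
  !(p.modR .n || p.modR .bg || p.modR .bh || p.modR .bp || p.modR .bz || p.modR .tb ||
    p.modA .inp || p.modA .pw || p.modA .hf || p.modA .par)

variable {I}

theorem Setup.frame {p : Cmd} {σ τ : St} (h : I.Setup σ) (hf : Cmd.Frame p σ τ)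
    (hp : keepsSetup p = true) : I.Setup τ := by
  simp only [keepsSetup, Bool.not_eq_true', Bool.or_eq_false_iff] at hp
  obtain ⟨⟨⟨⟨⟨⟨⟨⟨⟨h1, h2⟩, h3⟩, h4⟩, h5⟩, h6⟩, h7⟩, h8⟩, h9⟩, h10⟩ := hp
  obtain ⟨fr, fa⟩ := hf
  constructor
  · constructor
    · rw [fr _ h1, h.n_eq]
    · rw [fa _ h7]; exact h.inp_eq
  · rw [fr _ h2, h.bg_eq]
  · rw [fr _ h3, h.bh_eq]
  · rw [fr _ h4, h.bp_eq]
  · rw [fr _ h5, h.bz_eq]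
  · rw [fr _ h6, h.tb_eq]
  · rw [fa _ h8]; exact h.pw_eq
  · rw [fa _ h8]; exact h.pw_le
  · rw [fa _ h9]; exact h.hf_eq
  · rw [fa _ h10]; exact h.par_eq

end Inst

@[simp] theorem eval_labE (σ : St) (r w : Ex) :
    (labE r w).eval σ = σ.a .inp (1 + r.eval σ * σ.r .n + w.eval σ) := rfl

theorem sgn_cast (c : ℕ) (hc : c ≤ 2) : (((c + 1) - 3 * (c - 1) : ℕ) : ℤ) = sgn c + 1 := by
  unfold sgn; split_ifs <;> omega

theorem abs_sgn_le (c : ℕ) : |sgn c| ≤ 1 := by unfold sgn; split_ifs <;> simp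

namespace Cmd

open Inst

variable {V L : ℕ} {I : Inst}

theorem wp_init {σ : St} (hV : 1000 * (I.n * I.n) + 1000 * I.n + 1000 ≤ V)
    (hL : 16 * I.n + 32 ≤ L) (h : I.Input σ) (h0 : σ.a .pw = fun _ => 0) (h1 : σ.a .hf = fun _ => 0)
    (h2 : σ.a .par = fun _ => 0) : WP V L init σ I.Setup := by
  have hn := h.n_eq
  simp only [init, wp_seq, wp_asg, wp_sto, Ex.eval_add, Ex.eval_mul, Ex.eval_lit, Ex.eval_var,
    St.set_r, reduceCtorEq, if_false, hn]
  refine ⟨by omega, by omega, by omega, by omega, by omega, by omega, ?_⟩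
  refine wp_loop (fun j τ => (∀ g ≤ j, τ.a .pw g = min (2 ^ g) (6 * I.n + 10)) ∧
    (∀ g, τ.a .pw g ≤ 6 * I.n + 10)) (by decide) (by simp; omega) ?_ ?_ ?_
  · simp [h0]; intro g; split_ifs <;> omega
  · intro j τ hj ⟨hi1, hi2⟩ hji hf
    have hbp : τ.r .bp = 6 * I.n + 10 := by rw [hf.1 _ rfl]; simp
    have hpj := hi1 j le_rfl
    have key : ∀ c, c = min (2 * τ.a .pw j) (6 * I.n + 10) → c ≤ V ∧
        (∀ g ≤ j + 1, (if g = j + 1 then c else τ.a .pw g) = min (2 ^ g) (6 * I.n + 10)) ∧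
        ∀ g, (if g = j + 1 then c else τ.a .pw g) ≤ 6 * I.n + 10 := by
      intro c hc
      refine ⟨by omega, fun g hg => ?_, fun g => ?_⟩
      · split_ifs with hgj
        · rw [hc, hpj, hgj, pow_succ]; omega
        · exact hi1 g (by omega)
      · split_ifs
        · omega
        · exact hi2 g
    simp [hji, hbp]
    have := hi2 j
    exact ⟨by omega, fun _ => ⟨by omega, (key _ (by omega)).2⟩, fun _ => key _ (by omega)⟩
  · intro τ ⟨hi1, hi2⟩ hf
    refine ⟨by omega, ?_⟩
    have htb : τ.r .tb = 16 * I.n + 32 := by rw [hf.1 _ rfl]; simp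
    have hhf : τ.a .hf = fun _ => 0 := by rw [hf.2 _ rfl]; funext i; simp [h1]
    have hpar : τ.a .par = fun _ => 0 := by rw [hf.2 _ rfl]; funext i; simp [h2]
    refine wp_loop (fun j τ => (∀ x ≤ j + 1, τ.a .hf x = x / 2) ∧ (∀ x ≤ j + 1, τ.a .par x = x % 2))
      (by decide) (by simp [htb]; omega) ?_ ?_ ?_
    · simp [hhf, hpar]
      constructor <;> intro x hx <;> interval_cases x <;> rfl
    · intro j τ' hj ⟨hi1, hi2⟩ hji hf
      simp [htb] at hj
      simp [hji]
      have e1 := hi1 j (by omega)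
      have e2 := hi2 j (by omega)
      refine ⟨by omega, by omega, fun x hx => ?_, fun x hx => ?_⟩
      · split_ifs
        · omega
        · exact hi1 x (by omega)
      · split_ifs
        · omega
        · exact hi2 x (by omega)
    · intro τ' ⟨hi3, hi4⟩ hf'
      simp [htb] at hi3 hi4
      simp at hi1
      have hr : ∀ x, x ≠ .i → x ≠ .t → τ'.r x = τ.r x := fun x hx _ => by
        rw [hf'.1 _ (by simp [modR, hx])]; rfl
      have hpw : τ'.a .pw = τ.a .pw := by rw [hf'.2 _ rfl]; funext i; simp
      have hinp : τ'.a .inp = σ.a .inp := by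
        rw [hf'.2 _ rfl]; funext i; simp [hf.2 .inp rfl]
      constructor
      · constructor
        · rw [hr _ (by decide) (by decide), hf.1 _ rfl]; simp [hn]
        · rw [hinp]; exact h.inp_eq
      all_goals first
        | (rw [hr _ (by decide) (by decide), hf.1 _ rfl]; simp)
        | (rw [hpw]; assumption)
        | skip
      · exact fun x hx => hi3 x (by omega)
      · exact fun x hx => hi4 x (by omega)

end Cmd

end RAM

/-! ### Saturating evaluation of sums of powers of two -/

namespace RAM

open Ex (var get)

/-- The integer `x` confined to the interval `[-h, h]`. -/
def confine (h x : ℤ) : ℤ := max (-h) (min h x)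

/-- The number `x` approximates `a`: they agree or are both large with the same sign. -/
def Near (h x a : ℤ) : Prop := x = a ∨ (h ≤ x ∧ h ≤ a) ∨ (x ≤ -h ∧ a ≤ -h)

/-- Two numbers beyond `h` on the same side stay beyond `h - 2` after multiplication by factors `≥
1` and addition of `c`. If `x = a`, capping the power matters only when `P ≤ 2 ^ g`, and then for `x
≠ 0` both products have absolute value at least `P ≥ H + 2 ≥ h`. Confining to `H ≥ h - 2` is
invisible at this precision. -/
theorem Near.step {h H P x a c p : ℤ} {g : ℕ} (hN : Near h x a) (hc : |c| ≤ 2) (h3 : 3 ≤ h)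
    (hH : h ≤ H + 2) (hP : H + 2 ≤ P) (hp : (x = 0 ∧ a = 0) ∨ p = min (2 ^ g) P) :
    Near (h - 2) (confine H (x * p + c)) (a * 2 ^ g + c) := by
  have hg : (1 : ℤ) ≤ 2 ^ g := one_le_pow₀ (by norm_num)
  rw [abs_le] at hc
  have hconf : ∀ β b : ℤ, Near (h - 2) β b → Near (h - 2) (confine H β) b := by
    intro β b hb
    unfold Near confine at *
    omega
  apply hconf
  rcases hp with ⟨rfl, rfl⟩ | hp
  · left; ring
  have hp1 : 1 ≤ p := by omega
  rcases hN with rfl | ⟨h1, h2⟩ | ⟨h1, h2⟩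
  · by_cases hpe : p = 2 ^ g
    · left; rw [hpe]
    have hpP : p = P := by omega
    have hPg : P ≤ 2 ^ g := by omega
    rcases lt_trichotomy x 0 with hx | hx | hx
    · right; right
      have e1 : x * p ≤ -1 * p := mul_le_mul_of_nonneg_right (by omega) (by omega)
      have e2 : x * 2 ^ g ≤ -1 * 2 ^ g := mul_le_mul_of_nonneg_right (by omega) (by omega)
      constructor <;> omega
    · left; simp [hx]
    · right; left
      have e1 : 1 * p ≤ x * p := mul_le_mul_of_nonneg_right (by omega) (by omega)
      have e2 : 1 * 2 ^ g ≤ x * 2 ^ g := mul_le_mul_of_nonneg_right (by omega) (by omega)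
      constructor <;> omega
  · right; left
    have e1 : x * 1 ≤ x * p := mul_le_mul_of_nonneg_left hp1 (by omega)
    have e2 : a * 1 ≤ a * 2 ^ g := mul_le_mul_of_nonneg_left hg (by omega)
    constructor <;> omega
  · right; right
    have e1 : x * p ≤ x * 1 := mul_le_mul_of_nonpos_left hp1 (by omega)
    have e2 : a * 2 ^ g ≤ a * 1 := mul_le_mul_of_nonpos_left hg (by omega)
    constructor <;> omega

theorem Near.confine_eq {h G x a : ℤ} (hN : Near h x a) (hG : G ≤ h) (h0 : 0 ≤ G) :
    confine G x = confine G a := by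
  unfold Near confine at *
  omega

/-- The sum of the last `j` of `k` terms, in units of the smallest power of two that occurs. -/
def partialSum (c : ℕ → ℤ) (E : ℕ → ℕ) (k j : ℕ) : ℤ :=
  ∑ i ∈ Finset.Ico (k - j) k, c i * 2 ^ (E i - E (k - j))

theorem partialSum_zero (c : ℕ → ℤ) (E : ℕ → ℕ) (k : ℕ) : partialSum c E k 0 = 0 := by
  simp [partialSum]

/-- Horner's scheme along a sorted list: going down to the next exponent multiplies by two to the
power of the gap. -/
theorem partialSum_succ {c : ℕ → ℤ} {E : ℕ → ℕ} {k j : ℕ} (hj : j < k)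
    (hE : ∀ i i', i ≤ i' → i' < k → E i ≤ E i') :
    partialSum c E k (j + 1) =
      partialSum c E k j * 2 ^ (E (k - j) - E (k - 1 - j)) + c (k - 1 - j) := by
  unfold partialSum
  have h1 : k - (j + 1) = k - 1 - j := by omega
  rw [h1, Finset.sum_eq_sum_Ico_succ_bot (by omega), show k - 1 - j + 1 = k - j by omega, add_comm]
  congr 1
  · rw [Finset.sum_mul]
    refine Finset.sum_congr rfl fun i hi => ?_
    rw [Finset.mem_Ico] at hi
    have e1 := hE (k - 1 - j) (k - j) (by omega) (by omega)
    have e2 := hE (k - j) i hi.1 hi.2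
    rw [mul_assoc, ← pow_add]
    congr 2; omega
  · simp

/-! ### Sorted lists of vertices and the search for the next vertex -/

namespace Inst

variable {I : Inst}

/-- The vertex is not done, but its successors are. -/
def Ready (I : Inst) (done : ℕ → ℕ) (v : ℕ) : Prop :=
  done v = 0 ∧ ∀ w < I.n, I.lab (v + 1) w ≠ 0 → done w ≠ 0

/-- The vertices that are done are sorted. -/
structure Sorted (I : Inst) (done ord dif : ℕ → ℕ) (k : ℕ) : Prop where
  done_le : ∀ v, done v ≤ 1
  closed : ∀ v w, v < I.n → w < I.n → done v ≠ 0 → I.lab (v + 1) w ≠ 0 → done w ≠ 0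
  ord_lt : ∀ i < k, ord i < I.n
  ord_done : ∀ i < k, done (ord i) ≠ 0
  ord_nz : ∀ i < k, I.NZ (ord i)
  ord_inj : ∀ i j, i < k → j < k → ord i = ord j → i = j
  ord_surj : ∀ v < I.n, done v ≠ 0 → I.NZ v → ∃ i < k, ord i = v
  mono : ∀ i j, i ≤ j → j < k → I.e (ord i) ≤ I.e (ord j)
  dif_eq : ∀ v w, v < I.n → w < I.n → done v ≠ 0 → done w ≠ 0 → I.NZ v → I.NZ w → v ≠ w →
    (dif (v * I.n + w) : ℤ) = (4 * I.n + 8) + confine (4 * I.n + 8) ((I.e v : ℤ) - I.e w)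

namespace Sorted

variable {done ord dif : ℕ → ℕ} {k : ℕ}

theorem le_n (h : I.Sorted done ord dif k) : k ≤ I.n := by
  have : (Finset.range k).card ≤ (Finset.range I.n).card :=
    Finset.card_le_card_of_injOn ord (fun i hi => by
      simp only [Finset.coe_range, Set.mem_Iio] at hi ⊢; exact h.ord_lt i hi)
      (fun i hi j hj hij => by
        simp only [Finset.coe_range, Set.mem_Iio] at hi hj; exact h.ord_inj i j hi hj hij)
  simpa using this

/-- All successors of `v` are done, and the nonzero ones among them are in the list, so no other
vertex contributes. -/
theorem rowSum_eq (h : I.Sorted done ord dif k) {v : ℕ} (hsucc : ∀ w < I.n, I.lab (v + 1) w ≠ 0 →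
    done w ≠ 0) : I.rowSum (v + 1) =
      ∑ i ∈ Finset.range k, sgn (I.lab (v + 1) (ord i)) * 2 ^ I.e (ord i) := by
  classical
  have h1 : ∑ i ∈ Finset.range k, sgn (I.lab (v + 1) (ord i)) * 2 ^ I.e (ord i) =
      ∑ w ∈ (Finset.range k).image ord, sgn (I.lab (v + 1) w) * 2 ^ I.e w := by
    rw [Finset.sum_image]
    intro i hi j hj hij
    exact h.ord_inj i j (by simpa using hi) (by simpa using hj) hij
  rw [h1, rowSum]
  symm
  refine Finset.sum_subset_zero_on_sdiff ?_ ?_ ?_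
  · intro w hw
    obtain ⟨i, hi, rfl⟩ := Finset.mem_image.1 hw
    have hi := Finset.mem_range.1 hi
    exact Finset.mem_filter.2 ⟨Finset.mem_range.2 (h.ord_lt i hi), h.ord_nz i hi⟩
  · intro w hw
    rw [Finset.mem_sdiff, Finset.mem_filter, Finset.mem_range] at hw
    obtain ⟨⟨hwn, hnz⟩, hni⟩ := hw
    by_cases hl : I.lab (v + 1) w = 0
    · simp [hl, sgn]
    · exfalso
      obtain ⟨i, hi, rfl⟩ := h.ord_surj w hwn (hsucc w hwn hl) hnz
      exact hni (Finset.mem_image_of_mem _ (Finset.mem_range.2 hi))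
  · intro w _; rfl

/-- The smallest value of a nonzero vertex is `1`. -/
theorem e_ord_zero (h : I.Sorted done ord dif k) (hI : I.Fits) (hk : 0 < k) :
    I.e (ord 0) = 0 := by
  classical
  obtain ⟨i, hi, hmin⟩ := Finset.exists_min_image (Finset.range k) (fun i => I.ht (ord i))
    ⟨0, Finset.mem_range.2 hk⟩
  have hi := Finset.mem_range.1 hi
  have hz : I.rowSum (ord i + 1) = 0 := by
    refine Finset.sum_eq_zero fun w hw => ?_
    rw [Finset.mem_filter, Finset.mem_range] at hw
    by_cases hl : I.lab (ord i + 1) w = 0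
    · simp [hl, sgn]
    · exfalso
      obtain ⟨j, hj, rfl⟩ := h.ord_surj w hw.1
        (h.closed _ w (h.ord_lt i hi) hw.1 (h.ord_done i hi) hl) hw.2
      have h1 := I.ht_lt _ _ (h.ord_lt i hi) hw.1 hl
      have h2 := hmin j (Finset.mem_range.2 hj)
      omega
  have h1 := hI _ (h.ord_lt i hi)
  have h2 := h.mono 0 i (Nat.zero_le _) hi
  omega

theorem e_eq (h : I.Sorted done ord dif k) (hI : I.Fits) {v : ℕ} (hv : v < I.n)
    (hsucc : ∀ w < I.n, I.lab (v + 1) w ≠ 0 → done w ≠ 0) : (I.e v : ℤ) =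
      ∑ i ∈ Finset.range k, sgn (I.lab (v + 1) (ord i)) * 2 ^ I.e (ord i) := by
  rw [hI v hv, h.rowSum_eq hsucc]

end Sorted

/-- A vertex of least rank among those not done is ready. -/
theorem exists_ready (I : Inst) {done : ℕ → ℕ} (h : ∃ v < I.n, done v = 0) :
    ∃ v < I.n, I.Ready done v := by
  classical
  obtain ⟨v, hv, hmin⟩ := Finset.exists_min_image
    ((Finset.range I.n).filter fun v => done v = 0) I.ht (by
      obtain ⟨v, hv, h0⟩ := h
      exact ⟨v, by simp [hv, h0]⟩)
  simp only [Finset.mem_filter, Finset.mem_range] at hv hmin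
  refine ⟨v, hv.1, hv.2, fun w hw hl h0 => ?_⟩
  have h1 := I.ht_lt v w hv.1 hw hl
  have h2 := hmin w ⟨hw, h0⟩
  omega

end Inst

theorem index_inj {n v w v' w' : ℕ} (hw : w < n) (hw' : w' < n) :
    v * n + w = v' * n + w' ↔ v = v' ∧ w = w' := by
  refine ⟨fun h => ?_, fun ⟨h1, h2⟩ => by rw [h1, h2]⟩
  have h1 : (v * n + w) / n = (v' * n + w') / n := by rw [h]
  have hn : 0 < n := by omega
  rw [Nat.add_comm, Nat.add_mul_div_right _ _ hn, Nat.div_eq_of_lt hw, Nat.add_comm (v' * n),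
    Nat.add_mul_div_right _ _ hn, Nat.div_eq_of_lt hw'] at h1
  have h2 : v = v' := by omega
  subst h2
  exact ⟨rfl, by omega⟩

namespace Cmd

open Inst

variable {V L : ℕ} {I : Inst}

/-- The search does not stop at a hit; later ready vertices overwrite earlier ones, so the invariant
only claims some ready vertex. -/
theorem wp_find {σ : St} (h : I.Input σ) (hV : I.n + 1 ≤ V) (hL : I.n ≤ L)
    (hd : ∀ v, σ.a .done v ≤ 1) (hex : ∃ v < I.n, I.Ready (σ.a .done) v) :
    WP V L find σ fun τ => τ.r .cand < I.n ∧ I.Ready (σ.a .done) (τ.r .cand) := by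
  have hn := h.n_eq
  simp only [find, wp_seq, wp_asg, Ex.eval_var]
  refine ⟨by omega, wp_loop (fun j τ => (τ.r .cand < I.n ∧ I.Ready (σ.a .done) (τ.r .cand)) ∨
    (τ.r .cand = I.n ∧ ∀ v < j, ¬ I.Ready (σ.a .done) v)) (by decide) (by simp; omega) ?_ ?_ ?_⟩
  · right; simp [hn]
  · intro v τ hv hinv hvi hf
    simp [hn] at hv
    have hdone : τ.a .done = σ.a .done := hf.2 _ rfl
    have hinp : τ.a .inp = σ.a .inp := hf.2 _ rfl
    have hτn : τ.r .n = I.n := by rw [hf.1 _ rfl]; simp [hn]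
    simp only [wp_seq, wp_asg, Ex.eval_get, Ex.eval_var, hvi, hdone]
    refine ⟨by have := hd v; omega, ?_⟩
    refine wp_loop (fun j τ' => τ'.r .flag ≤ 1 ∧ (τ'.r .flag = 0 ↔ σ.a .done v = 0 ∧
      ∀ w < j, I.lab (v + 1) w ≠ 0 → σ.a .done w ≠ 0)) (by decide) (by simp; omega) ?_ ?_ ?_
    · simp; exact hd v
    · intro w τ' hw ⟨hle, hinv'⟩ hwi hf'
      simp [hτn] at hw
      have hdone' : τ'.a .done = σ.a .done := by rw [hf'.2 _ rfl]; exact hdone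
      have hlab : τ'.a .inp (1 + (v + 1) * I.n + w) = I.lab (v + 1) w := by
        rw [hf'.2 _ rfl, St.set_a, hinp]; exact h.inp_eq _ _ (by omega) hw
      have hv' : τ'.r .v = v := by rw [hf'.1 _ rfl]; simp [hvi]
      have hn' : τ'.r .n = I.n := by rw [hf'.1 _ rfl]; simp [hτn]
      simp only [wp_seq, wp_asg, wp_sto, wp_ite, wp_skip, Cn.holds_lt, Cn.holds_eq, Ex.eval_add, Ex.eval_sub,
      Ex.eval_mul, Ex.eval_get, Ex.eval_var, Ex.eval_lit, eval_labE, St.set_r, St.set_a, St.put_r,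
      St.put_a, reduceCtorEq, if_true, if_false, true_and, and_true, false_and, and_false, hv', hn', hwi, hlab, hdone']
      have hsucc : (∀ w' < w + 1, I.lab (v + 1) w' ≠ 0 → σ.a .done w' ≠ 0) ↔
          (∀ w' < w, I.lab (v + 1) w' ≠ 0 → σ.a .done w' ≠ 0) ∧
          (I.lab (v + 1) w ≠ 0 → σ.a .done w ≠ 0) := by
        constructor
        · exact fun hall => ⟨fun w' hw' => hall w' (by omega), hall w (by omega)⟩
        · rintro ⟨h1, h2⟩ w' hw'
          rcases Nat.lt_succ_iff_lt_or_eq.1 hw' with h3 | rfl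
          · exact h1 w' h3
          · exact h2
      rw [hsucc]
      refine ⟨fun h0 => ⟨hle, by rw [hinv']; simp [h0]⟩, fun h0 => ⟨fun h1 => ⟨by omega, le_rfl, ?_⟩,
        fun h1 => ⟨hle, by rw [hinv']; simp [h1]⟩⟩⟩
      simp [h0, h1]
    · intro τ' ⟨hle, hinv'⟩ hf'
      simp only [St.set_r, reduceCtorEq, if_false, hτn] at hinv'
      have hv' : τ'.r .v = v := by rw [hf'.1 _ rfl]; simp [hvi]
      have hcand : τ'.r .cand = τ.r .cand := by rw [hf'.1 _ rfl]; simp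
      simp [hv', hcand]
      refine ⟨fun h0 => ⟨by omega, Or.inl ⟨hv, hinv'.1 h0⟩⟩, fun h0 => ?_⟩
      rcases hinv with hinv | ⟨h1, h2⟩
      · exact Or.inl hinv
      · refine Or.inr ⟨h1, fun v' hv' => ?_⟩
        rcases Nat.lt_or_eq_of_le hv' with h3 | rfl
        · exact h2 v' h3
        · exact fun hr => h0 (hinv'.2 hr)
  · intro τ hinv hf
    rcases hinv with hinv | ⟨-, h2⟩
    · exact hinv
    · obtain ⟨v, hv, hr⟩ := hex
      exact absurd hr (h2 v (by simpa [hn] using hv))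

theorem wp_testZero {σ : St} (h : I.Input σ) (hV : 1 ≤ V) (hL : I.n ≤ L) (hc : σ.r .cand < I.n) :
    WP V L testZero σ fun τ => τ.r .nzf ≤ 1 ∧ (τ.r .nzf ≠ 0 ↔ I.NZ (σ.r .cand)) := by
  have hn := h.n_eq
  simp only [testZero, wp_seq, wp_asg, Ex.eval_lit]
  refine ⟨by omega, wp_loop (fun j τ => τ.r .nzf ≤ 1 ∧ (τ.r .nzf ≠ 0 ↔ ∃ w < j,
    I.lab (σ.r .cand + 1) w ≠ 0)) (by decide) (by simp; omega) ?_ ?_ ?_⟩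
  · simp
  · intro w τ hw ⟨hle, hinv⟩ hwi hf
    simp [hn] at hw
    have hlab : τ.a .inp (1 + (σ.r .cand + 1) * I.n + w) = I.lab (σ.r .cand + 1) w := by
      rw [hf.2 _ rfl]; exact h.inp_eq _ _ (by omega) hw
    have hcand : τ.r .cand = σ.r .cand := by rw [hf.1 _ rfl]; simp
    have hτn : τ.r .n = I.n := by rw [hf.1 _ rfl]; simp [hn]
    simp [hcand, hτn, hwi, hlab]
    refine ⟨fun h0 => ⟨hle, ?_⟩, fun h0 => ⟨by omega, w, by omega, h0⟩⟩
    rw [← ne_eq, hinv]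
    constructor
    · rintro ⟨w', h1, h2⟩; exact ⟨w', by omega, h2⟩
    · rintro ⟨w', h1, h2⟩
      rcases Nat.lt_or_eq_of_le h1 with h3 | rfl
      · exact ⟨w', h3, h2⟩
      · exact absurd h0 h2
  · intro τ ⟨hle, hinv⟩ _
    simp only [St.set_r, reduceCtorEq, if_false, hn] at hinv
    exact ⟨hle, hinv⟩

theorem wp_clamp {σ : St} {x : ℤ} {h : Reg} (hacc : (σ.r .acc : ℤ) = σ.r .bz + x)
    (hh : σ.r h ≤ σ.r .bz) (hV : 2 * σ.r .bz ≤ V) (hne : h ≠ .acc) :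
    WP V L (clamp h) σ fun τ => (τ.r .acc : ℤ) = σ.r .bz + confine (σ.r h) x := by
  simp only [clamp, wp_seq, wp_ite, wp_asg, wp_skip, Cn.holds_lt, Ex.eval_add, Ex.eval_sub,
    Ex.eval_var, St.set_r, if_true, reduceCtorEq, if_false, if_neg hne]
  unfold confine
  refine ⟨fun h1 => ⟨by omega, fun h2 => ⟨by omega, ?_⟩, fun h2 => ?_⟩,
    fun h1 => ⟨fun h2 => ⟨by omega, ?_⟩, fun h2 => ?_⟩⟩ <;> omega

theorem signE_eval {σ : St} (h : I.Input σ) {r w : Ex} (hr : r.eval σ ≤ I.n) (hw : w.eval σ < I.n) :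
    (((signE r w).eval σ : ℕ) : ℤ) = sgn (I.lab (r.eval σ) (w.eval σ)) + 1 := by
  have h1 : σ.a .inp (1 + r.eval σ * σ.r .n + w.eval σ) = I.lab (r.eval σ) (w.eval σ) := by
    rw [h.n_eq]; exact h.inp_eq _ _ hr hw
  simp only [signE, Ex.eval_sub, Ex.eval_add, Ex.eval_mul, Ex.eval_lit, eval_labE, h1]
  exact sgn_cast _ (I.lab_le _ _)

end Cmd

end RAM

/-! ### Insertion into the sorted list and comparison of exponents -/

namespace RAM

open Ex (var get)

theorem confine_neg (h x : ℤ) (h0 : 0 ≤ h) : confine h (-x) = -confine h x := by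
  unfold confine; omega

theorem abs_confine_le (h x : ℤ) (h0 : 0 ≤ h) : -h ≤ confine h x ∧ confine h x ≤ h := by
  unfold confine; omega

/-- The offset `z` is at least `H * P + 2`, so the truncated subtraction never truncates. -/
theorem cast_horner {A p z a b : ℕ} {x c H P : ℤ} (hA : (A : ℤ) = z + x) (hx : -H ≤ x ∧ x ≤ H)
    (hp : (p : ℤ) ≤ P) (hab : (a : ℤ) - b = c) (hc : |c| ≤ 2) (hz : H * P + 2 ≤ z) :
    ((A * p + z + a - (z * p + b) : ℕ) : ℤ) = z + (x * p + c) ∧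
      -(H * P) ≤ x * p ∧ x * p ≤ H * P := by
  rw [abs_le] at hc
  have hp0 : (0 : ℤ) ≤ p := by positivity
  have h1 : x * p ≤ H * P :=
    (mul_le_mul_of_nonneg_right hx.2 hp0).trans (mul_le_mul_of_nonneg_left hp (by omega))
  have h2 : -(H * P) ≤ x * p := by
    have h3 : H * p ≤ H * P := mul_le_mul_of_nonneg_left hp (by omega)
    have h4 : -H * p ≤ x * p := mul_le_mul_of_nonneg_right hx.1 hp0
    linarith
  have h5 : ((A * p : ℕ) : ℤ) = (z * p : ℕ) + x * p := by push_cast; rw [hA]; ring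
  refine ⟨?_, h2, h1⟩
  generalize A * p = B at *
  generalize z * p = D at *
  omega

namespace Inst

variable {I : Inst} {done ord dif : ℕ → ℕ} {k : ℕ}

/-- Entries from place `p` on move up by one; the three cases of `hcase` then settle each property
of the list. -/
theorem Sorted.insert (h : I.Sorted done ord dif k) {v : ℕ} (hv : v < I.n) (hr : I.Ready done v)
    (hnz : I.NZ v) {dif' ord' : ℕ → ℕ} {p : ℕ} (hp : p ≤ k)
    (hd : I.Sorted done ord dif' k)
    (hd' : ∀ i < k, (dif' (v * I.n + ord i) : ℤ) = (4 * I.n + 8) +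
        confine (4 * I.n + 8) ((I.e v : ℤ) - I.e (ord i)) ∧
      (dif' (ord i * I.n + v) : ℤ) = (4 * I.n + 8) +
        confine (4 * I.n + 8) ((I.e (ord i) : ℤ) - I.e v))
    (h1 : ∀ i < p, ord' i = ord i ∧ I.e (ord i) ≤ I.e v) (h2 : ord' p = v)
    (h3 : ∀ i, p ≤ i → i < k → ord' (i + 1) = ord i ∧ I.e v ≤ I.e (ord i)) :
    I.Sorted (fun x => if x = v then 1 else done x) ord' dif' (k + 1) := by
  have hcase : ∀ i < k + 1, (i < p ∧ ord' i = ord i ∧ I.e (ord i) ≤ I.e v) ∨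
      (i = p ∧ ord' i = v) ∨
      (∃ j, i = j + 1 ∧ p ≤ j ∧ j < k ∧ ord' i = ord j ∧ I.e v ≤ I.e (ord j)) := by
    intro i hi
    rcases lt_trichotomy i p with hip | hip | hip
    · exact Or.inl ⟨hip, h1 i hip⟩
    · exact Or.inr (Or.inl ⟨hip, hip ▸ h2⟩)
    · obtain ⟨j, rfl⟩ := Nat.exists_eq_succ_of_ne_zero (show i ≠ 0 by omega)
      exact Or.inr (Or.inr ⟨j, rfl, by omega, by omega, h3 j (by omega) (by omega)⟩)
  have hne : ∀ i < k, ord i ≠ v := fun i hi he => h.ord_done i hi (he ▸ hr.1)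
  constructor
  · intro w; split_ifs; exacts [le_rfl, h.done_le w]
  · intro x w hx hw hdx hl
    split_ifs at hdx ⊢ with hwv hxv hxv
    · simp
    · simp
    · subst hxv; exact hr.2 w hw hl
    · exact h.closed x w hx hw hdx hl
  · intro i hi
    rcases hcase i hi with ⟨hip, he, -⟩ | ⟨-, he⟩ | ⟨j, -, -, hj, he, -⟩ <;> rw [he]
    · exact h.ord_lt i (by omega)
    · exact hv
    · exact h.ord_lt j hj
  · intro i hi
    rcases hcase i hi with ⟨hip, he, -⟩ | ⟨-, he⟩ | ⟨j, -, -, hj, he, -⟩ <;> rw [he]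
    · rw [if_neg (hne i (by omega))]; exact h.ord_done i (by omega)
    · simp
    · rw [if_neg (hne j hj)]; exact h.ord_done j hj
  · intro i hi
    rcases hcase i hi with ⟨hip, he, -⟩ | ⟨-, he⟩ | ⟨j, -, -, hj, he, -⟩ <;> rw [he]
    · exact h.ord_nz i (by omega)
    · exact hnz
    · exact h.ord_nz j hj
  · intro i i' hi hi' hii
    rcases hcase i hi with ⟨hip, he, -⟩ | ⟨hip, he⟩ | ⟨j, hij, hpj, hj, he, -⟩ <;>
      rcases hcase i' hi' with ⟨hip', he', -⟩ | ⟨hip', he'⟩ | ⟨j', hij', hpj', hj', he', -⟩ <;>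
      rw [he, he'] at hii
    · exact h.ord_inj i i' (by omega) (by omega) hii
    · exact absurd hii (hne i (by omega))
    · have := h.ord_inj i j' (by omega) hj' hii; omega
    · exact absurd hii.symm (hne i' (by omega))
    · omega
    · exact absurd hii.symm (hne j' hj')
    · have := h.ord_inj j i' hj (by omega) hii; omega
    · exact absurd hii (hne j hj)
    · have := h.ord_inj j j' hj hj' hii; omega
  · intro w hw hdw hnw
    by_cases hwv : w = v
    · exact ⟨p, by omega, by rw [h2, hwv]⟩
    · rw [if_neg hwv] at hdw
      obtain ⟨i, hi, rfl⟩ := h.ord_surj w hw hdw hnw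
      by_cases hip : i < p
      · exact ⟨i, by omega, (h1 i hip).1⟩
      · exact ⟨i + 1, by omega, (h3 i (by omega) hi).1⟩
  · intro i i' hii hi'
    rcases hcase i (by omega) with ⟨hip, he, hl⟩ | ⟨hip, he⟩ | ⟨j, hij, hpj, hj, he, hl⟩ <;>
      rcases hcase i' hi' with ⟨hip', he', hl'⟩ | ⟨hip', he'⟩ | ⟨j', hij', hpj', hj', he', hl'⟩ <;>
      rw [he, he']
    · exact h.mono i i' hii (by omega)
    · exact hl
    · exact h.mono i j' (by omega) hj'
    · omega
    · exact hl'
    · omega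
    · omega
    · exact h.mono j j' (by omega) hj'
  · intro x w hx hw hdx hdw hnx hnw hxw
    by_cases hxv : x = v
    · subst hxv
      rw [if_neg (Ne.symm hxw)] at hdw
      obtain ⟨i, hi, rfl⟩ := h.ord_surj w hw hdw hnw
      exact (hd' i hi).1
    · rw [if_neg hxv] at hdx
      obtain ⟨i, hi, rfl⟩ := h.ord_surj x hx hdx hnx
      by_cases hwv : w = v
      · subst hwv; exact (hd' i hi).2
      · rw [if_neg hwv] at hdw
        exact hd.dif_eq _ w hx hw hdx hdw hnx hnw hxw

theorem Sorted.insert_zero (h : I.Sorted done ord dif k) {v : ℕ} (hr : I.Ready done v)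
    (hnz : ¬ I.NZ v) : I.Sorted (fun x => if x = v then 1 else done x) ord dif k := by
  constructor
  · intro w; split_ifs; exacts [le_rfl, h.done_le w]
  · intro x w hx hw hdx hl
    split_ifs at hdx ⊢ with hwv hxv hxv
    · simp
    · simp
    · subst hxv; exact hr.2 w hw hl
    · exact h.closed x w hx hw hdx hl
  · exact h.ord_lt
  · intro i hi
    split_ifs
    · simp
    · exact h.ord_done i hi
  · exact h.ord_nz
  · exact h.ord_inj
  · intro w hw hdw hnw
    have : w ≠ v := fun hc => hnz (hc ▸ hnw)
    simp only [if_neg this] at hdw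
    exact h.ord_surj w hw hdw hnw
  · exact h.mono
  · intro x w hx hw hdx hdw hnx hnw hxw
    have h1 : x ≠ v := fun hc => hnz (hc ▸ hnx)
    have h2 : w ≠ v := fun hc => hnz (hc ▸ hnw)
    simp only [if_neg h1] at hdx
    simp only [if_neg h2] at hdw
    exact h.dif_eq x w hx hw hdx hdw hnx hnw hxw

/-- Entries of the difference table that do not concern two done vertices are irrelevant. -/
theorem Sorted.congr_dif (h : I.Sorted done ord dif k) {dif' : ℕ → ℕ}
    (hd : ∀ v w, v < I.n → w < I.n → done v ≠ 0 → done w ≠ 0 →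
      dif' (v * I.n + w) = dif (v * I.n + w)) : I.Sorted done ord dif' k :=
  ⟨h.done_le, h.closed, h.ord_lt, h.ord_done, h.ord_nz, h.ord_inj, h.ord_surj, h.mono,
    fun v w hv hw hdv hdw hnv hnw hne => by
      rw [hd v w hv hw hdv hdw]; exact h.dif_eq v w hv hw hdv hdw hnv hnw hne⟩

/-- Saturated differences suffice for capped powers, because `2 ^ (4 * n + 8)` already exceeds the
cap `6 * n + 10`. -/
theorem Sorted.pw_dif {σ : St} (hS : I.Setup σ) (h : I.Sorted done ord dif k) {i i' : ℕ}
    (hi : i < i') (hi' : i' < k) :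
    ((σ.a .pw (dif (ord i' * I.n + ord i) - (4 * I.n + 8)) : ℕ) : ℤ) =
      min (2 ^ (I.e (ord i') - I.e (ord i))) ((6 * I.n + 10 : ℕ) : ℤ) := by
  have hm := h.mono i i' hi.le hi'
  have h1 := h.dif_eq (ord i') (ord i) (h.ord_lt _ hi') (h.ord_lt _ (by omega)) (h.ord_done _ hi')
    (h.ord_done _ (by omega)) (h.ord_nz _ hi') (h.ord_nz _ (by omega))
    (fun hc => by have := h.ord_inj _ _ hi' (by omega) hc; omega)
  have h2 : dif (ord i' * I.n + ord i) - (4 * I.n + 8) =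
      min (4 * I.n + 8) (I.e (ord i') - I.e (ord i)) := by
    unfold confine at h1; omega
  rw [h2, hS.pw_eq _ (min_le_left _ _)]
  generalize I.e (ord i') - I.e (ord i) = g
  push_cast
  by_cases hg : g ≤ 4 * I.n + 8
  · rw [min_eq_right hg]
  · rw [min_eq_left (show 4 * I.n + 8 ≤ g by omega)]
    have h3 : 6 * I.n + 10 ≤ 2 ^ (4 * I.n + 8) := by
      have := Nat.lt_two_pow_self (n := 4 * I.n)
      rw [pow_add]; omega
    have h4 : 2 ^ (4 * I.n + 8) ≤ 2 ^ g := Nat.pow_le_pow_right (by omega) (by omega)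
    have h5 := h3.trans h4
    rw [min_eq_right (by exact_mod_cast h3), min_eq_right (by exact_mod_cast h5)]

end Inst

namespace Cmd

open Inst

variable {V L : ℕ} {I : Inst}

/-- The difference of the two exponents is a sum over the sorted list with coefficients of absolute
value at most `2`, and since the smallest exponent is `0`, the last Horner value is this difference
itself. The margin starts at `6 * n + 10` and loses `2` in each of at most `n` rounds, so the result
confined to `4 * n + 8` is exact. -/
theorem wp_compare {σ : St} (hV : 1000 * (I.n * I.n) + 1000 * I.n + 1000 ≤ V)
    (hL : 16 * I.n + 32 ≤ L) (hS : I.Setup σ) (hI : I.Fits)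
    (h : I.Sorted (σ.a .done) (σ.a .ord) (σ.a .dif) (σ.r .k)) (hk : 0 < σ.r .k)
    (hv : σ.r .cand < I.n) (hr : I.Ready (σ.a .done) (σ.r .cand))
    (hu : σ.r .s < I.n) (hdu : σ.a .done (σ.r .s) ≠ 0) :
    WP V L compare σ fun τ => (τ.r .acc : ℤ) = σ.r .bz +
      confine (4 * I.n + 8) ((I.e (σ.r .cand) : ℤ) - I.e (σ.r .s)) := by
  have hkn := h.le_n
  have hbz := hS.bz_eq
  set v := σ.r .cand with hvdef
  set u := σ.r .s with hudef
  set k := σ.r .k with hkdef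
  set E : ℕ → ℕ := fun i => I.e (σ.a .ord i) with hE
  set c : ℕ → ℤ := fun i => sgn (I.lab (v + 1) (σ.a .ord i)) - sgn (I.lab (u + 1) (σ.a .ord i))
    with hc
  have hcabs : ∀ i, |c i| ≤ 2 := fun i => by
    have h1 := abs_sgn_le (I.lab (v + 1) (σ.a .ord i))
    have h2 := abs_sgn_le (I.lab (u + 1) (σ.a .ord i))
    simp only [hc]; rw [abs_le] at *; omega
  have hmono : ∀ i i', i ≤ i' → i' < k → E i ≤ E i' := fun i i' => h.mono i i'
  have hfin : partialSum c E k k = (I.e v : ℤ) - I.e u := by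
    have h0 : E 0 = 0 := h.e_ord_zero hI hk
    rw [h.e_eq hI hv hr.2, h.e_eq hI hu fun w hw hl => h.closed u w hu hw hdu hl,
      ← Finset.sum_sub_distrib]
    unfold partialSum
    rw [Nat.sub_self, h0, Finset.range_eq_Ico]
    refine Finset.sum_congr rfl fun i _ => ?_
    simp only [hc, hE, Nat.sub_zero]; ring
  simp only [compare, wp_seq, wp_asg, Ex.eval_var]
  refine ⟨by omega, wp_loop (fun j τ => ∃ x : ℤ, (τ.r .acc : ℤ) = σ.r .bz + x ∧
    (-(6 * I.n + 8) ≤ x ∧ x ≤ 6 * I.n + 8) ∧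
    Near (6 * I.n + 10 - 2 * j) x (partialSum c E k j) ∧ (j = 0 → x = 0))
    (by decide) (by simp; omega) ?_ ?_ ?_⟩
  · exact ⟨0, by simp, by omega, by left; rw [partialSum_zero], fun _ => rfl⟩
  · intro j τ hj ⟨x, hx, hxb, hnear, hx0⟩ hji hf
    simp only [St.set_r, reduceCtorEq, if_false] at hj
    have hS' : I.Setup τ := Setup.frame (σ := σ.set .acc (σ.r .bz)) (by
      refine hS.frame (p := asg .acc (var .bz)) ⟨fun x hx => ?_, fun a _ => rfl⟩ rfl
      simp only [modR, decide_eq_false_iff_not] at hx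
      simp [hx]) hf (by decide)
    have hord : τ.a .ord = σ.a .ord := hf.2 _ rfl
    have hdif : τ.a .dif = σ.a .dif := hf.2 _ rfl
    have hτk : τ.r .k = k := by rw [hf.1 _ rfl]; simp [hkdef]
    have hτv : τ.r .cand = v := by rw [hf.1 _ rfl]; simp [hvdef]
    have hτu : τ.r .s = u := by rw [hf.1 _ rfl]; simp [hudef]
    have hτbz : τ.r .bz = σ.r .bz := by rw [hf.1 _ rfl]; simp
    have hq : σ.a .ord (k - 1 - j) < I.n := h.ord_lt _ (by omega)
    simp only [wp_seq, wp_asg, wp_sto, wp_ite, wp_skip, Cn.holds_lt, Cn.holds_eq, Ex.eval_add, Ex.eval_sub,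
      Ex.eval_mul, Ex.eval_get, Ex.eval_var, Ex.eval_lit, eval_labE, St.set_r, St.set_a, St.put_r,
      St.put_a, reduceCtorEq, if_true, if_false, true_and, and_true, false_and, and_false, hτk, hji, hord, hdif]
    refine ⟨by omega, by have := hS'.pw_le (σ.a .dif (σ.a .ord (k - j) * τ.r .n +
      σ.a .ord (k - 1 - j)) - τ.r .bg); omega, ?_⟩
    set p := τ.a .pw (σ.a .dif (σ.a .ord (k - j) * τ.r .n + σ.a .ord (k - 1 - j)) - τ.r .bg)
      with hp
    have hple := hS'.pw_le (σ.a .dif (σ.a .ord (k - j) * τ.r .n + σ.a .ord (k - 1 - j)) - τ.r .bg)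
    rw [← hp] at hple
    set τ₁ := (τ.set .q (σ.a .ord (k - 1 - j))).set .p p with hτ₁
    have hS₁ : I.Input τ₁ := ⟨by simp [hτ₁, hS'.n_eq], by simp only [hτ₁, St.set_a]; exact hS'.inp_eq⟩
    have ha := signE_eval hS₁ (r := var .cand + 1) (w := var .q) (by simp [hτ₁, hτv]; omega)
      (by simp [hτ₁]; omega)
    have hva : (var .cand + 1 : Ex).eval τ₁ = v + 1 := by simp [hτ₁, hτv]
    have hvq : (var .q : Ex).eval τ₁ = σ.a .ord (k - 1 - j) := by simp [hτ₁]
    rw [hva, hvq] at ha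
    set a := (signE (var .cand + 1) (var .q)).eval τ₁ with hadef
    have hsa := abs_sgn_le (I.lab (v + 1) (σ.a .ord (k - 1 - j)))
    rw [abs_le] at hsa
    refine ⟨by omega, ?_⟩
    set τ₂ := τ₁.set .a a with hτ₂
    have hS₂ : I.Input τ₂ := ⟨by simp [hτ₂, hS₁.n_eq], by simp only [hτ₂, St.set_a]; exact hS₁.inp_eq⟩
    have hb := signE_eval hS₂ (r := var .s + 1) (w := var .q) (by simp [hτ₂, hτ₁, hτu]; omega)
      (by simp [hτ₂, hτ₁]; omega)
    have hvb : (var .s + 1 : Ex).eval τ₂ = u + 1 := by simp [hτ₂, hτ₁, hτu]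
    have hvq' : (var .q : Ex).eval τ₂ = σ.a .ord (k - 1 - j) := by simp [hτ₂, hτ₁]
    rw [hvb, hvq'] at hb
    set b := (signE (var .s + 1) (var .q)).eval τ₂ with hbdef
    have hsb := abs_sgn_le (I.lab (u + 1) (σ.a .ord (k - 1 - j)))
    rw [abs_le] at hsb
    refine ⟨by omega, ?_⟩
    simp only [hτ₂, hτ₁, wp_seq, wp_asg, wp_sto, wp_ite, wp_skip, Cn.holds_lt, Cn.holds_eq, Ex.eval_add, Ex.eval_sub,
      Ex.eval_mul, Ex.eval_get, Ex.eval_var, Ex.eval_lit, eval_labE, St.set_r, St.set_a, St.put_r,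
      St.put_a, reduceCtorEq, if_true, if_false, true_and, and_true, false_and, and_false, hτbz]
    have hcab : (a : ℤ) - b = c (k - 1 - j) := by rw [ha, hb]; simp only [hc]; ring
    obtain ⟨hcast, hlo, hhi⟩ := cast_horner (H := 6 * I.n + 8) (P := 6 * I.n + 10) hx hxb
      (by exact_mod_cast hple) hcab (hcabs _) (by rw [hbz]; push_cast; nlinarith)
    have hHP : ((6 * I.n + 8 : ℤ)) * (6 * I.n + 10) = 36 * (I.n * I.n) + 108 * I.n + 80 := by ring
    rw [hHP] at hlo hhi
    have hca := hcabs (k - 1 - j)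
    rw [abs_le] at hca
    have hNN : ((I.n * I.n : ℕ) : ℤ) = (I.n : ℤ) * I.n := by push_cast; ring
    refine ⟨by zify; zify at hbz hV; rw [hcast, hbz]; linarith [hca.2, hhi], ?_⟩
    refine (wp_clamp (x := x * p + c (k - 1 - j)) (by simpa [hτbz] using hcast)
      (by simp [hS'.bh_eq, hτbz, hbz]; omega) (by simp [hτbz, hbz]; omega) (by decide)).mono ?_
    intro τ' hτ'
    simp only [St.set_r, reduceCtorEq, if_false, if_true, hτbz, hS'.bh_eq] at hτ' ⊢
    push_cast at hτ' ⊢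
    refine ⟨confine (6 * I.n + 8) (x * p + c (k - 1 - j)), hτ', ?_, ?_, ?_⟩
    · exact abs_confine_le _ _ (by omega)
    · rw [partialSum_succ hj hmono]
      have := hnear.step (H := 6 * I.n + 8) (P := 6 * I.n + 10) (c := c (k - 1 - j)) (p := p)
        (g := E (k - j) - E (k - 1 - j)) (hcabs _) (by omega) (by omega) (by omega) ?_
      · convert this using 1; ring
      · by_cases h0 : j = 0
        · left; rw [hx0 h0, h0]; exact ⟨rfl, partialSum_zero _ _ _⟩
        · right
          have := h.pw_dif hS' (i := k - 1 - j) (i' := k - j) (by omega) (by omega)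
          rw [hp, hS'.n_eq, hS'.bg_eq, this]
          push_cast; rfl
    · exact False.elim
  · intro τ ⟨x, hx, hxb, hnear, _⟩ hf
    simp only [St.set_r, reduceCtorEq, if_false] at hnear
    rw [← hkdef, hfin] at hnear
    have hτbz : τ.r .bz = σ.r .bz := by rw [hf.1 _ rfl]; simp
    have hτbg : τ.r .bg = 4 * I.n + 8 := by rw [hf.1 _ rfl]; simp [hS.bg_eq]
    refine (wp_clamp (x := x) (by rw [hτbz]; exact hx) (by omega) (by omega) (by decide)).mono ?_
    intro τ' hτ'
    rw [hτ', hτbz, hτbg, ← hnear.confine_eq (G := 4 * I.n + 8) (by omega) (by omega)]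
    push_cast; rfl

end Cmd

end RAM

/-! ### Correctness of the sorting -/

namespace RAM

open Ex (var get)

theorem St.put_a_of_ne {b b' : Arr} (h : b' ≠ b) (σ : St) (i c : ℕ) :
    (σ.put b i c).a b' = σ.a b' := by
  funext i'
  simp [h]

namespace Cmd

open Inst

variable {V L : ℕ} {I : Inst}

/-- Only entries in the row and column of `cand` are written. As `cand` is not done yet, the entries
that later comparisons read are not affected. -/
theorem wp_compareAll {σ : St} (hV : 1000 * (I.n * I.n) + 1000 * I.n + 1000 ≤ V)
    (hL : 16 * I.n + 32 ≤ L) (hS : I.Setup σ) (hI : I.Fits)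
    (h : I.Sorted (σ.a .done) (σ.a .ord) (σ.a .dif) (σ.r .k))
    (hv : σ.r .cand < I.n) (hr : I.Ready (σ.a .done) (σ.r .cand)) :
    WP V L compareAll σ fun τ => I.Sorted (σ.a .done) (σ.a .ord) (τ.a .dif) (σ.r .k) ∧
      ∀ i < σ.r .k, (τ.a .dif (σ.r .cand * I.n + σ.a .ord i) : ℤ) = (4 * I.n + 8) +
          confine (4 * I.n + 8) ((I.e (σ.r .cand) : ℤ) - I.e (σ.a .ord i)) ∧
        (τ.a .dif (σ.a .ord i * I.n + σ.r .cand) : ℤ) = (4 * I.n + 8) +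
          confine (4 * I.n + 8) ((I.e (σ.a .ord i) : ℤ) - I.e (σ.r .cand)) := by
  have hkn := h.le_n
  have hbz := hS.bz_eq
  have hbg := hS.bg_eq
  have hn := hS.n_eq
  refine wp_loop (fun j τ => I.Sorted (σ.a .done) (σ.a .ord) (τ.a .dif) (σ.r .k) ∧
      ∀ i < j, (τ.a .dif (σ.r .cand * I.n + σ.a .ord i) : ℤ) = (4 * I.n + 8) +
          confine (4 * I.n + 8) ((I.e (σ.r .cand) : ℤ) - I.e (σ.a .ord i)) ∧
        (τ.a .dif (σ.a .ord i * I.n + σ.r .cand) : ℤ) = (4 * I.n + 8) +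
          confine (4 * I.n + 8) ((I.e (σ.a .ord i) : ℤ) - I.e (σ.r .cand))) (by decide)
    (by omega) ⟨h, by simp⟩ ?_ fun τ hτ _ => hτ
  intro i τ hi ⟨hs, hd⟩ hii hf
  have hord : τ.a .ord = σ.a .ord := hf.2 _ rfl
  have hdone : τ.a .done = σ.a .done := hf.2 _ rfl
  have hk : τ.r .k = σ.r .k := hf.1 _ rfl
  have hcand : τ.r .cand = σ.r .cand := hf.1 _ rfl
  have hS' : I.Setup τ := hS.frame hf (by decide)
  have hlt : σ.a .ord i < I.n := h.ord_lt i hi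
  have hdi := h.ord_done i hi
  generalize hw : σ.a .ord i = w at *
  have hne : σ.r .cand ≠ w := by
    rintro he; exact hdi (he ▸ hr.1)
  simp only [wp_seq, wp_asg, Ex.eval_get, Ex.eval_var, hii, hord, hw]
  refine ⟨by omega, ?_⟩
  set τ₁ := τ.set .s w with hτ₁
  have hS₁ : I.Setup τ₁ := hS'.frame (p := asg .s 0) ⟨fun x hx => by
    simp only [modR, decide_eq_false_iff_not] at hx
    simp [hτ₁, hx], fun _ _ => rfl⟩ rfl
  refine (wp_compare hV hL hS₁ hI (by simpa [hτ₁, hord, hdone, hk] using hs)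
    (by simp [hτ₁, hk]; omega) (by simpa [hτ₁, hcand] using hv)
    (by simpa [hτ₁, hcand, hdone] using hr) (by simpa [hτ₁] using hlt)
    (by simpa [hτ₁, hdone] using hdi)).frame ?_
  intro τ₂ hacc hf₂
  have hbz₂ : τ₂.r .bz = σ.r .bz := by rw [hf₂.1 _ rfl]; simp [hτ₁, hS'.bz_eq, hbz]
  have hbg₂ : τ₂.r .bg = 4 * I.n + 8 := by rw [hf₂.1 _ rfl]; simp [hτ₁, hS'.bg_eq]
  have hn₂ : τ₂.r .n = I.n := by rw [hf₂.1 _ rfl]; simp [hτ₁, hS'.n_eq]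
  have hs₂ : τ₂.r .s = w := by rw [hf₂.1 _ rfl]; simp [hτ₁]
  have hc₂ : τ₂.r .cand = σ.r .cand := by rw [hf₂.1 _ rfl]; simp [hτ₁, hcand]
  have hd₂ : τ₂.a .dif = τ.a .dif := by rw [hf₂.2 _ rfl]; simp [hτ₁]
  simp only [hτ₁, St.set_r, reduceCtorEq, if_false, if_true, hcand] at hacc
  rw [hS'.bz_eq] at hacc
  generalize hcv : σ.r .cand = v at *
  have hneg := confine_neg (4 * I.n + 8) ((I.e v : ℤ) - I.e w) (by omega)
  have habs := abs_confine_le (4 * I.n + 8) ((I.e v : ℤ) - I.e w) (by omega)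
  rw [neg_sub] at hneg
  simp only [wp_seq, wp_asg, wp_sto, wp_ite, wp_skip, Cn.holds_lt, Cn.holds_eq, Ex.eval_add, Ex.eval_sub,
      Ex.eval_mul, Ex.eval_get, Ex.eval_var, Ex.eval_lit, eval_labE, St.set_r, St.set_a, St.put_r,
      St.put_a, reduceCtorEq, if_true, if_false, true_and, and_true, false_and, and_false, hbz₂, hbg₂, hn₂, hs₂, hc₂, hd₂, hcv]
  refine ⟨by omega, by omega, ?_, ?_⟩
  · refine hs.congr_dif fun x y hx hy hdx hdy => ?_
    have hxv : x ≠ v := fun hc => hdx (hc ▸ hr.1)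
    have hyv : y ≠ v := fun hc => hdy (hc ▸ hr.1)
    simp only [St.put_a, index_inj hy hlt, index_inj hy hv, hxv, hyv, and_false, false_and,
      if_false, hd₂]
  · intro i' hi'
    rcases Nat.lt_or_eq_of_le (Nat.lt_succ_iff.1 hi') with h1 | rfl
    · have hlt' := h.ord_lt i' (by omega)
      have hne' : σ.a .ord i' ≠ w := fun hc => by
        have := h.ord_inj i' i (by omega) hi (hc.trans hw.symm); omega
      simp only [index_inj hlt' hv, index_inj hlt' hlt, index_inj hv hv, index_inj hv hlt, hne', hne,
        and_false, false_and, if_false]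
      exact hd i' h1
    · rw [hw]
      simp only [index_inj hlt hv, index_inj hlt hlt, index_inj hv hv, index_inj hv hlt, hne,
        Ne.symm hne, and_false, false_and, if_false, true_and, if_true]
      constructor <;> omega

/-- Insertion from the top without early exit: once the comparison fails it fails in all later
rounds, which is the last alternative of the invariant. -/
theorem wp_place {σ : St} (hV : 1000 * (I.n * I.n) + 1000 * I.n + 1000 ≤ V)
    (hL : 16 * I.n + 32 ≤ L) (hS : I.Setup σ)
    (h : I.Sorted (σ.a .done) (σ.a .ord) (σ.a .dif) (σ.r .k))
    (hv : σ.r .cand < I.n) (hr : I.Ready (σ.a .done) (σ.r .cand)) (hnz : I.NZ (σ.r .cand))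
    (hd : ∀ i < σ.r .k, (σ.a .dif (σ.r .cand * I.n + σ.a .ord i) : ℤ) = (4 * I.n + 8) +
          confine (4 * I.n + 8) ((I.e (σ.r .cand) : ℤ) - I.e (σ.a .ord i)) ∧
        (σ.a .dif (σ.a .ord i * I.n + σ.r .cand) : ℤ) = (4 * I.n + 8) +
          confine (4 * I.n + 8) ((I.e (σ.a .ord i) : ℤ) - I.e (σ.r .cand))) :
    WP V L place σ fun τ => I.Sorted (fun x => if x = σ.r .cand then 1 else σ.a .done x)
      (τ.a .ord) (τ.a .dif) (τ.r .k) := by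
  have hkn := h.le_n
  simp only [place, wp_seq, wp_asg, Ex.eval_var]
  refine ⟨by omega, ?_⟩
  refine wp_loop (fun j τ => τ.r .pos ≤ σ.r .k ∧
    (∀ i < τ.r .pos, τ.a .ord i = σ.a .ord i) ∧
    (∀ i, τ.r .pos ≤ i → i < σ.r .k → τ.a .ord (i + 1) = σ.a .ord i ∧
      I.e (σ.r .cand) ≤ I.e (σ.a .ord i)) ∧
    (τ.r .pos + j = σ.r .k ∨
      (0 < τ.r .pos ∧ I.e (σ.a .ord (τ.r .pos - 1)) ≤ I.e (σ.r .cand)))) (by decide)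
    (by simp; omega) ?_ ?_ ?_
  · simp
    intro i h1 h2; omega
  · intro j τ hj ⟨hp, h1, h2, h3⟩ hji hf
    simp only [St.set_r, reduceCtorEq, if_false] at hj
    have hp0 : 0 < τ.r .pos := by omega
    have hdif : τ.a .dif = σ.a .dif := hf.2 _ rfl
    have hcand : τ.r .cand = σ.r .cand := by rw [hf.1 _ rfl]; simp
    have hn : τ.r .n = I.n := by rw [hf.1 _ rfl]; simp [hS.n_eq]
    have hbg : τ.r .bg = 4 * I.n + 8 := by rw [hf.1 _ rfl]; simp [hS.bg_eq]
    have hlast := h1 (τ.r .pos - 1) (by omega)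
    have hdl := (hd (τ.r .pos - 1) (by omega)).1
    have hlt := h.ord_lt (τ.r .pos - 1) (by omega)
    simp only [wp_seq, wp_asg, wp_sto, wp_ite, wp_skip, Cn.holds_lt, Cn.holds_eq, Ex.eval_add, Ex.eval_sub,
      Ex.eval_mul, Ex.eval_get, Ex.eval_var, Ex.eval_lit, eval_labE, St.set_r, St.set_a, St.put_r,
      St.put_a, reduceCtorEq, if_true, if_false, true_and, and_true, false_and, and_false, hcand, hn, hbg, hdif, hlast]
    have hcmp : σ.a .dif (σ.r .cand * I.n + σ.a .ord (τ.r .pos - 1)) < 4 * I.n + 8 ↔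
        I.e (σ.r .cand) < I.e (σ.a .ord (τ.r .pos - 1)) := by
      unfold confine at hdl; omega
    rw [hcmp]
    refine ⟨fun hc => ⟨by omega, by omega, by omega, ?_, ?_, ?_⟩, fun hc => ⟨hp, h1, h2, ?_⟩⟩
    · intro i hi
      rw [if_neg (by omega)]; exact h1 i (by omega)
    · intro i hi hik
      by_cases hie : i = τ.r .pos - 1
      · rw [if_pos (by omega), hie]; exact ⟨rfl, hc.le⟩
      · rw [if_neg (by omega)]; exact h2 i (by omega) hik
    · rcases h3 with h3 | h3
      · left; omega
      · omega
    · right; exact ⟨hp0, by omega⟩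
  · intro τ ⟨hp, h1, h2, h3⟩ hf
    simp only [St.set_r, reduceCtorEq, if_false] at h3
    have hdif : τ.a .dif = σ.a .dif := hf.2 _ rfl
    have hcand : τ.r .cand = σ.r .cand := by rw [hf.1 _ rfl]; simp
    have hk : τ.r .k = σ.r .k := by rw [hf.1 _ rfl]; simp
    simp only [wp_seq, wp_asg, wp_sto, wp_ite, wp_skip, Cn.holds_lt, Cn.holds_eq, Ex.eval_add, Ex.eval_sub,
      Ex.eval_mul, Ex.eval_get, Ex.eval_var, Ex.eval_lit, eval_labE, St.set_r, St.set_a, St.put_r,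
      St.put_a, reduceCtorEq, if_true, if_false, true_and, and_true, false_and, and_false, hcand, hk, St.put_a_of_ne (show Arr.dif ≠ .ord by decide), hdif]
    refine ⟨by omega, by omega, ?_⟩
    refine h.insert hv hr hnz hp h hd ?_ (by simp) ?_
    · intro i hi
      rw [St.put_a]
      rw [if_neg (by omega)]
      refine ⟨h1 i hi, ?_⟩
      rcases h3 with h3 | ⟨h3, h4⟩
      · omega
      · exact (h.mono i (τ.r .pos - 1) (by omega) (by omega)).trans h4
    · intro i hi hik
      rw [St.put_a, if_neg (by omega)]
      exact h2 i hi hik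

/-- Acyclicity provides a ready vertex as long as one is not done. Each round increases the number
of vertices that are done by exactly one, so `n` rounds treat all of them. -/
theorem wp_sort {σ : St} (hV : 1000 * (I.n * I.n) + 1000 * I.n + 1000 ≤ V)
    (hL : 16 * I.n + 32 ≤ L) (hS : I.Setup σ) (hI : I.Fits) (h0 : σ.a .done = fun _ => 0) :
    WP V L sort σ fun τ => I.Sorted (τ.a .done) (τ.a .ord) (τ.a .dif) (τ.r .k) ∧
      (∀ v < I.n, τ.a .done v ≠ 0) ∧ ∀ v < I.n, (τ.a .nz v ≠ 0 ↔ I.NZ v) := by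
  have hn := hS.n_eq
  simp only [sort, wp_seq, wp_asg, Ex.eval_lit]
  refine ⟨by omega, ?_⟩
  refine wp_loop (fun r τ => I.Sorted (τ.a .done) (τ.a .ord) (τ.a .dif) (τ.r .k) ∧
    ((Finset.range I.n).filter fun v => τ.a .done v ≠ 0).card = r ∧
    ∀ v < I.n, τ.a .done v ≠ 0 → (τ.a .nz v ≠ 0 ↔ I.NZ v)) (by decide) (by simp; omega) ?_ ?_ ?_
  · simp only [St.set_a, St.set_r, h0, reduceCtorEq, if_false, if_true]
    refine ⟨⟨?_, ?_, ?_, ?_, ?_, ?_, ?_, ?_, ?_⟩, ?_, ?_⟩ <;> simp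
  · intro r τ hr ⟨hs, hcard, hnz⟩ hri hf
    simp only [St.set_r, reduceCtorEq, if_false, hn] at hr
    have hS' : I.Setup τ := Setup.frame (σ := σ.set .k 0) (by
      refine hS.frame (p := asg .k 0) ⟨fun x hx => ?_, fun a _ => rfl⟩ rfl
      simp only [modR, decide_eq_false_iff_not] at hx
      simp [hx]) hf (by decide)
    have hex : ∃ v < I.n, τ.a .done v = 0 := by
      by_contra! hall
      rw [Finset.filter_true_of_mem (fun v hv => hall v (Finset.mem_range.1 hv)),
        Finset.card_range] at hcard
      omega
    refine wp_seq.2 ((wp_find hS'.toInput (by omega) (by omega) hs.done_le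
      (I.exists_ready hex)).frame ?_)
    intro τ₁ ⟨hv, hrd⟩ hf₁
    have hS₁ : I.Setup τ₁ := hS'.frame hf₁ (by decide)
    refine wp_seq.2 ((wp_testZero hS₁.toInput (by omega) (by omega) hv).frame ?_)
    intro τ₂ ⟨hle, hnzf⟩ hf₂
    have hS₂ : I.Setup τ₂ := hS₁.frame hf₂ (by decide)
    have hdone : τ₂.a .done = τ.a .done := by rw [hf₂.2 _ rfl, hf₁.2 _ rfl]
    have hord : τ₂.a .ord = τ.a .ord := by rw [hf₂.2 _ rfl, hf₁.2 _ rfl]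
    have hdif : τ₂.a .dif = τ.a .dif := by rw [hf₂.2 _ rfl, hf₁.2 _ rfl]
    have hnza : τ₂.a .nz = τ.a .nz := by rw [hf₂.2 _ rfl, hf₁.2 _ rfl]
    have hk : τ₂.r .k = τ.r .k := by rw [hf₂.1 _ rfl, hf₁.1 _ rfl]
    have hc : τ₂.r .cand = τ₁.r .cand := hf₂.1 _ rfl
    have hfin : ∀ τ₃ : St, I.Sorted (fun x => if x = τ₁.r .cand then 1 else τ.a .done x)
        (τ₃.a .ord) (τ₃.a .dif) (τ₃.r .k) → τ₃.a .done = τ.a .done → τ₃.a .nz = τ.a .nz →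
        τ₃.r .cand = τ₁.r .cand → τ₃.r .nzf = τ₂.r .nzf →
        WP V L (sto .done (var .cand) 1 ;; sto .nz (var .cand) (var .nzf)) τ₃ fun τ' =>
          I.Sorted (τ'.a .done) (τ'.a .ord) (τ'.a .dif) (τ'.r .k) ∧
          ((Finset.range I.n).filter fun v => τ'.a .done v ≠ 0).card = r + 1 ∧
          ∀ v < I.n, τ'.a .done v ≠ 0 → (τ'.a .nz v ≠ 0 ↔ I.NZ v) := by
      intro τ₃ h1 h2 h3 h4 h5
      have hd' : ∀ c d : ℕ, ((τ₃.put .done c 1).put .nz c d).a .done =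
          fun x => if x = c then 1 else τ.a .done x := fun c d => by
        funext x; simp [h2]
      simp only [wp_seq, wp_asg, wp_sto, wp_ite, wp_skip, Cn.holds_lt, Cn.holds_eq, Ex.eval_add, Ex.eval_sub,
      Ex.eval_mul, Ex.eval_get, Ex.eval_var, Ex.eval_lit, eval_labE, St.set_r, St.set_a, St.put_r,
      St.put_a, reduceCtorEq, if_true, if_false, true_and, and_true, false_and, and_false, h4, h5]
      refine ⟨by omega, by omega, ?_, ?_, ?_⟩
      · rw [hd']
        simpa only [St.put_a_of_ne (show Arr.ord ≠ .done by decide),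
          St.put_a_of_ne (show Arr.ord ≠ .nz by decide),
          St.put_a_of_ne (show Arr.dif ≠ .done by decide),
          St.put_a_of_ne (show Arr.dif ≠ .nz by decide)] using h1
      · rw [← hcard, ← Finset.card_insert_of_notMem (a := τ₁.r .cand)
          (s := (Finset.range I.n).filter fun v => τ.a .done v ≠ 0) (by simp [hrd.1])]
        congr 1
        ext x
        simp only [h2, Finset.mem_filter, Finset.mem_range, Finset.mem_insert]
        by_cases hx : x = τ₁.r .cand
        · simp [hx, hv]
        · simp [hx]
      · intro x hx hdx
        by_cases hxc : x = τ₁.r .cand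
        · rw [if_pos hxc, hxc]; exact hnzf
        · rw [if_neg hxc, h2] at hdx
          rw [if_neg hxc, h3]
          exact hnz x hx hdx
    refine wp_seq.2 (wp_ite.2 ⟨fun hz => ?_, fun hz => ?_⟩)
    · simp only [Cn.holds_eq, Ex.eval_var, Ex.eval_lit] at hz
      rw [wp_skip]
      refine (hfin τ₂ ?_ hdone hnza hc rfl).mono fun τ' h => ?_
      · rw [hord, hdif, hk]
        exact hs.insert_zero hrd (fun h => hnzf.2 h hz)
      · exact h
    · simp only [Cn.holds_eq, Ex.eval_var, Ex.eval_lit] at hz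
      refine wp_seq.2 ((wp_compareAll hV hL hS₂ hI (by rwa [hdone, hord, hdif, hk])
        (by rw [hc]; exact hv) (by rw [hc, hdone]; exact hrd)).frame ?_)
      intro τ₃ ⟨hs₃, hd₃⟩ hf₃
      have hS₃ : I.Setup τ₃ := hS₂.frame hf₃ (by decide)
      have e1 : τ₃.a .done = τ.a .done := by rw [hf₃.2 _ rfl, hdone]
      have e2 : τ₃.a .ord = τ₂.a .ord := by rw [hf₃.2 _ rfl]
      have e3 : τ₃.r .k = τ₂.r .k := by rw [hf₃.1 _ rfl]
      have e4 : τ₃.r .cand = τ₁.r .cand := by rw [hf₃.1 _ rfl, hc]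
      rw [hc] at hd₃
      refine (wp_place hV hL hS₃ (by rw [e1, e2, e3, ← hdone]; exact hs₃) (by rw [e4]; exact hv)
        (by rw [e4, e1]; exact hrd) (by rw [e4]; exact hnzf.1 hz)
        (by rw [e2, e3, e4]; exact hd₃)).frame ?_
      intro τ₄ hs₄ hf₄
      rw [e4, e1] at hs₄
      refine (hfin τ₄ hs₄ ?_ ?_ ?_ ?_).mono fun τ' h => ?_
      · rw [hf₄.2 _ rfl, e1]
      · rw [hf₄.2 _ rfl, hf₃.2 _ rfl, hnza]
      · rw [hf₄.1 _ rfl, e4]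
      · rw [hf₄.1 _ rfl, hf₃.1 _ rfl]
      · exact h
  · intro τ ⟨hs, hcard, hnz⟩ hf
    simp only [St.set_r, reduceCtorEq, if_false, hn] at hcard
    have hall : ∀ v < I.n, τ.a .done v ≠ 0 := by
      have := Finset.eq_of_subset_of_card_le (Finset.filter_subset (fun v => τ.a .done v ≠ 0)
        (Finset.range I.n)) (by rw [hcard, Finset.card_range])
      intro v hv
      exact Finset.filter_eq_self.1 this v (Finset.mem_range.2 hv)
    exact ⟨hs, hall, fun v hv => hnz v hv (hall v hv)⟩

end Cmd
end RAM

/-! ### The positions of an instance -/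

namespace RAM
namespace Inst

open Classical in
/-- The number of nonzero vertices with a given exponent. -/
noncomputable def mult (I : Inst) (b : ℕ) : ℕ :=
  ((Finset.range I.n).filter fun v => I.NZ v ∧ I.e v = b).card

/-- The multiplicities, padded at `0`. -/
noncomputable def cap (I : Inst) : ℕ → ℕ := if 0 < I.mult 0 then padded I.mult (I.n + 1) else I.mult

/-- The positions of digits that are taken into account. -/
def Pos (I : Inst) (b : ℕ) : Prop := CarrySupport I.cap b

noncomputable instance (I : Inst) : DecidablePred I.Pos := Classical.decPred _

variable {I : Inst}

open Classical in
theorem sum_mult_le_card (I : Inst) (N : ℕ) :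
    ∑ b ∈ Finset.range N, I.mult b ≤ ((Finset.range I.n).filter I.NZ).card := by
  unfold mult
  rw [← Finset.card_biUnion]
  · refine Finset.card_le_card fun v hv => ?_
    simp only [Finset.mem_biUnion, Finset.mem_filter] at hv ⊢
    obtain ⟨_, _, h, h', _⟩ := hv
    exact ⟨h, h'⟩
  · intro b _ b' _ hbb
    refine Finset.disjoint_left.2 fun v h h' => hbb ?_
    rw [Finset.mem_filter] at h h'
    rw [← h.2.2, h'.2.2]

theorem sum_mult_le (I : Inst) (N : ℕ) : ∑ b ∈ Finset.range N, I.mult b ≤ I.n := by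
  classical
  exact (I.sum_mult_le_card N).trans ((Finset.card_filter_le _ _).trans (by simp))

theorem mult_le (I : Inst) (b : ℕ) : I.mult b ≤ I.n := by
  classical
  exact (Finset.card_le_card (Finset.filter_subset _ _)).trans (by simp)

theorem mult_pos {v : ℕ} (hv : v < I.n) (hnz : I.NZ v) : 0 < I.mult (I.e v) :=
  Finset.card_pos.2 ⟨v, by simp [hv, hnz]⟩

theorem mult_le_cap (I : Inst) (b : ℕ) : I.mult b ≤ I.cap b := by
  unfold cap
  split_ifs
  · rw [padded]; omega
  · exact le_rfl

theorem pos_e {v : ℕ} (hv : v < I.n) (hnz : I.NZ v) : I.Pos (I.e v) := by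
  have h1 := mult_pos hv hnz
  have h2 := I.mult_le_cap (I.e v)
  unfold Pos CarrySupport; omega

theorem cap_eq (h : 0 < I.mult 0) : I.cap = padded I.mult (I.n + 1) := if_pos h

theorem cap_eq_ite (h : 0 < I.mult 0) (b : ℕ) :
    I.cap b = I.mult b + if b = 0 then I.n + 1 else 0 := by rw [cap_eq h, padded]

theorem carryBound_cap_le (h : 0 < I.mult 0) (b : ℕ) : carryBound I.cap b ≤ I.n + 1 := by
  rw [cap_eq h]
  exact carryBound_padded_le (fun i => by have := I.mult_le i; omega) b

theorem cap_le (h : 0 < I.mult 0) (b : ℕ) : I.cap b ≤ 2 * I.n + 1 := by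
  have := I.mult_le b
  rw [cap_eq_ite h]; split_ifs <;> omega

/-- The multiplicities add up to at most `n`. A linear bound is all that the running time needs. -/
theorem count_pos_le (h : 0 < I.mult 0) (N : ℕ) : Nat.count I.Pos N ≤ 4 * I.n + 4 := by
  have h1 := count_carrySupport_le I.mult (I.n + 1) N
  have h2 := I.sum_mult_le (N + 1)
  have h3 := Nat.count_monotone I.Pos (Nat.le_succ N)
  have h4 : Nat.count I.Pos (N + 1) = Nat.count (CarrySupport (padded I.mult (I.n + 1))) (N + 1) := by
    unfold Pos; simp only [cap_eq h]
  rw [Finset.sum_range_succ'] at h2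
  rw [Nat.succ_eq_add_one] at h3
  omega

/-- Positions stay within `n + 1` of an exponent, well inside the range `4 * n + 8` in which
differences are known exactly. -/
theorem exists_of_pos (h : 0 < I.mult 0) {b : ℕ} (hb : I.Pos b) :
    ∃ v < I.n, I.NZ v ∧ I.e v ≤ b ∧ b ≤ I.e v + I.n + 1 := by
  unfold Pos at hb
  rw [cap_eq h] at hb
  obtain ⟨e, he, hm, hlt⟩ := exists_of_carrySupport (fun i => by have := I.mult_le i; omega) h b hb
  obtain ⟨v, hv⟩ := Finset.card_pos.1 hm
  simp only [Finset.mem_filter, Finset.mem_range] at hv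
  refine ⟨v, hv.1, hv.2.1, by omega, ?_⟩
  by_cases hc : e < b
  · have := hlt hc; omega
  · omega

theorem not_pos_iff {b : ℕ} : ¬ I.Pos b ↔ I.cap b = 0 ∧ carryBound I.cap b = 0 := by
  unfold Pos CarrySupport; omega

theorem carryBound_succ_of_not_pos {b : ℕ} (h : ¬ I.Pos b) : carryBound I.cap (b + 1) = 0 := by
  rw [not_pos_iff] at h
  rw [carryBound, h.1, h.2]; split_ifs <;> rfl

/-- No positions occur far beyond the exponents. -/
theorem count_pos_eq (h : 0 < I.mult 0) {b N : ℕ} (hbN : b + (4 * I.n + 8) ≤ N)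
    (hgap : ∀ v < I.n, I.NZ v → I.e v ≤ b ∨ N ≤ I.e v) :
    Nat.count I.Pos N = Nat.count I.Pos (b + (4 * I.n + 8)) ∧ carryBound I.cap N = 0 := by
  have hno : ∀ p, b + (4 * I.n + 7) ≤ p → p < N → ¬ I.Pos p := by
    intro p h1 h2 hp
    obtain ⟨v, hv, hnz, h3, h4⟩ := exists_of_pos h hp
    rcases hgap v hv hnz with h5 | h5 <;> omega
  constructor
  · induction N, hbN using Nat.le_induction with
    | base => rfl
    | succ N hN ih =>
      rw [Nat.count_succ, if_neg (hno N (by omega) (by omega)), Nat.add_zero]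
      exact ih (fun v hv hnz => by rcases hgap v hv hnz with h | h <;> omega)
        (fun p h1 h2 => hno p h1 (by omega))
  · obtain ⟨N, rfl⟩ := Nat.exists_eq_succ_of_ne_zero (show N ≠ 0 by omega)
    exact carryBound_succ_of_not_pos (hno N (by omega) (by omega))

theorem exists_count_eq {N s : ℕ} (hs : s < Nat.count I.Pos N) :
    ∃ p, I.Pos p ∧ Nat.count I.Pos p = s := by
  induction N with
  | zero => simp at hs
  | succ N ih =>
    rw [Nat.count_succ] at hs
    by_cases hlt : s < Nat.count I.Pos N
    · exact ih hlt
    · split_ifs at hs with hN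
      · exact ⟨N, hN, by omega⟩
      · omega

theorem count_lt_count {p q : ℕ} (hp : I.Pos p) (hpq : p < q) :
    Nat.count I.Pos p < Nat.count I.Pos q :=
  Nat.count_strict_mono hp hpq

theorem count_inj {p q : ℕ} (hp : I.Pos p) (hq : I.Pos q)
    (h : Nat.count I.Pos p = Nat.count I.Pos q) : p = q :=
  Nat.count_injective hp hq h

namespace Sorted

variable {done ord dif : ℕ → ℕ} {k : ℕ}

theorem mult_eq (h : I.Sorted done ord dif k) (hall : ∀ v < I.n, done v ≠ 0) (b : ℕ) :
    I.mult b = ((Finset.range k).filter fun i => I.e (ord i) = b).card := by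
  classical
  unfold mult
  symm
  refine Finset.card_bij (fun i _ => ord i) ?_ ?_ ?_
  · intro i hi
    simp only [Finset.mem_filter, Finset.mem_range] at hi ⊢
    exact ⟨h.ord_lt i hi.1, h.ord_nz i hi.1, hi.2⟩
  · intro i hi j hj hij
    simp only [Finset.mem_filter, Finset.mem_range] at hi hj
    exact h.ord_inj i j hi.1 hj.1 hij
  · intro v hv
    simp only [Finset.mem_filter, Finset.mem_range] at hv
    obtain ⟨i, hi, rfl⟩ := h.ord_surj v hv.1 (hall v hv.1) hv.2.1
    exact ⟨i, by simp [hi, hv.2.2], rfl⟩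

theorem mult_zero_pos (h : I.Sorted done ord dif k) (hI : I.Fits) (hk : 0 < k) :
    0 < I.mult 0 := by
  have := mult_pos (h.ord_lt 0 hk) (h.ord_nz 0 hk)
  rwa [h.e_ord_zero hI hk] at this

end Sorted

/-- The list of the positions: the position with number `s` exceeds the exponent of the vertex
`ur s - 1` by `uj s`, and `adj s` tells whether the next number is a position, too. -/
structure Entries (I : Inst) (ur uj adj : ℕ → ℕ) (t : ℕ) : Prop where
  entry : ∀ p, I.Pos p → Nat.count I.Pos p < t → ∃ v < I.n, I.NZ v ∧
    ur (Nat.count I.Pos p) = v + 1 ∧ I.e v + uj (Nat.count I.Pos p) = p ∧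
    uj (Nat.count I.Pos p) ≤ I.n + 1 ∧ (adj (Nat.count I.Pos p) = 1 ↔ I.Pos (p + 1))

theorem Entries.succ {ur uj adj ur' uj' adj' : ℕ → ℕ} {p v j a : ℕ}
    (h : I.Entries ur uj adj (Nat.count I.Pos p)) (hp : I.Pos p) (hv : v < I.n) (hnz : I.NZ v)
    (hj : I.e v + j = p) (hjle : j ≤ I.n + 1) (ha : a = 1 ↔ I.Pos (p + 1))
    (hur : ∀ x, ur' x = if x = Nat.count I.Pos p then v + 1 else ur x)
    (huj : ∀ x, uj' x = if x = Nat.count I.Pos p then j else uj x)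
    (hadj : ∀ x, adj' x = if x = Nat.count I.Pos p then a else adj x) :
    I.Entries ur' uj' adj' (Nat.count I.Pos p + 1) := by
  refine ⟨fun q hq hlt => ?_⟩
  rw [hur, huj, hadj]
  rcases Nat.lt_or_eq_of_le (Nat.lt_succ_iff.1 hlt) with h1 | h1
  · simp only [if_neg (Nat.ne_of_lt h1)]
    exact h.entry q hq h1
  · simp only [if_pos h1]
    obtain rfl := count_inj hq hp h1
    exact ⟨v, hv, hnz, rfl, hj, hjle, ha⟩

end Inst
end RAM

/-! ### Listing the positions -/

namespace RAM

open Ex (var get)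

namespace Inst

/-- The list of the positions is complete. -/
structure Listed (I : Inst) (τ : St) : Prop extends
    I.Entries (τ.a .ur) (τ.a .uj) (τ.a .adj) (τ.r .u) where
  u_le : τ.r .u ≤ 4 * I.n + 4
  u1_eq : τ.r .u1 = τ.r .u + 1
  count_lt : ∀ p, I.Pos p → Nat.count I.Pos p < τ.r .u
  exists_count : ∀ s < τ.r .u, ∃ p, I.Pos p ∧ Nat.count I.Pos p = s
  mult_pos : 0 < τ.r .u → 0 < I.mult 0
  ur_last : τ.a .ur (τ.r .u) = 0
  uj_last : τ.a .uj (τ.r .u) = 0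
  ui_eq : ∀ v < I.n, I.NZ v → τ.a .ui v = Nat.count I.Pos (I.e v)

end Inst

namespace Cmd

open Inst

variable {V L : ℕ} {I : Inst}

theorem carryBound_cap_succ {b z : ℕ} (hz : z = if I.cap b + carryBound I.cap b ≤ 1 ∧
      I.cap (b + 1) = 0 then 0 else (I.cap b + carryBound I.cap b + 1) / 2) :
    carryBound I.cap (b + 1) = z ∧ (0 < I.cap b + carryBound I.cap b →
      (I.Pos (b + 1) ↔ I.cap (b + 1) ≠ 0 ∨ z ≠ 0)) := by
  have h1 : carryBound I.cap (b + 1) = z := hz.symm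
  refine ⟨h1, fun h => ?_⟩
  unfold Pos CarrySupport
  rw [h1]; omega

theorem wp_emit {σ : St} (hhf : σ.a .hf (σ.r .y + 1) = (σ.r .y + 1) / 2)
    (hV : σ.r .y + σ.r .t + σ.r .v + σ.r .j + 2 ≤ V) :
    WP V L emit σ fun τ => τ.r .t = σ.r .t + 1 ∧
      τ.r .y = (if σ.r .j + 1 < σ.r .g ∧ σ.r .y < 2 then 0 else (σ.r .y + 1) / 2) ∧
      (∀ x, τ.a .ur x = if x = σ.r .t then σ.r .v + 1 else σ.a .ur x) ∧
      (∀ x, τ.a .uj x = if x = σ.r .t then σ.r .j else σ.a .uj x) ∧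
      ∀ x, τ.a .adj x = if x = σ.r .t then (if σ.r .j + 1 < σ.r .g ∧ τ.r .y = 0 then 0 else 1)
        else σ.a .adj x := by
  have h1 : σ.r .y < 2 → (σ.r .y + 1) / 2 ≤ V := fun _ => by omega
  simp only [emit, wp_seq, wp_asg, wp_sto, wp_ite, wp_skip, Cn.holds_lt, Cn.holds_eq, Ex.eval_add, Ex.eval_sub,
      Ex.eval_mul, Ex.eval_get, Ex.eval_var, Ex.eval_lit, eval_labE, St.set_r, St.set_a, St.put_r,
      St.put_a, reduceCtorEq, if_true, if_false, true_and, and_true, false_and, and_false, hhf]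
  by_cases h1 : σ.r .j + 1 < σ.r .g
  · by_cases h2 : σ.r .y < 2
    · simp [h1, h2]; omega
    · have h3 : (σ.r .y + 1) / 2 ≠ 0 := by omega
      simp only [h1, h2, h3, if_true, if_false, true_and, and_true, and_false, false_and,
        forall_true_left, not_true, not_false_eq_true, false_implies, implies_true]
      omega
  · simp [h1]; omega

/-- For `j < g` the variable `y` is coefficient bound plus carry bound; from `g` on it is the carry
bound alone, because the summands at the next exponent are added in the next block. The hypothesis
`hlast` justifies the second case of `carryBound` at the last place. -/
theorem wp_block {σ : St} (hV : 1000 * (I.n * I.n) + 1000 * I.n + 1000 ≤ V)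
    (hL : 16 * I.n + 32 ≤ L) (hS : I.Setup σ) (h0 : 0 < I.mult 0) (hv : σ.r .v < I.n)
    (hnz : I.NZ (σ.r .v)) (hg : 0 < σ.r .g) (hgle : σ.r .g ≤ 4 * I.n + 8)
    (ht : σ.r .t = Nat.count I.Pos (I.e (σ.r .v)))
    (hy : σ.r .y + σ.r .cnt = I.cap (I.e (σ.r .v)) + carryBound I.cap (I.e (σ.r .v)))
    (hcap : ∀ j, 0 < j → j < σ.r .g → I.cap (I.e (σ.r .v) + j) = 0)
    (hlast : I.Pos (I.e (σ.r .v) + (σ.r .g - 1)) → 0 < I.cap (I.e (σ.r .v) + σ.r .g))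
    (hE : I.Entries (σ.a .ur) (σ.a .uj) (σ.a .adj) (σ.r .t)) :
    WP V L block σ fun τ => τ.r .t = Nat.count I.Pos (I.e (σ.r .v) + σ.r .g) ∧
      τ.r .y = carryBound I.cap (I.e (σ.r .v) + σ.r .g) ∧ τ.r .cnt = 0 ∧
      I.Entries (τ.a .ur) (τ.a .uj) (τ.a .adj) (τ.r .t) := by
  have hbg := hS.bg_eq
  have hyb : ∀ b, I.cap b + carryBound I.cap b ≤ 3 * I.n + 2 := fun b => by
    have := cap_le h0 b; have := carryBound_cap_le h0 b; omega
  have hyb' := hyb (I.e (σ.r .v))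
  simp only [block, wp_seq, wp_asg, Ex.eval_add, Ex.eval_var, Ex.eval_lit]
  refine ⟨by omega, by omega, ?_⟩
  refine wp_loop (fun j τ =>
    τ.r .t = Nat.count I.Pos (I.e (σ.r .v) + min j (σ.r .g)) ∧
    (j < σ.r .g → τ.r .y = I.cap (I.e (σ.r .v) + j) + carryBound I.cap (I.e (σ.r .v) + j)) ∧
    (σ.r .g ≤ j → τ.r .y = carryBound I.cap (I.e (σ.r .v) + σ.r .g)) ∧ τ.r .cnt = 0 ∧
    I.Entries (τ.a .ur) (τ.a .uj) (τ.a .adj) (τ.r .t)) (by decide) (by simp; omega) ?_ ?_ ?_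
  · simp [ht, hy, hE]
    rw [← ht]; exact ⟨by omega, hE⟩
  · intro j τ hj ⟨h1, h2, h3, h4, h5⟩ hji hf
    simp only [St.set_r, reduceCtorEq, if_false, hbg] at hj
    have hvτ : τ.r .v = σ.r .v := by rw [hf.1 _ rfl]; simp
    have hgτ : τ.r .g = σ.r .g := by rw [hf.1 _ rfl]; simp
    have hhf : τ.a .hf = σ.a .hf := by rw [hf.2 _ rfl]; simp
    generalize hbdef : I.e (σ.r .v) = b at *
    generalize σ.r .g = g at *
    by_cases hjg : j < g
    · rw [min_eq_left hjg.le] at h1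
      have hyj := h2 hjg
      have hyb'' := hyb (b + j)
      have hct := count_pos_le h0 (b + j)
      have hmin : min (j + 1) g = j + 1 := by omega
      by_cases hy0 : 0 < τ.r .y
      · have hp : I.Pos (b + j) := by unfold Pos CarrySupport; omega
        have hhfy : σ.a .hf (τ.r .y + 1) = (τ.r .y + 1) / 2 := hS.hf_eq _ (by omega)
        have hnext : ∀ z, z = (if j + 1 < g ∧ τ.r .y < 2 then 0 else (τ.r .y + 1) / 2) →
            carryBound I.cap (b + (j + 1)) = z ∧
            ((if j + 1 < g ∧ z = 0 then 0 else 1) = 1 ↔ I.Pos (b + j + 1)) := by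
          intro z hz
          obtain ⟨e1, e2⟩ := carryBound_cap_succ (I := I) (b := b + j) (z := z) (by
            rw [hz]
            by_cases hj1 : j + 1 < g
            · have := hcap (j + 1) (by omega) hj1
              rw [← add_assoc] at this
              rw [this, ← hyj]
              simp only [hj1, true_and, and_true]
              split_ifs <;> omega
            · obtain rfl : g = j + 1 := by omega
              have := hlast hp
              rw [← add_assoc] at this
              rw [if_neg (by omega), if_neg (by omega), hyj])
          refine ⟨e1, ?_⟩
          rw [e2 (by omega)]
          by_cases hj1 : j + 1 < g
          · have := hcap (j + 1) (by omega) hj1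
            rw [← add_assoc] at this
            rw [this]
            by_cases hz0 : z = 0 <;> simp [hj1, hz0]
          · obtain rfl : g = j + 1 := by omega
            have := hlast hp
            rw [← add_assoc] at this
            simp; omega
        refine wp_ite.2 ⟨fun _ => wp_ite.2 ⟨fun _ => ?_, fun h => ?_⟩, fun h => ?_⟩
        · refine (wp_emit (by rw [hhf, hhfy]) (by rw [hvτ, hji, h1]; omega)).frame ?_
          intro τ' ⟨g1, g2, g3, g4, g5⟩ hf'
          have hcnt : τ'.r .cnt = 0 := by rw [hf'.1 _ rfl, h4]
          rw [hji, hgτ] at g2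
          simp only [hji, hgτ, hvτ] at g3 g4 g5
          obtain ⟨e1, e2⟩ := hnext _ g2
          simp only [St.set_r, St.set_a, reduceCtorEq, if_false]
          refine ⟨?_, fun hj1 => ?_, fun hj1 => ?_, hcnt, ?_⟩
          · rw [hmin, ← add_assoc, Nat.count_succ, if_pos hp, g1, h1]
          · rw [hcap (j + 1) (by omega) hj1, e1]; omega
          · obtain rfl : g = j + 1 := by omega
            exact e1.symm
          · rw [h1] at h5 g1 g3 g4 g5
            rw [g1]
            refine h5.succ hp hv hnz (by omega) ?_ e2 g3 g4 g5
            -- The position is within `n + 1` of some exponent, and no exponent lies after `b` up to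
            -- `b + j`.
            obtain ⟨w, hw, hnw, hw1, hw2⟩ := exists_of_pos h0 hp
            by_cases hwb : I.e w ≤ b
            · omega
            · have e3 := hcap (I.e w - b) (by omega) (by omega)
              rw [show b + (I.e w - b) = I.e w by omega] at e3
              have e4 := (mult_pos hw hnw).trans_le (I.mult_le_cap _)
              omega
        · exact absurd hy0 h
        · simp only [Cn.holds_lt, Ex.eval_var, hji, hgτ] at h
          exact absurd hjg h
      · have hp : ¬ I.Pos (b + j) := by unfold Pos CarrySupport; omega
        have e1 := carryBound_succ_of_not_pos hp
        refine wp_ite.2 ⟨fun _ => wp_ite.2 ⟨fun h => absurd h hy0, fun _ => ?_⟩, fun h => ?_⟩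
        · rw [wp_skip]
          simp only [St.set_r, St.set_a, reduceCtorEq, if_false]
          refine ⟨?_, fun hj1 => ?_, fun hj1 => ?_, h4, h5⟩
          · rw [hmin, ← add_assoc, Nat.count_succ, if_neg hp, h1, Nat.add_zero]
          · rw [hcap (j + 1) (by omega) hj1, ← add_assoc, e1]; omega
          · obtain rfl : g = j + 1 := by omega
            rw [← add_assoc, e1]; omega
        · simp only [Cn.holds_lt, Ex.eval_var, hji, hgτ] at h
          exact absurd hjg h
    · refine wp_ite.2 ⟨fun h => ?_, fun _ => ?_⟩
      · simp only [Cn.holds_lt, Ex.eval_var, hji, hgτ] at h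
        exact absurd h hjg
      · rw [wp_skip]
        simp only [St.set_r, St.set_a, reduceCtorEq, if_false]
        refine ⟨?_, fun hj1 => by omega, fun _ => h3 (by omega), h4, h5⟩
        rw [h1, min_eq_right (by omega), min_eq_right (by omega)]
  · intro τ ⟨h1, h2, h3, h4, h5⟩ hf
    simp only [St.set_r, reduceCtorEq, if_false, hbg] at h1 h3
    refine ⟨?_, h3 hgle, h4, h5⟩
    rw [h1, min_eq_right hgle]

/-- Vertices with equal exponents have gap `0`, and `cnt` collects their number until the last of
them starts a block. A gap beyond the exact range is harmless: by `count_pos_eq` there is neither a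
position nor a carry left at its end. -/
theorem wp_positions {σ : St} (hV : 1000 * (I.n * I.n) + 1000 * I.n + 1000 ≤ V)
    (hL : 16 * I.n + 32 ≤ L) (hS : I.Setup σ) (hI : I.Fits)
    (h : I.Sorted (σ.a .done) (σ.a .ord) (σ.a .dif) (σ.r .k))
    (hall : ∀ v < I.n, σ.a .done v ≠ 0) :
    WP V L positions σ I.Listed := by
  have hkn := h.le_n
  have hn := hS.n_eq
  set k := σ.r .k with hk
  set ord := σ.a .ord with hord
  set E : ℕ → ℕ := fun i => I.e (ord i) with hEdef
  have hexp : ∀ v < I.n, I.NZ v → ∃ i < k, ord i = v := fun v hv hnz =>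
    h.ord_surj v hv (hall v hv) hnz
  simp only [positions, wp_seq, wp_asg, Ex.eval_add, Ex.eval_var, Ex.eval_lit, St.set_r, St.set_a,
    reduceCtorEq, if_false, hn]
  refine ⟨by omega, by omega, by omega, ?_⟩
  refine wp_loop (fun i τ =>
    (i < k → τ.r .t = Nat.count I.Pos (E i) ∧ τ.r .y = carryBound I.cap (E i) ∧
      τ.r .cnt = ((Finset.range i).filter fun i' => E i' = E i).card +
        if E i = 0 then I.n + 1 else 0) ∧
    (i = k → 0 < k → ∀ N, E (k - 1) + (4 * I.n + 8) ≤ N → τ.r .t = Nat.count I.Pos N) ∧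
    (i = 0 → τ.r .t = 0) ∧
    I.Entries (τ.a .ur) (τ.a .uj) (τ.a .adj) (τ.r .t) ∧
    ∀ i' < i, τ.a .ui (ord i') = Nat.count I.Pos (E i')) (by decide) (by simp; omega) ?_ ?_ ?_
  · refine ⟨fun h0 => ?_, fun h0 => by omega, fun _ => by simp, ⟨by simp⟩, by simp⟩
    have := h.e_ord_zero hI h0
    simp [hEdef, this, carryBound]
  · intro i τ hi ⟨h1, _, _, h4, h5⟩ hii hf
    simp only [St.set_r, reduceCtorEq, if_false] at hi
    obtain ⟨ht, hy, hcnt⟩ := h1 hi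
    have h0 := h.mult_zero_pos hI (by omega : 0 < k)
    -- The composite command only serves as a common frame for the initial assignments and the loop.
    have hS' : I.Setup τ := Setup.frame (p := asg .t 0 ;; asg .y 0 ;; asg .cnt 0 ;; positions) hS
      ⟨fun x hx => (hf.1 x (by revert hx; cases x <;> decide)).trans
        (by revert hx; cases x <;> simp [modR]),
        fun a ha => hf.2 a (by revert ha; cases a <;> decide)⟩ (by decide)
    have hkτ : τ.r .k = k := by rw [hf.1 _ rfl]; simp [hk]
    have hordτ : τ.a .ord = ord := hf.2 _ rfl
    have hdif : τ.a .dif = σ.a .dif := hf.2 _ rfl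
    have hct := count_pos_le h0 (E i)
    have hv := h.ord_lt i hi
    have hnz := h.ord_nz i hi
    set b := E i with hb
    have hcntle : ((Finset.range i).filter fun i' => E i' = b).card ≤ i :=
      (Finset.card_le_card (Finset.filter_subset _ _)).trans (by simp)
    have hcnt1 : τ.r .cnt + 1 = ((Finset.range (i + 1)).filter fun i' => E i' = b).card +
        if b = 0 then I.n + 1 else 0 := by
      rw [Finset.range_add_one, Finset.filter_insert, if_pos hb.symm, Finset.card_insert_of_notMem
        (by simp), hcnt]
      omega
    have hui : ∀ f : ℕ → ℕ, (∀ x, f x = if x = ord i then Nat.count I.Pos b else τ.a .ui x) →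
        ∀ i' < i + 1, f (ord i') = Nat.count I.Pos (E i') := by
      intro f hf' i' hi'
      rw [hf']
      rcases Nat.lt_or_eq_of_le (Nat.lt_succ_iff.1 hi') with h6 | rfl
      · rw [if_neg fun hc => by have := h.ord_inj i' i (by omega) hi hc; omega]
        exact h5 i' h6
      · rw [if_pos rfl]
    have hdifi : i + 1 < k → σ.a .dif (ord (i + 1) * I.n + ord i) - (4 * I.n + 8) =
        min (4 * I.n + 8) (E (i + 1) - b) := by
      intro hi1
      have e1 := h.dif_eq _ _ (h.ord_lt _ hi1) hv (hall _ (h.ord_lt _ hi1)) (hall _ hv)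
        (h.ord_nz _ hi1) hnz (fun hc => by have := h.ord_inj _ _ hi1 hi hc; omega)
      have e2 := h.mono i (i + 1) (by omega) hi1
      simp only [hEdef, hb]
      unfold confine at e1
      omega
    have hmid : ∀ g τ₁, g = (if i + 1 < k then min (4 * I.n + 8) (E (i + 1) - b)
          else 4 * I.n + 8) → τ₁.r .g = g → τ₁.r .v = ord i → I.Setup τ₁ →
        τ₁.r .t = τ.r .t → τ₁.r .y = τ.r .y → τ₁.r .cnt = τ.r .cnt + 1 →
        τ₁.a .ur = τ.a .ur → τ₁.a .uj = τ.a .uj → τ₁.a .adj = τ.a .adj →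
        (∀ x, τ₁.a .ui x = if x = ord i then Nat.count I.Pos b else τ.a .ui x) →
        WP V L (ite (.eq (var .g) 0) skip block) τ₁ fun τ =>
          (i + 1 < k → τ.r .t = Nat.count I.Pos (E (i + 1)) ∧
            τ.r .y = carryBound I.cap (E (i + 1)) ∧
            τ.r .cnt = ((Finset.range (i + 1)).filter fun i' => E i' = E (i + 1)).card +
              if E (i + 1) = 0 then I.n + 1 else 0) ∧
          (i + 1 = k → 0 < k → ∀ N, E (k - 1) + (4 * I.n + 8) ≤ N →
            τ.r .t = Nat.count I.Pos N) ∧ (i + 1 = 0 → τ.r .t = 0) ∧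
          I.Entries (τ.a .ur) (τ.a .uj) (τ.a .adj) (τ.r .t) ∧
          ∀ i' < i + 1, τ.a .ui (ord i') = Nat.count I.Pos (E i') := by
      intro g τ₁ hg hg₁ hv₁ hS₁ ht₁ hy₁ hcnt₁ hur hujj hadj hui₁
      refine wp_ite.2 ⟨fun hz => ?_, fun hz => ?_⟩
      · simp only [Cn.holds_eq, Ex.eval_var, Ex.eval_lit, hg₁] at hz
        rw [wp_skip, hur, hujj, hadj, ht₁, hy₁, hcnt₁]
        split_ifs at hg with hi1
        · have e2 := h.mono i (i + 1) (by omega) hi1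
          have e3 : E (i + 1) = b := by simp only [hEdef, hb] at hg ⊢; omega
          rw [e3]
          exact ⟨fun _ => ⟨ht, hy, hcnt1⟩, fun hc => by omega, fun hc => by omega, h4, hui _ hui₁⟩
        · omega
      · simp only [Cn.holds_eq, Ex.eval_var, Ex.eval_lit, hg₁] at hz
        have hgap : ∀ i' < k, i' ≤ i ∧ E i' ≤ b ∨ i < i' ∧ i + 1 < k ∧ E (i + 1) ≤ E i' := by
          intro i' hi'
          rcases Nat.lt_or_ge i i' with h6 | h6
          · exact Or.inr ⟨h6, by omega, h.mono (i + 1) i' h6 hi'⟩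
          · exact Or.inl ⟨h6, h.mono i' i h6 hi⟩
        have hnext : i + 1 < k → b < E (i + 1) ∧ b + g ≤ E (i + 1) ∧
            (g < 4 * I.n + 8 → b + g = E (i + 1)) := by
          intro hi1
          rw [if_pos hi1] at hg
          omega
        have hgle : g ≤ 4 * I.n + 8 := by rw [hg]; split_ifs <;> omega
        have hlastg : ¬ i + 1 < k → g = 4 * I.n + 8 := fun hi1 => by rw [hg, if_neg hi1]
        have hev : ∀ v < I.n, I.NZ v → I.e v ≤ b ∨ i + 1 < k ∧ E (i + 1) ≤ I.e v := by
          intro v hv hnz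
          obtain ⟨i', hi', rfl⟩ := hexp v hv hnz
          rcases hgap i' hi' with h6 | h6
          · exact Or.inl h6.2
          · exact Or.inr ⟨h6.2.1, h6.2.2⟩
        have hcap0 : ∀ j, 0 < j → j < g → I.cap (b + j) = 0 := by
          intro j hj0 hjg
          rw [cap_eq_ite h0, if_neg (by omega), h.mult_eq hall]
          simp only [Nat.add_zero, Finset.card_eq_zero, Finset.filter_eq_empty_iff,
            Finset.mem_range]
          intro i' hi' hc
          rcases hgap i' hi' with h6 | h6
          · simp only [hEdef] at h6; omega
          · have := hnext h6.2.1
            simp only [hEdef] at h6 this; omega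
        have hcapb : I.cap b = τ.r .cnt + 1 := by
          rw [cap_eq_ite h0, hcnt1, h.mult_eq hall]
          congr 2
          ext i'
          simp only [Finset.mem_filter, Finset.mem_range]
          constructor
          · rintro ⟨h6, h7⟩
            refine ⟨?_, h7⟩
            rcases hgap i' h6 with h8 | h8
            · omega
            · have := hnext h8.2.1
              simp only [hEdef] at h8 this; omega
          · rintro ⟨h6, h7⟩
            exact ⟨by omega, h7⟩
        refine (wp_block hV hL hS₁ h0 (by rw [hv₁]; exact hv) (by rw [hv₁]; exact hnz)
          (by omega) (by omega) (by rw [ht₁, hv₁]; exact ht) ?_ ?_ ?_ ?_).frame ?_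
        · rw [hy₁, hcnt₁, hv₁, ← hcapb, hy]; exact Nat.add_comm _ _
        · rw [hv₁, hg₁]; exact hcap0
        · rw [hv₁, hg₁]
          intro hp
          obtain ⟨v', hv', hnz', h6, h7⟩ := exists_of_pos h0 hp
          change I.e v' ≤ b + (g - 1) at h6
          change b + (g - 1) ≤ _ at h7
          change 0 < I.cap (b + g)
          by_cases hgbg : g < 4 * I.n + 8
          · have hi1 : i + 1 < k := by by_contra hc; have := hlastg hc; omega
            rw [(hnext hi1).2.2 hgbg]
            exact (mult_pos (h.ord_lt _ hi1) (h.ord_nz _ hi1)).trans_le (I.mult_le_cap _)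
          · exfalso
            rcases hev v' hv' hnz' with h8 | ⟨h8, h9⟩
            · omega
            · have := hnext h8; omega
        · rw [hur, hujj, hadj, ht₁]; exact h4
        · intro τ₂ ⟨q1, q2, q3, q4⟩ hf₂
          rw [hv₁, hg₁] at q1 q2
          change _ = Nat.count I.Pos (b + g) at q1
          change _ = carryBound I.cap (b + g) at q2
          have hui₂ : τ₂.a .ui = τ₁.a .ui := hf₂.2 _ rfl
          refine ⟨fun hi1 => ?_, fun hik _ N hN => ?_, fun hc => by omega, q4, hui _ (by
            rw [hui₂]; exact hui₁)⟩
          · have hcard : ((Finset.range (i + 1)).filter fun i' => E i' = E (i + 1)).card = 0 := by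
              simp only [Finset.card_eq_zero, Finset.filter_eq_empty_iff, Finset.mem_range]
              intro i' hi' hc
              have e1 := (hnext hi1).1
              have e2 := h.mono i' i (by omega) hi
              simp only [hEdef, hb] at e1 hc
              omega
            rw [hcard, if_neg (by have := (hnext hi1).1; omega), q1, q2, q3]
            by_cases hgbg : g < 4 * I.n + 8
            · rw [(hnext hi1).2.2 hgbg]; exact ⟨rfl, rfl, rfl⟩
            -- The block ended possibly before the next exponent; count and carry bound do not
            -- change in between.
            · have hg8 : g = 4 * I.n + 8 := by omega
              have e1 := (hnext hi1).2.1
              rw [hg8] at e1 ⊢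
              obtain ⟨c1, c2⟩ := count_pos_eq h0 e1 fun v hv hnz =>
                (hev v hv hnz).imp_right fun hh => hh.2
              obtain ⟨_, c3⟩ := count_pos_eq h0 (le_refl (b + (4 * I.n + 8))) fun v hv hnz =>
                (hev v hv hnz).imp_right fun hh => by omega
              exact ⟨c1.symm, by rw [c2, c3], rfl⟩
          · have hik' : k - 1 = i := by omega
            rw [hik'] at hN
            have hg8 := hlastg (by omega)
            rw [q1, hg8]
            exact (count_pos_eq h0 hN fun v hv hnz => (hev v hv hnz).imp_right fun hh => by
              omega).1.symm
    have hnτ : τ.r .n = I.n := hS'.n_eq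
    have hbgτ : τ.r .bg = 4 * I.n + 8 := hS'.bg_eq
    have hS₁ : ∀ g c d : ℕ, I.Setup ((((τ.set .v (ord i)).put .ui (ord i) c).set .cnt d).set .g g) :=
      fun g c d => Setup.frame (p := asg .v 0 ;; sto .ui 0 0 ;; asg .cnt 0 ;; asg .g 0) hS'
        ⟨fun x hx => by
          simp only [modR, Bool.or_eq_false_iff, decide_eq_false_iff_not] at hx; simp [hx],
          fun a ha => by
          simp only [modA, Bool.or_eq_false_iff, decide_eq_false_iff_not] at ha; funext; simp [ha]⟩
        (by decide)
    have hcap3 := I.mult_le b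
    rw [h.mult_eq hall] at hcap3
    have hifle : (if b = 0 then I.n + 1 else 0) ≤ I.n + 1 := by split_ifs <;> omega
    generalize (ite (.eq (var .g) 0) skip block : Cmd) = c at hmid ⊢
    simp only [wp_seq, wp_asg, wp_sto, wp_ite, wp_skip, Cn.holds_lt, Cn.holds_eq, Ex.eval_add, Ex.eval_sub,
      Ex.eval_mul, Ex.eval_get, Ex.eval_var, Ex.eval_lit, eval_labE, St.set_r, St.set_a, St.put_r,
      St.put_a, reduceCtorEq, if_true, if_false, true_and, and_true, false_and, and_false, hii, hordτ, ht, hkτ, hnτ, hbgτ, hdif]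
    refine ⟨by omega, by omega, by omega, by omega, fun hi1 => ⟨by have := hdifi hi1; omega, ?_⟩,
      fun hi1 => ?_⟩
    · refine (hmid _ _ rfl (by simp [hi1, hdifi hi1]) (by simp) ?_ (by simp [ht]) (by simp)
        (by simp) (by simp [St.put_a_of_ne]) (by simp [St.put_a_of_ne])
        (by simp [St.put_a_of_ne]) (by simp)).mono fun τ' h => ?_
      · exact (hS₁ (4 * I.n + 8) (Nat.count I.Pos b) (τ.r .cnt + 1)).frame (p := asg .g 0) ⟨fun x hx => by
          simp only [modR, decide_eq_false_iff_not] at hx; simp [hx], fun a ha => rfl⟩ (by decide)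
      · simpa using h
    · refine (hmid _ _ rfl (by simp [hi1]) (by simp) (hS₁ _ _ _) (by simp [ht]) (by simp)
        (by simp) (by simp [St.put_a_of_ne]) (by simp [St.put_a_of_ne])
        (by simp [St.put_a_of_ne]) (by simp)).mono fun τ' h => ?_
      simpa using h
  · intro τ ⟨_, h2, h3, h4, h5⟩ hf
    simp only [St.set_r, reduceCtorEq, if_false, ← hk] at h2 h3
    simp only [St.set_r, reduceCtorEq, if_false, ← hk] at h5
    have htot : ∃ B, τ.r .t = Nat.count I.Pos B ∧ (∀ p, I.Pos p → p < B) ∧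
        τ.r .t ≤ 4 * I.n + 4 ∧ (0 < τ.r .t → 0 < I.mult 0) := by
      by_cases hk0 : k = 0
      · refine ⟨0, by simpa using h3 hk0, fun p hp => ?_, by have := h3 hk0; omega,
          fun hc => by have := h3 hk0; omega⟩
        -- Without nonzero vertices `cap` has no padding, so there are no positions.
        exfalso
        have h6 : ∀ b, I.mult b = 0 := fun b => by rw [h.mult_eq hall, hk0]; simp
        have h7 : I.cap = I.mult := if_neg (by rw [h6]; omega)
        have h8 : ∀ b, carryBound I.cap b = 0 := by
          intro b
          induction b with
          | zero => rfl
          | succ b ih => rw [carryBound, ih, h7, h6, h6]; rfl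
        unfold Pos CarrySupport at hp
        rw [h8, h7, h6] at hp
        omega
      · have h0 := h.mult_zero_pos hI (by omega : 0 < k)
        refine ⟨_, h2 trivial (by omega) _ le_rfl, fun p hp => ?_, ?_, fun _ => h0⟩
        · obtain ⟨v, hv, hnz, _, h6⟩ := exists_of_pos h0 hp
          obtain ⟨i, hi, rfl⟩ := hexp v hv hnz
          have := h.mono i (k - 1) (by omega) (by omega)
          simp only [hEdef]; omega
        · rw [h2 trivial (by omega) _ le_rfl]; exact count_pos_le h0 _
    obtain ⟨B, hB, hlt, hle, hm⟩ := htot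
    simp only [wp_seq, wp_asg, wp_sto, wp_ite, wp_skip, Cn.holds_lt, Cn.holds_eq, Ex.eval_add, Ex.eval_sub,
      Ex.eval_mul, Ex.eval_get, Ex.eval_var, Ex.eval_lit, eval_labE, St.set_r, St.set_a, St.put_r,
      St.put_a, reduceCtorEq, if_true, if_false, true_and, and_true, false_and, and_false]
    refine ⟨by omega, by omega, by omega, by omega, ?_⟩
    have hlt' : ∀ p, I.Pos p → Nat.count I.Pos p < τ.r .t := fun p hp => by
      rw [hB]; exact count_lt_count hp (hlt p hp)
    constructor
    · refine ⟨fun p hp hc => ?_⟩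
      have := hlt' p hp
      simpa [this.ne, St.put_a_of_ne] using h4.entry p hp this
    · simpa using hle
    · simp
    · simpa using hlt'
    · intro s hs
      exact exists_count_eq (N := B) (by simpa [← hB] using hs)
    · simpa using hm
    · simp
    · simp
    · intro v hv hnz
      obtain ⟨i, hi, rfl⟩ := hexp v hv hnz
      simpa [St.put_a_of_ne] using h5 i hi

end Cmd
end RAM

/-! ### Coefficients, carries and digits of the rows -/

namespace RAM
namespace Inst

variable {I : Inst}

open Classical in
/-- The coefficient of `2 ^ b` in the sum in row `r` increased by `j`. -/
noncomputable def coef (I : Inst) (r j b : ℕ) : ℤ :=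
  (∑ w ∈ (Finset.range I.n).filter I.NZ, if I.e w = b then sgn (I.lab r w) else 0) +
    if b = 0 then (j : ℤ) else 0

open Classical in
/-- The terms of the sum from `2 ^ b` on, divided by `2 ^ b`. -/
noncomputable def rest (I : Inst) (r j b : ℕ) : ℤ :=
  (∑ w ∈ (Finset.range I.n).filter I.NZ,
    if b ≤ I.e w then sgn (I.lab r w) * 2 ^ (I.e w - b) else 0) + if b = 0 then (j : ℤ) else 0

theorem rest_zero (I : Inst) (r j : ℕ) : I.rest r j 0 = I.rowSum r + j := by
  simp [rest, rowSum]

/-- Splits off the summands with exponent exactly `b`; this is the recursion on which the carrying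
lemmas rest. -/
theorem rest_eq (I : Inst) (r j b : ℕ) : I.rest r j b = I.coef r j b + 2 * I.rest r j (b + 1) := by
  have h : ∀ w, (if b ≤ I.e w then sgn (I.lab r w) * 2 ^ (I.e w - b) else 0) =
      (if I.e w = b then sgn (I.lab r w) else 0) +
      2 * if b + 1 ≤ I.e w then sgn (I.lab r w) * 2 ^ (I.e w - (b + 1)) else 0 := by
    intro w
    rcases lt_trichotomy (I.e w) b with h | h | h
    · rw [if_neg (by omega), if_neg (by omega), if_neg (by omega)]; ring
    · rw [if_pos (by omega), if_pos h, if_neg (by omega), h]; simp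
    · rw [if_pos (by omega), if_neg (by omega), if_pos (by omega),
        show I.e w - b = I.e w - (b + 1) + 1 by omega]
      ring
  simp only [rest, coef, h, Finset.sum_add_distrib, ← Finset.mul_sum, Nat.add_eq_zero_iff,
    one_ne_zero, and_false, if_false]
  ring

theorem abs_coef_le_padded {r j J : ℕ} (hj : j ≤ J) (b : ℕ) :
    |I.coef r j b| ≤ padded I.mult J b := by
  classical
  rw [padded, coef]
  have h1 : |∑ w ∈ (Finset.range I.n).filter I.NZ, if I.e w = b then sgn (I.lab r w) else 0| ≤
      I.mult b := by
    rw [mult, ← Finset.filter_filter, ← Finset.sum_filter]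
    refine (Finset.abs_sum_le_sum_abs _ _).trans ?_
    refine (Finset.sum_le_card_nsmul _ _ 1 fun w _ => abs_sgn_le _).trans ?_
    simp
  rw [abs_le] at *
  split_ifs <;> push_cast <;> omega

theorem abs_coef_le (h : 0 < I.mult 0) {r j : ℕ} (hj : j ≤ I.n + 1) (b : ℕ) :
    |I.coef r j b| ≤ I.cap b := by
  rw [cap_eq h]
  exact abs_coef_le_padded hj b

/-- The bounds do not depend on the row, so one set of positions serves all rows and all increments
up to the padding. -/
theorem pos_of_naf_ne_zero (h : 0 < I.mult 0) {r j p : ℕ} (hj : j ≤ I.n + 1)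
    (hp : naf (I.rowSum r + j) p ≠ 0) : I.Pos p := by
  rw [← rest_zero] at hp
  exact carrySupport_of_naf_ne_zero (I.rest_eq r j) (abs_coef_le h hj) hp

theorem naf_eq (I : Inst) (r j p : ℕ) : naf (I.rowSum r + j) p =
    carryDigit (I.coef r j p + carry (I.coef r j) p) (I.coef r j (p + 1)) := by
  rw [← rest_zero]
  exact naf_eq_carryDigit (I.rest_eq r j) p

theorem coef_eq_zero (h : 0 < I.mult 0) {r j p : ℕ} (hj : j ≤ I.n + 1) (hp : ¬ I.Pos p) :
    I.coef r j p = 0 := by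
  have := abs_coef_le h (r := r) hj p
  rw [(not_pos_iff.1 hp).1] at this
  simpa using this

/-- No carry enters a run of consecutive positions, so the runs are independent of each other. -/
theorem carry_eq_zero (h : 0 < I.mult 0) {r j p : ℕ} (hj : j ≤ I.n + 1)
    (hp : ∀ q, p = q + 1 → ¬ I.Pos q) : carry (I.coef r j) p = 0 := by
  cases p with
  | zero => rfl
  | succ q =>
    have := abs_carry_le (abs_coef_le h (r := r) hj) (q + 1)
    rw [carryBound_succ_of_not_pos (hp q rfl)] at this
    simpa using this

theorem carry_bound (h : 0 < I.mult 0) {r j : ℕ} (hj : j ≤ I.n + 1) (p : ℕ) :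
    |I.coef r j p| ≤ 2 * I.n + 1 ∧ |carry (I.coef r j) p| ≤ I.n + 1 := by
  have h1 := abs_coef_le h (r := r) hj p
  have h2 := abs_carry_le (abs_coef_le h (r := r) hj) p
  have h3 := cap_le h p
  have h4 := carryBound_cap_le h p
  omega

end Inst

theorem signCode_zero : signCode 0 = 0 := rfl

theorem signCode_le (s : SignType) : signCode s ≤ 2 := by cases s <;> decide

theorem signCode_eq_zero {s : SignType} : signCode s = 0 ↔ s = 0 := by cases s <;> decide

theorem sgn_signCode (s : SignType) : sgn (signCode s) = (s : ℤ) := by cases s <;> rfl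

end RAM

namespace RAM

open Ex (var get)

namespace Inst

variable {I : Inst}

theorem Listed.row {τ : St} (h : I.Listed τ) {t : ℕ} (ht : t ≤ τ.r .u) :
    τ.a .ur t ≤ I.n ∧ τ.a .uj t ≤ I.n + 1 := by
  rcases Nat.lt_or_eq_of_le ht with h1 | rfl
  · obtain ⟨p, hp, rfl⟩ := h.exists_count t h1
    obtain ⟨v, hv, _, h2, _, h3, _⟩ := h.entry p hp h1
    omega
  · rw [h.ur_last, h.uj_last]; omega

theorem Listed.pos_zero {τ : St} (h : I.Listed τ) (hu : 0 < τ.r .u) : I.Pos 0 := by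
  have h1 := h.mult_pos hu
  have h2 := I.mult_le_cap 0
  unfold Pos CarrySupport; omega

theorem Listed.congr {τ τ' : St} (h : I.Listed τ) (hu : τ'.r .u = τ.r .u)
    (hu1 : τ'.r .u1 = τ.r .u1) (hur : τ'.a .ur = τ.a .ur) (huj : τ'.a .uj = τ.a .uj)
    (hadj : τ'.a .adj = τ.a .adj) (hui : τ'.a .ui = τ.a .ui) : I.Listed τ' := by
  obtain ⟨h0, h1, h2, h3, h4, h5, h6, h7, h8⟩ := h
  constructor
  · rwa [hu, hur, huj, hadj]
  all_goals simp only [hu, hu1, hur, huj, hadj, hui]; assumption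

/-- The command does not touch the list of the positions. -/
def keepsListed (p : Cmd) : Bool :=
  !(p.modR .u || p.modR .u1 || p.modA .ur || p.modA .uj || p.modA .adj || p.modA .ui)

theorem Listed.frame {p : Cmd} {σ τ : St} (h : I.Listed σ) (hf : Cmd.Frame p σ τ)
    (hp : keepsListed p = true) : I.Listed τ := by
  simp only [keepsListed, Bool.not_eq_true', Bool.or_eq_false_iff] at hp
  obtain ⟨⟨⟨⟨⟨h1, h2⟩, h3⟩, h4⟩, h5⟩, h6⟩ := hp
  exact h.congr (hf.1 _ h1) (hf.1 _ h2) (hf.2 _ h3) (hf.2 _ h4) (hf.2 _ h5) (hf.2 _ h6)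

end Inst

namespace Cmd

open Inst

variable {V L : ℕ} {I : Inst}

-- Coefficients are collected by position number, with offset `4 * n + 8`. Different exponents have
-- different numbers, and the number `0` belongs to the exponent `0`, where the increment is added.
open Classical in
theorem wp_coefficients {σ : St} (hV : 1000 * (I.n * I.n) + 1000 * I.n + 1000 ≤ V)
    (hL : 16 * I.n + 32 ≤ L) (hS : I.Setup σ) (hl : I.Listed σ)
    (hnz : ∀ v < I.n, (σ.a .nz v ≠ 0 ↔ I.NZ v)) (ht : σ.r .t ≤ σ.r .u) :
    WP V L coefficients σ fun τ => ∀ p, I.Pos p → (τ.a .co (Nat.count I.Pos p) : ℤ) =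
      4 * I.n + 8 + I.coef (σ.a .ur (σ.r .t)) (σ.a .uj (σ.r .t)) p := by
  have hu := hl.u_le
  have hu1 := hl.u1_eq
  have hbg := hS.bg_eq
  obtain ⟨hr, hj⟩ := hl.row ht
  set r := σ.a .ur (σ.r .t) with hrdef
  set j := σ.a .uj (σ.r .t) with hjdef
  simp only [coefficients, wp_seq]
  refine wp_loop (fun s τ => ∀ s' < s, τ.a .co s' = 4 * I.n + 8) (by decide) (by omega) (by simp)
    ?_ ?_
  · intro s τ hs hinv hsi hf
    have hbgτ : τ.r .bg = 4 * I.n + 8 := by rw [hf.1 _ rfl, hbg]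
    simp only [wp_seq, wp_asg, wp_sto, wp_ite, wp_skip, Cn.holds_lt, Cn.holds_eq, Ex.eval_add, Ex.eval_sub,
      Ex.eval_mul, Ex.eval_get, Ex.eval_var, Ex.eval_lit, eval_labE, St.set_r, St.set_a, St.put_r,
      St.put_a, reduceCtorEq, if_true, if_false, true_and, and_true, false_and, and_false, hsi, hbgτ]
    refine ⟨by omega, fun s' hs' => ?_⟩
    split_ifs with h1
    · rfl
    · exact hinv s' (by omega)
  intro τ hco hf
  have hnτ : τ.r .n = I.n := by rw [hf.1 _ rfl, hS.n_eq]
  refine wp_loop (fun w τ' => ∀ s ≤ σ.r .u, (τ'.a .co s : ℤ) = 4 * I.n + 8 +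
      ∑ w' ∈ Finset.range w, if I.NZ w' ∧ σ.a .ui w' = s then sgn (I.lab r w') else 0)
      (by decide) (by omega) ?_ ?_ ?_
  · intro s hs
    simp [hco s (by omega)]
  · intro w τ' hw hinv hwi hf'
    rw [hnτ] at hw
    have hnz' : τ'.a .nz = σ.a .nz := by rw [hf'.2 _ rfl, hf.2 _ rfl]
    have hui : τ'.a .ui = σ.a .ui := by rw [hf'.2 _ rfl, hf.2 _ rfl]
    have hur : τ'.a .ur = σ.a .ur := by rw [hf'.2 _ rfl, hf.2 _ rfl]
    have ht' : τ'.r .t = σ.r .t := by rw [hf'.1 _ rfl, hf.1 _ rfl]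
    have hS' : I.Setup τ' := (hS.frame hf (by decide)).frame hf' (by decide)
    have hsum : ∀ s w, (∀ w' < w, w' < I.n) →
        |∑ w' ∈ Finset.range w, if I.NZ w' ∧ σ.a .ui w' = s then sgn (I.lab r w') else 0| ≤ w := by
      intro s w _
      refine (Finset.abs_sum_le_sum_abs _ _).trans ?_
      refine (Finset.sum_le_card_nsmul _ _ 1 fun w _ => ?_).trans (by simp)
      split_ifs
      · exact abs_sgn_le _
      · simp
    have hsgn := signE_eval hS'.toInput (r := get .ur (var .t)) (w := var .w)
      (by simp [hur, ht', ← hrdef, hr]) (by simp [hwi, hw])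
    have e1 : (get .ur (var .t) : Ex).eval τ' = r := by simp [hur, ht', hrdef]
    have e2 : (var .w : Ex).eval τ' = w := by simp [hwi]
    rw [e1, e2] at hsgn
    have habs := abs_sgn_le (I.lab r w)
    rw [abs_le] at habs
    simp only [wp_seq, wp_asg, wp_sto, wp_ite, wp_skip, Cn.holds_lt, Cn.holds_eq, Ex.eval_add, Ex.eval_sub,
      Ex.eval_mul, Ex.eval_get, Ex.eval_var, Ex.eval_lit, eval_labE, St.set_r, St.set_a, St.put_r,
      St.put_a, reduceCtorEq, if_true, if_false, true_and, and_true, false_and, and_false, hwi, hnz', hui]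
    generalize (signE (get .ur (var .t)) (var .w)).eval τ' = a at hsgn ⊢
    refine ⟨fun h0 s hs => ?_, fun h0 => ?_⟩
    · rw [Finset.sum_range_succ, if_neg (fun hc => (hnz w hw).2 hc.1 h0), add_zero]
      exact hinv s hs
    · have hnw : I.NZ w := (hnz w hw).1 h0
      have hus : σ.a .ui w ≤ σ.r .u := by
        rw [hl.ui_eq w hw hnw]; exact (hl.count_lt _ (pos_e hw hnw)).le
      have h1 := hinv _ hus
      have h2 := hsum (σ.a .ui w) w (fun w' h => by omega)
      rw [abs_le] at h2
      refine ⟨by omega, by omega, fun s hs => ?_⟩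
      rw [Finset.sum_range_succ]
      by_cases hsw : s = σ.a .ui w
      · rw [if_pos hsw, if_pos ⟨hnw, hsw.symm⟩, hsw]; omega
      · rw [if_neg hsw, if_neg (fun hc => hsw hc.2.symm), add_zero]
        exact hinv s hs
  · intro τ' hinv hf'
    rw [hnτ] at hinv
    have huj : τ'.a .uj = σ.a .uj := by rw [hf'.2 _ rfl, hf.2 _ rfl]
    have ht' : τ'.r .t = σ.r .t := by rw [hf'.1 _ rfl, hf.1 _ rfl]
    have hsum : ∀ s,
        |∑ w' ∈ Finset.range I.n, if I.NZ w' ∧ σ.a .ui w' = s then sgn (I.lab r w') else 0| ≤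
          I.n := by
      intro s
      refine (Finset.abs_sum_le_sum_abs _ _).trans ?_
      refine (Finset.sum_le_card_nsmul _ _ 1 fun w _ => ?_).trans (by simp)
      split_ifs
      · exact abs_sgn_le _
      · simp
    have h0 := hinv 0 (Nat.zero_le _)
    have h0' := hsum 0
    rw [abs_le] at h0'
    simp only [wp_seq, wp_asg, wp_sto, wp_ite, wp_skip, Cn.holds_lt, Cn.holds_eq, Ex.eval_add, Ex.eval_sub,
      Ex.eval_mul, Ex.eval_get, Ex.eval_var, Ex.eval_lit, eval_labE, St.set_r, St.set_a, St.put_r,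
      St.put_a, reduceCtorEq, if_true, if_false, true_and, and_true, false_and, and_false, huj, ht', ← hjdef]
    refine ⟨by omega, fun p hp => ?_⟩
    have hpu := hl.count_lt p hp
    have hcoef : I.coef r j p = (∑ w' ∈ Finset.range I.n,
        if I.NZ w' ∧ σ.a .ui w' = Nat.count I.Pos p then sgn (I.lab r w') else 0) +
        if p = 0 then (j : ℤ) else 0 := by
      rw [coef, Finset.sum_filter]
      congr 1
      refine Finset.sum_congr rfl fun w hw => ?_
      rw [Finset.mem_range] at hw
      by_cases hnw : I.NZ w
      · have : σ.a .ui w = Nat.count I.Pos p ↔ I.e w = p := by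
          rw [hl.ui_eq w hw hnw]
          exact ⟨fun h => count_inj (pos_e hw hnw) hp h, fun h => by rw [h]⟩
        simp only [hnw, true_and, if_true, this]
      · simp [hnw]
    have hp0 : Nat.count I.Pos p = 0 ↔ p = 0 := by
      constructor
      · intro h
        exact count_inj hp (hl.pos_zero (by omega)) (by simpa using h)
      · rintro rfl; simp
    rw [hcoef]
    simp only [hp0]
    have hpp := hinv _ hpu.le
    by_cases hpz : p = 0
    · subst hpz
      simp only [if_true, Nat.count_zero] at hpp ⊢
      push_cast
      rw [h0]; ring
    · simp only [if_neg hpz]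
      rw [hpp]; ring

/-- The loop runs over numbers of positions rather than places. It may hand the carry on to the next
number in any case: if that position is not adjacent, the carry is `0`. -/
theorem wp_digits {σ : St} (hV : 1000 * (I.n * I.n) + 1000 * I.n + 1000 ≤ V)
    (hL : 16 * I.n + 32 ≤ L) (hS : I.Setup σ) (hl : I.Listed σ) {r j : ℕ} (hj : j ≤ I.n + 1)
    (hco : ∀ p, I.Pos p → (σ.a .co (Nat.count I.Pos p) : ℤ) = 4 * I.n + 8 + I.coef r j p) :
    WP V L digits σ fun τ => (∀ p, I.Pos p →
        τ.a .dg (σ.r .t * σ.r .u + Nat.count I.Pos p) = signCode (naf (I.rowSum r + j) p)) ∧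
      ∀ x, (∀ s < σ.r .u, x ≠ σ.r .t * σ.r .u + s) → τ.a .dg x = σ.a .dg x := by
  have hu := hl.u_le
  have hbg := hS.bg_eq
  simp only [digits, wp_seq, wp_asg, Ex.eval_var]
  refine ⟨by omega, ?_⟩
  refine wp_loop (fun s τ =>
    (∀ p, I.Pos p → Nat.count I.Pos p = s → (τ.r .kx : ℤ) = 4 * I.n + 8 + carry (I.coef r j) p) ∧
    (∀ p, I.Pos p → Nat.count I.Pos p < s →
      τ.a .dg (σ.r .t * σ.r .u + Nat.count I.Pos p) = signCode (naf (I.rowSum r + j) p)) ∧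
    ∀ x, (∀ s < σ.r .u, x ≠ σ.r .t * σ.r .u + s) → τ.a .dg x = σ.a .dg x) (by decide)
    (by simp; omega) ?_ ?_ ?_
  · refine ⟨fun p hp h0 => ?_, by simp, by simp⟩
    have hc := carry_eq_zero (hl.mult_pos (by have := hl.count_lt p hp; omega)) (r := r) hj
      (p := p) (fun q hq hpq => by have := count_lt_count hpq (show q < p by omega); omega)
    simp [hc, hbg]
  · intro s τ hs ⟨h1, h2, h3⟩ hsi hf
    simp only [St.set_r, reduceCtorEq, if_false] at hs
    have h0 := hl.mult_pos (by omega)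
    obtain ⟨p, hp, hps⟩ := hl.exists_count s hs
    have hkx := h1 p hp hps
    have hcop := hco p hp
    obtain ⟨b1, b2⟩ := carry_bound h0 (r := r) hj p
    obtain ⟨b3, -⟩ := carry_bound h0 (r := r) hj (p + 1)
    rw [abs_le] at b1 b2 b3
    have hnaf := I.naf_eq r j p
    have hcarry : carry (I.coef r j) (p + 1) =
      carryStep (I.coef r j p + carry (I.coef r j) p) (I.coef r j (p + 1)) := rfl
    have hcoτ : τ.a .co = σ.a .co := hf.2 _ rfl
    have hadjτ : τ.a .adj = σ.a .adj := hf.2 _ rfl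
    have hhf : τ.a .hf = σ.a .hf := hf.2 _ rfl
    have hpar : τ.a .par = σ.a .par := hf.2 _ rfl
    have hbgτ : τ.r .bg = 4 * I.n + 8 := by rw [hf.1 _ rfl]; simp [hbg]
    have htτ : τ.r .t = σ.r .t := by rw [hf.1 _ rfl]; simp
    have huτ : τ.r .u = σ.r .u := by rw [hf.1 _ rfl]; simp
    obtain ⟨v, _, _, _, _, _, hadj⟩ := hl.entry p hp (by omega)
    rw [hps] at hadj hcop
    have hq : ∀ q, q = (if σ.a .adj s = 1 then σ.a .co (s + 1) else 4 * I.n + 8) →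
        (q : ℤ) = 4 * I.n + 8 + I.coef r j (p + 1) := by
      intro q hq
      split_ifs at hq with ha
      · have hp1 := hadj.1 ha
        rw [hq, ← hco _ hp1, Nat.count_succ, if_pos hp, hps]
      · have hp1 : ¬ I.Pos (p + 1) := fun hc => ha (hadj.2 hc)
        rw [hq, coef_eq_zero h0 hj hp1]; push_cast; ring
    have hfin : ∀ (dg' : ℕ → ℕ) (kx d : ℕ), (kx : ℤ) = 4 * I.n + 8 + carry (I.coef r j) (p + 1) →
        d = signCode (naf (I.rowSum r + j) p) → (∀ x, dg' x =
          if x = σ.r .t * σ.r .u + s then d else τ.a .dg x) →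
        (∀ p, I.Pos p → Nat.count I.Pos p = s + 1 →
          (kx : ℤ) = 4 * I.n + 8 + carry (I.coef r j) p) ∧
        (∀ p, I.Pos p → Nat.count I.Pos p < s + 1 →
          dg' (σ.r .t * σ.r .u + Nat.count I.Pos p) = signCode (naf (I.rowSum r + j) p)) ∧
        ∀ x, (∀ s < σ.r .u, x ≠ σ.r .t * σ.r .u + s) → dg' x = σ.a .dg x := by
      intro dg' kx d e1 e2 e3
      refine ⟨fun p' hp' hps' => ?_, fun p' hp' hps' => ?_, fun x hx => ?_⟩
      · by_cases hpp : p' = p + 1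
        · rw [e1, hpp]
        · have hp1 : ¬ I.Pos (p + 1) := fun hc => hpp (count_inj hp' hc (by
            rw [hps', Nat.count_succ, if_pos hp, hps]))
          have hz1 : carry (I.coef r j) (p + 1) = 0 := by
            have := abs_carry_le (abs_coef_le h0 (r := r) hj) (p + 1)
            rw [(not_pos_iff.1 hp1).2] at this
            simpa using this
          rw [e1, hz1, carry_eq_zero h0 hj fun q hpq' hpq => ?_]
          have e4 : Nat.count I.Pos q = s := by
            rw [hpq', Nat.count_succ, if_pos hpq] at hps'; omega
          obtain rfl := count_inj hpq hp (e4.trans hps.symm)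
          exact hpp hpq'
      · rw [e3]
        rcases Nat.lt_or_eq_of_le (Nat.lt_succ_iff.1 hps') with h4 | h4
        · rw [if_neg (by omega)]; exact h2 p' hp' h4
        · obtain rfl := count_inj hp' hp (h4.trans hps.symm)
          rw [if_pos (by omega), e2]
      · rw [e3, if_neg (hx s hs)]; exact h3 x hx
    set x : ℤ := I.coef r j p + carry (I.coef r j) p with hx
    set c' := I.coef r j (p + 1) with hc'
    -- The joint offset is even and its half is `4 * n + 8` again, so halving and parity are
    -- compatible with the encoding.
    have hacc : ((σ.a .co s + τ.r .kx : ℕ) : ℤ) = 8 * I.n + 16 + x := by push_cast; omega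
    have hhfa := hS.hf_eq (σ.a .co s + τ.r .kx) (by omega)
    have hpara := hS.par_eq (σ.a .co s + τ.r .kx) (by omega)
    have hsc0 : signCode 0 = 0 := rfl
    have hsc1 : signCode 1 = 1 := rfl
    have hsc2 : signCode (-1) = 2 := rfl
    generalize hA : σ.a .co s + τ.r .kx = A at *
    have hcore : ∀ q : ℕ, (q : ℤ) = 4 * I.n + 8 + c' → A % 2 ≠ 0 →
        σ.a .par (A / 2 + q) = (A / 2 + q) % 2 ∧
        ((A / 2 + q) % 2 = 0 → carryDigit x c' = 1 ∧ carryStep x c' = x / 2) ∧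
        ((A / 2 + q) % 2 ≠ 0 → carryDigit x c' = -1 ∧ carryStep x c' = x / 2 + 1) := by
      intro q hq hA
      have hx1 : ¬ x % 2 = 0 := by omega
      refine ⟨hS.par_eq _ (by omega), fun h => ?_, fun h => ?_⟩
      · have hx2 : (x / 2 + c') % 2 = 0 := by omega
        simp only [carryDigit, carryStep, hx1, hx2, if_true, if_false, and_self]
      · have hx2 : ¬ (x / 2 + c') % 2 = 0 := by omega
        simp only [carryDigit, carryStep, hx1, hx2, if_false, and_self]
    have hzero : A % 2 = 0 → carryDigit x c' = 0 ∧ carryStep x c' = x / 2 := by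
      intro h
      have hx1 : x % 2 = 0 := by omega
      simp only [carryDigit, carryStep, hx1, if_true, and_self]
    simp only [wp_seq, wp_asg, wp_sto, wp_ite, wp_skip, Cn.holds_lt, Cn.holds_eq, Ex.eval_add, Ex.eval_sub,
      Ex.eval_mul, Ex.eval_get, Ex.eval_var, Ex.eval_lit, eval_labE, St.set_r, St.set_a, St.put_r,
      St.put_a, reduceCtorEq, if_true, if_false, true_and, and_true, false_and, and_false, hsi, hcoτ, hadjτ, hhf, hpar, hbgτ, htτ, huτ, hA, hhfa, hpara]
    refine ⟨by omega, by omega, by omega, fun hz => ?_, fun hz => ⟨by omega, ?_⟩⟩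
    · obtain ⟨e1, e2⟩ := hzero hz
      exact ⟨by omega, hfin (fun y => if y = σ.r .t * σ.r .u + s then 0 else τ.a .dg y) _ _
        (by omega) (by rw [hnaf, e1, hsc0]) fun _ => rfl⟩
    · have hrest : ∀ q : ℕ, (q : ℤ) = 4 * I.n + 8 + c' →
          q ≤ V ∧ (σ.a .par (A / 2 + q) = 0 → (A / 2 : ℤ) = 4 * I.n + 8 + carryStep x c' ∧
            1 = signCode (carryDigit x c')) ∧
          (¬ σ.a .par (A / 2 + q) = 0 → (A / 2 : ℤ) + 1 = 4 * I.n + 8 + carryStep x c' ∧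
            2 = signCode (carryDigit x c')) := by
        intro q hq
        obtain ⟨e1, e2, e3⟩ := hcore q hq hz
        rw [e1]
        refine ⟨by omega, fun h => ?_, fun h => ?_⟩
        · obtain ⟨e4, e5⟩ := e2 h
          rw [e4, hsc1]; omega
        · obtain ⟨e4, e5⟩ := e3 h
          rw [e4, hsc2]; omega
      refine ⟨fun ha => ?_, fun ha => ?_⟩
      · obtain ⟨e1, e2, e3⟩ := hrest (σ.a .co (s + 1)) (hq _ (by rw [if_pos ha]))
        refine ⟨e1, fun hz' => ⟨by omega, by omega, ?_⟩, fun hz' => ⟨by omega, by omega, by omega, ?_⟩⟩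
        · exact hfin (fun y => if y = σ.r .t * σ.r .u + s then 1 else τ.a .dg y) _ _
            (by rw [hcarry, ← (e2 hz').1]; rfl) (by rw [hnaf]; exact (e2 hz').2) fun _ => rfl
        · exact hfin (fun y => if y = σ.r .t * σ.r .u + s then 2 else τ.a .dg y) _ _
            (by rw [hcarry, ← (e3 hz').1]; push_cast; rfl) (by rw [hnaf]; exact (e3 hz').2)
            fun _ => rfl
      · obtain ⟨_, e2, e3⟩ := hrest (4 * I.n + 8) (hq _ (by rw [if_neg ha]))
        refine ⟨fun hz' => ⟨by omega, by omega, ?_⟩, fun hz' => ⟨by omega, by omega, by omega, ?_⟩⟩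
        · exact hfin (fun y => if y = σ.r .t * σ.r .u + s then 1 else τ.a .dg y) _ _
            (by rw [hcarry, ← (e2 hz').1]; rfl) (by rw [hnaf]; exact (e2 hz').2) fun _ => rfl
        · exact hfin (fun y => if y = σ.r .t * σ.r .u + s then 2 else τ.a .dg y) _ _
            (by rw [hcarry, ← (e3 hz').1]; push_cast; rfl) (by rw [hnaf]; exact (e3 hz').2)
            fun _ => rfl
  · intro τ ⟨_, h2, h3⟩ hf
    simp only [St.set_r, reduceCtorEq, if_false] at h2 h3
    exact ⟨fun p hp => h2 p hp (hl.count_lt p hp), h3⟩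

/-- The digits of all rows are known. -/
def _root_.RAM.Inst.Digits (I : Inst) (τ : St) : Prop :=
  ∀ t ≤ τ.r .u, ∀ p, I.Pos p → τ.a .dg (t * τ.r .u + Nat.count I.Pos p) =
    signCode (naf (I.rowSum (τ.a .ur t) + τ.a .uj t) p)

theorem wp_rows {σ : St} (hV : 1000 * (I.n * I.n) + 1000 * I.n + 1000 ≤ V)
    (hL : 16 * I.n + 32 ≤ L) (hS : I.Setup σ) (hl : I.Listed σ)
    (hnz : ∀ v < I.n, (σ.a .nz v ≠ 0 ↔ I.NZ v)) : WP V L rows σ I.Digits := by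
  have hu := hl.u_le
  have hu1 := hl.u1_eq
  refine wp_loop (fun t τ => ∀ t' < t, ∀ p, I.Pos p →
    τ.a .dg (t' * σ.r .u + Nat.count I.Pos p) =
      signCode (naf (I.rowSum (σ.a .ur t') + σ.a .uj t') p)) (by decide) (by omega) (by simp) ?_ ?_
  · intro t τ ht hinv hti hf
    have hS' : I.Setup τ := hS.frame hf (by decide)
    have hl' : I.Listed τ := hl.frame hf (by decide)
    have hnzτ : τ.a .nz = σ.a .nz := hf.2 _ rfl
    have hurτ : τ.a .ur = σ.a .ur := hf.2 _ rfl
    have hujτ : τ.a .uj = σ.a .uj := hf.2 _ rfl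
    have huτ : τ.r .u = σ.r .u := hf.1 _ rfl
    refine wp_seq.2 ((wp_coefficients hV hL hS' hl' (by rw [hnzτ]; exact hnz)
      (by rw [hti, huτ]; omega)).frame ?_)
    intro τ₁ hco hf₁
    have hdg : τ₁.a .dg = τ.a .dg := hf₁.2 _ rfl
    have ht₁ : τ₁.r .t = t := by rw [hf₁.1 _ rfl, hti]
    have hu₁ : τ₁.r .u = σ.r .u := by rw [hf₁.1 _ rfl, huτ]
    rw [hti, hurτ, hujτ] at hco
    refine (wp_digits hV hL (hS'.frame hf₁ (by decide)) (hl'.frame hf₁ (by decide))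
      (hl.row (by omega)).2 hco).mono ?_
    intro τ₂ ⟨h1, h2⟩ t' ht' p hp
    rw [ht₁, hu₁] at h1 h2
    simp only [St.set_a]
    rcases Nat.lt_or_eq_of_le (Nat.lt_succ_iff.1 ht') with h3 | rfl
    · have hlt := hl.count_lt p hp
      rw [h2 _ fun s hs hc => by rw [index_inj hlt hs] at hc; omega, hdg]
      exact hinv t' h3 p hp
    · exact h1 p hp
  · intro τ hinv hf t ht p hp
    have hurτ : τ.a .ur = σ.a .ur := hf.2 _ rfl
    have hujτ : τ.a .uj = σ.a .uj := hf.2 _ rfl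
    have huτ : τ.r .u = σ.r .u := hf.1 _ rfl
    rw [hurτ, hujτ, huτ]
    exact hinv t (by omega) p hp

end Cmd
end RAM

/-! ### Needed positions and their numbering -/

noncomputable instance (x : ℤ) : DecidablePred (Needed x) := Classical.decPred _

namespace RAM

open Ex (var get)

namespace Inst

variable {I : Inst}

theorem Listed.mult_zero_pos {τ : St} (h : I.Listed τ) {p : ℕ} (hp : I.Pos p) : 0 < I.mult 0 :=
  h.mult_pos (by have := h.count_lt p hp; omega)

/-- A position may be too large to be stored, but as a row together with a small increment it is
available for computing its NAF. -/
theorem Listed.row_eq {τ : St} (h : I.Listed τ) (hI : I.Fits) {p : ℕ} (hp : I.Pos p) :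
    I.rowSum (τ.a .ur (Nat.count I.Pos p)) + τ.a .uj (Nat.count I.Pos p) = p := by
  obtain ⟨v, hv, _, h1, h2, _⟩ := h.entry p hp (h.count_lt p hp)
  rw [h1, ← hI v hv]
  exact_mod_cast h2

theorem Listed.pos_of_naf {τ : St} (h : I.Listed τ) (hI : I.Fits) {b p : ℕ} (hb : I.Pos b)
    (hp : naf (b : ℤ) p ≠ 0) : I.Pos p := by
  rw [← h.row_eq hI hb] at hp
  exact pos_of_naf_ne_zero (h.mult_zero_pos hb) (h.row (h.count_lt b hb).le).2 hp

/-- Digit positions of the value are positions, and positions are closed under passing to digit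
positions. -/
theorem Listed.pos_of_needed {τ : St} (h : I.Listed τ) (hI : I.Fits) {p : ℕ}
    (hp : Needed (I.rowSum 0) p) : I.Pos p := by
  induction hp with
  | @base p hp =>
    have hx : I.rowSum 0 ≠ 0 := by
      intro hx
      rw [hx, naf_zero_left] at hp
      exact hp rfl
    classical
    obtain ⟨v, hv, _⟩ := Finset.exists_ne_zero_of_sum_ne_zero hx
    rw [Finset.mem_filter, Finset.mem_range] at hv
    have h1 := h.mult_zero_pos (pos_e hv.1 hv.2)
    exact pos_of_naf_ne_zero h1 (r := 0) (j := 0) (Nat.zero_le _) (by simpa using hp)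
  | step _ hp ih => exact h.pos_of_naf hI ih hp

theorem Digits.pos {τ : St} (hd : I.Digits τ) (h : I.Listed τ) (hI : I.Fits) {b p : ℕ}
    (hb : I.Pos b) (hp : I.Pos p) :
    τ.a .dg (Nat.count I.Pos b * τ.r .u + Nat.count I.Pos p) = signCode (naf (b : ℤ) p) := by
  rw [hd _ (h.count_lt b hb).le p hp, h.row_eq hI hb]

theorem Digits.value {τ : St} (hd : I.Digits τ) (h : I.Listed τ) {p : ℕ} (hp : I.Pos p) :
    τ.a .dg (τ.r .u * τ.r .u + Nat.count I.Pos p) = signCode (naf (I.rowSum 0) p) := by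
  rw [hd _ le_rfl p hp, h.ur_last, h.uj_last]
  simp

/-- A command that does not modify the digits preserves them. -/
theorem Digits.frame {p : Cmd} {σ τ : St} (h : I.Digits σ) (hf : Cmd.Frame p σ τ)
    (hp : keepsListed p = true) (hp' : p.modA .dg = false) : I.Digits τ := by
  simp only [keepsListed, Bool.not_eq_true', Bool.or_eq_false_iff] at hp
  obtain ⟨⟨⟨⟨⟨h1, h2⟩, h3⟩, h4⟩, h5⟩, h6⟩ := hp
  unfold Digits
  rw [hf.1 _ h1, hf.2 _ h3, hf.2 _ h4, hf.2 _ hp']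
  exact h

theorem Listed.exists_count_eq_u {τ : St} (h : I.Listed τ) : ∃ N, Nat.count I.Pos N = τ.r .u := by
  by_cases hu : τ.r .u = 0
  · exact ⟨0, by simp [hu]⟩
  · obtain ⟨p, hp, hpu⟩ := h.exists_count (τ.r .u - 1) (by omega)
    exact ⟨p + 1, by rw [Nat.count_succ, if_pos hp]; omega⟩

/-- Needed exponents are counted along position numbers; between consecutive positions there is none
to miss. -/
theorem count_needed_congr {x : ℤ} (hx : ∀ p, Needed x p → I.Pos p) {N N' : ℕ}
    (h : Nat.count I.Pos N = Nat.count I.Pos N') :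
    Nat.count (Needed x) N = Nat.count (Needed x) N' := by
  wlog hN : N ≤ N' generalizing N N'
  · exact (this h.symm (by omega)).symm
  induction N', hN using Nat.le_induction with
  | base => rfl
  | succ N' hN ih =>
    have h1 := Nat.count_monotone I.Pos hN
    rw [Nat.count_succ] at h
    rw [Nat.count_succ, if_neg, Nat.add_zero]
    · exact ih (by split_ifs at h <;> omega)
    · intro hc
      rw [if_pos (hx _ hc)] at h; omega

theorem count_needed_le {x : ℤ} (hx : ∀ p, Needed x p → I.Pos p) (N : ℕ) :
    Nat.count (Needed x) N ≤ Nat.count I.Pos N :=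
  Nat.count_mono_left fun p _ => hx p

end Inst

/-- The number of vertices of the canonical circuit of value `x`. -/
noncomputable def vertexCount (x : ℤ) : ℕ := 1 + Nat.count (Needed x) x.natAbs

theorem count_needed_of_le {x : ℤ} {N : ℕ} (h : ∀ p, Needed x p → p < N) :
    Nat.count (Needed x) N = Nat.count (Needed x) x.natAbs := by
  have key : ∀ M N, M ≤ N → (∀ p, Needed x p → p < M) →
      Nat.count (Needed x) N = Nat.count (Needed x) M := by
    intro M N hMN hM
    induction N, hMN using Nat.le_induction with
    | base => rfl
    | succ N hN ih =>
      rw [Nat.count_succ, if_neg (fun hc => by have := hM N hc; omega), ih, Nat.add_zero]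
  rcases Nat.le_total N x.natAbs with h1 | h1
  · exact (key _ _ h1 h).symm
  · exact key _ _ h1 fun p hp => hp.lt_natAbs

/-- The exponent of the vertex with a given number in the canonical circuit of value `x`. -/
noncomputable def vertexExponent (x : ℤ) : ℕ → Option ℕ
  | 0 => none
  | i + 1 => some (Nat.nth (Needed x) i)

theorem vertexExponent_index {x : ℤ} {p : ℕ} (hp : Needed x p) :
    vertexExponent x (1 + Nat.count (Needed x) p) = some p := by
  rw [Nat.add_comm, vertexExponent, Nat.nth_count hp]

theorem index_lt {x : ℤ} {p : ℕ} (hp : Needed x p) :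
    1 + Nat.count (Needed x) p < vertexCount x := by
  have := Nat.count_strict_mono hp hp.lt_natAbs
  unfold vertexCount; omega

theorem vertexExponent_cases {x : ℤ} {i : ℕ} (hi : i < vertexCount x) :
    (i = 0 ∧ vertexExponent x i = none) ∨
      ∃ p, Needed x p ∧ i = 1 + Nat.count (Needed x) p ∧ vertexExponent x i = some p := by
  rcases i with _ | i
  · exact Or.inl ⟨rfl, rfl⟩
  · right
    unfold vertexCount at hi
    have key : ∀ N, i < Nat.count (Needed x) N → ∃ p, Needed x p ∧ Nat.count (Needed x) p = i := by
      intro N hN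
      induction N with
      | zero => simp at hN
      | succ N ih =>
        rw [Nat.count_succ] at hN
        by_cases hlt : i < Nat.count (Needed x) N
        · exact ih hlt
        · split_ifs at hN with h
          · exact ⟨N, h, by omega⟩
          · omega
    obtain ⟨p, hp, hpi⟩ := key x.natAbs (by omega)
    refine ⟨p, hp, by omega, ?_⟩
    rw [← hpi, Nat.add_comm]
    exact vertexExponent_index hp

theorem vertexExponent_inj {x : ℤ} {i j : ℕ} (hi : i < vertexCount x) (hj : j < vertexCount x)
    (h : vertexExponent x i = vertexExponent x j) : i = j := by
  rcases vertexExponent_cases hi with ⟨h1, h2⟩ | ⟨p, _, h1, h2⟩ <;>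
    rcases vertexExponent_cases hj with ⟨h3, h4⟩ | ⟨q, _, h3, h4⟩ <;> rw [h2, h4] at h
  · omega
  · cases h
  · cases h
  · cases h; omega

namespace Cmd

open Inst

variable {V L : ℕ} {I : Inst}

/-- When a position is treated, all larger ones have been treated, and only these and the value can
make it needed; so its entry is final by then. -/
theorem wp_need {σ : St} (hV : 1000 * (I.n * I.n) + 1000 * I.n + 1000 ≤ V)
    (hL : 16 * I.n + 32 ≤ L) (hI : I.Fits) (hl : I.Listed σ) (hd : I.Digits σ) :
    WP V L need σ fun τ => ∀ p, I.Pos p →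
      (τ.a .nd (Nat.count I.Pos p) ≠ 0 ↔ Needed (I.rowSum 0) p) := by
  have hu := hl.u_le
  set x := I.rowSum 0 with hx
  simp only [need, wp_seq]
  refine wp_loop (fun s τ => ∀ p, I.Pos p → Nat.count I.Pos p < s →
    (τ.a .nd (Nat.count I.Pos p) ≠ 0 ↔ naf x p ≠ 0)) (by decide) (by omega) (by simp) ?_ ?_
  · intro s τ hs hinv hsi hf
    have huτ : τ.r .u = σ.r .u := hf.1 _ rfl
    have hdg : τ.a .dg = σ.a .dg := hf.2 _ rfl
    obtain ⟨p, hp, rfl⟩ := hl.exists_count s hs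
    have hval := hd.value hl hp
    simp only [wp_seq, wp_asg, wp_sto, wp_ite, wp_skip, Cn.holds_lt, Cn.holds_eq, Ex.eval_add, Ex.eval_sub,
      Ex.eval_mul, Ex.eval_get, Ex.eval_var, Ex.eval_lit, eval_labE, St.set_r, St.set_a, St.put_r,
      St.put_a, reduceCtorEq, if_true, if_false, true_and, and_true, false_and, and_false, hsi, huτ, hdg, hval, signCode_eq_zero]
    have hstep : ∀ d : ℕ, (d ≠ 0 ↔ naf x p ≠ 0) → ∀ p', I.Pos p' →
        Nat.count I.Pos p' < Nat.count I.Pos p + 1 →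
        ((if Nat.count I.Pos p' = Nat.count I.Pos p then d
          else τ.a .nd (Nat.count I.Pos p')) ≠ 0 ↔ naf x p' ≠ 0) := by
      intro d hd' p' hp' hlt
      split_ifs with h1
      · rw [count_inj hp' hp h1]; exact hd'
      · exact hinv p' hp' (by omega)
    refine ⟨by omega, fun h0 => ⟨by omega, hstep 0 (by simp [hx, h0])⟩,
      fun h0 => ⟨by omega, by omega, hstep 1 (by simpa using h0)⟩⟩
  intro τ hnd hf
  have huτ : τ.r .u = σ.r .u := hf.1 _ rfl
  refine wp_loop (fun i τ' => ∀ p, I.Pos p → (τ'.a .nd (Nat.count I.Pos p) ≠ 0 ↔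
    naf x p ≠ 0 ∨ ∃ b, I.Pos b ∧ σ.r .u ≤ Nat.count I.Pos b + i ∧ Needed x b ∧
      naf (b : ℤ) p ≠ 0)) (by decide) (by omega) ?_ ?_ ?_
  · intro p hp
    simp only [St.set_a]
    rw [hnd p hp (hl.count_lt p hp)]
    refine ⟨Or.inl, fun h => h.resolve_right ?_⟩
    rintro ⟨b, hb, h1, _⟩
    have := hl.count_lt b hb
    omega
  · intro i τ' hi hinv hii hf'
    rw [huτ] at hi
    have hu' : τ'.r .u = σ.r .u := by rw [hf'.1 _ rfl, huτ]
    have hdg' : τ'.a .dg = σ.a .dg := by rw [hf'.2 _ rfl, hf.2 _ rfl]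
    obtain ⟨q, hq, hqt⟩ := hl.exists_count (σ.r .u - 1 - i) (by omega)
    have hndq : τ'.a .nd (Nat.count I.Pos q) ≠ 0 ↔ Needed x q := by
      rw [hinv q hq]
      constructor
      · rintro (h | ⟨b, _, _, h1, h2⟩)
        · exact .base h
        · exact h1.step h2
      · intro h
        cases h with
        | base h => exact Or.inl h
        | @step b _ hb h =>
          have hbp := hl.pos_of_needed hI hb
          have := count_lt_count hq (lt_of_naf_natCast_ne_zero h)
          exact Or.inr ⟨b, hbp, by omega, hb, h⟩
    have hsplit : ∀ b, I.Pos b → (σ.r .u ≤ Nat.count I.Pos b + (i + 1) ↔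
        σ.r .u ≤ Nat.count I.Pos b + i ∨ b = q) := by
      intro b hb
      constructor
      · intro h
        by_cases hc : σ.r .u ≤ Nat.count I.Pos b + i
        · exact Or.inl hc
        · exact Or.inr (count_inj hb hq (by omega))
      · rintro (h | rfl) <;> omega
    have hgoal : ∀ p, (naf x p ≠ 0 ∨ ∃ b, I.Pos b ∧ σ.r .u ≤ Nat.count I.Pos b + (i + 1) ∧
        Needed x b ∧ naf (b : ℤ) p ≠ 0) ↔ (naf x p ≠ 0 ∨ ∃ b, I.Pos b ∧
        σ.r .u ≤ Nat.count I.Pos b + i ∧ Needed x b ∧ naf (b : ℤ) p ≠ 0) ∨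
        (Needed x q ∧ naf (q : ℤ) p ≠ 0) := by
      intro p
      rw [or_assoc]
      refine or_congr_right ⟨?_, ?_⟩
      · rintro ⟨b, hb, h1, h2, h3⟩
        rcases (hsplit b hb).1 h1 with h1 | rfl
        · exact Or.inl ⟨b, hb, h1, h2, h3⟩
        · exact Or.inr ⟨h2, h3⟩
      · rintro (⟨b, hb, h1, h2, h3⟩ | ⟨h2, h3⟩)
        · exact ⟨b, hb, (hsplit b hb).2 (Or.inl h1), h2, h3⟩
        · exact ⟨q, hq, (hsplit q hq).2 (Or.inr rfl), h2, h3⟩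
    simp only [wp_seq, wp_asg, Ex.eval_sub, Ex.eval_var, Ex.eval_lit, hu', hii, ← hqt]
    refine ⟨by omega, wp_ite.2 ⟨fun h0 => ?_, fun h0 => ?_⟩⟩
    · simp only [Cn.holds_eq, Ex.eval_get, Ex.eval_var, Ex.eval_lit, St.set_r, St.set_a,
        if_true] at h0
      simp only [wp_skip, St.set_a]
      intro p hp
      rw [hgoal p, hinv p hp]
      have : ¬ Needed x q := fun hc => hndq.2 hc h0
      simp [this]
    · simp only [Cn.holds_eq, Ex.eval_get, Ex.eval_var, Ex.eval_lit, St.set_r, St.set_a,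
        if_true] at h0
      have hnq := hndq.1 h0
      refine wp_loop (fun s τ'' => ∀ p, I.Pos p → (τ''.a .nd (Nat.count I.Pos p) ≠ 0 ↔
        τ'.a .nd (Nat.count I.Pos p) ≠ 0 ∨ (Nat.count I.Pos p < s ∧ naf (q : ℤ) p ≠ 0)))
        (by decide) (by simp [hu']; omega) (by simp) ?_ ?_
      · intro s τ'' hs hinv' hsi hf''
        simp only [St.set_r, reduceCtorEq, if_false, hu'] at hs
        obtain ⟨p, hp, rfl⟩ := hl.exists_count s hs
        have hdg'' : τ''.a .dg = σ.a .dg := by rw [hf''.2 _ rfl]; exact hdg'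
        have hu'' : τ''.r .u = σ.r .u := by rw [hf''.1 _ rfl]; simp [hu']
        have ht'' : τ''.r .t = Nat.count I.Pos q := by rw [hf''.1 _ rfl]; simp
        have hval := hd.pos hl hI hq hp
        simp only [wp_seq, wp_asg, wp_sto, wp_ite, wp_skip, Cn.holds_lt, Cn.holds_eq, Ex.eval_add, Ex.eval_sub,
      Ex.eval_mul, Ex.eval_get, Ex.eval_var, Ex.eval_lit, eval_labE, St.set_r, St.set_a, St.put_r,
      St.put_a, reduceCtorEq, if_true, if_false, true_and, and_true, false_and, and_false, hsi, hdg'', hu'', ht'', hval, signCode_eq_zero]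
        have hlt : ∀ p', I.Pos p' → (Nat.count I.Pos p' < Nat.count I.Pos p + 1 ↔
            Nat.count I.Pos p' < Nat.count I.Pos p ∨ p' = p) := by
          intro p' hp'
          constructor
          · intro h
            by_cases hc : Nat.count I.Pos p' < Nat.count I.Pos p
            · exact Or.inl hc
            · exact Or.inr (count_inj hp' hp (by omega))
          · rintro (h | rfl) <;> omega
        refine ⟨fun hz p' hp' => ?_, fun hz => ⟨by omega, fun p' hp' => ?_⟩⟩
        · rw [hinv' p' hp', hlt p' hp']
          refine or_congr_right (and_congr_left fun h3 => ?_)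
          refine ⟨Or.inl, fun h => h.resolve_right ?_⟩
          rintro rfl
          exact h3 hz
        · split_ifs with h1
          · obtain rfl := count_inj hp' hp h1
            refine ⟨fun _ => Or.inr ⟨by omega, hz⟩, fun _ => by omega⟩
          · rw [hinv' p' hp', hlt p' hp']
            have : p' ≠ p := fun hc => h1 (by rw [hc])
            simp [this]
      · intro τ'' hinv' _ p hp
        simp only [St.set_r, reduceCtorEq, if_false, hu'] at hinv'
        simp only [St.set_a]
        rw [hinv' p hp, hgoal p, hinv p hp]
        have := hl.count_lt p hp
        simp [this, hnq]
  · intro τ' hinv hf' p hp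
    rw [huτ] at hinv
    rw [hinv p hp]
    constructor
    · rintro (h | ⟨b, _, _, h1, h2⟩)
      · exact .base h
      · exact h1.step h2
    · intro h
      cases h with
      | base h => exact Or.inl h
      | @step b _ hb h => exact Or.inr ⟨b, hl.pos_of_needed hI hb, by omega, hb, h⟩

/-- Numbers increase with the exponents and start at `1`, since `0` is reserved for the zero vertex.
-/
theorem wp_number {σ : St} (hV : 1000 * (I.n * I.n) + 1000 * I.n + 1000 ≤ V)
    (hL : 16 * I.n + 32 ≤ L) (hI : I.Fits) (hl : I.Listed σ)
    (hnd : ∀ p, I.Pos p → (σ.a .nd (Nat.count I.Pos p) ≠ 0 ↔ Needed (I.rowSum 0) p)) :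
    WP V L number σ fun τ => τ.r .m = vertexCount (I.rowSum 0) ∧ τ.r .m ≤ 4 * I.n + 5 ∧
      ∀ p, Needed (I.rowSum 0) p →
        τ.a .idx (Nat.count I.Pos p) = 1 + Nat.count (Needed (I.rowSum 0)) p := by
  have hu := hl.u_le
  set x := I.rowSum 0 with hx
  have hpos : ∀ p, Needed x p → I.Pos p := fun p hp => hl.pos_of_needed hI hp
  simp only [number, wp_seq, wp_asg, Ex.eval_lit]
  refine ⟨by omega, ?_⟩
  refine wp_loop (fun s τ => (∀ N, Nat.count I.Pos N = s →
      τ.r .m = 1 + Nat.count (Needed x) N) ∧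
      ∀ p, Needed x p → Nat.count I.Pos p < s →
        τ.a .idx (Nat.count I.Pos p) = 1 + Nat.count (Needed x) p)
    (by decide) (by simp; omega) ?_ ?_ ?_
  · refine ⟨fun N hN => ?_, by simp⟩
    rw [count_needed_congr hpos (show Nat.count I.Pos N = Nat.count I.Pos 0 by simpa using hN)]
    simp
  · intro s τ hs ⟨h1, h2⟩ hsi hf
    simp only [St.set_r, reduceCtorEq, if_false] at hs
    obtain ⟨p, hp, rfl⟩ := hl.exists_count s hs
    have hndτ : τ.a .nd = σ.a .nd := hf.2 _ rfl
    have hm := h1 p rfl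
    have hle := count_needed_le hpos p
    have hnext : ∀ N, Nat.count I.Pos N = Nat.count I.Pos p + 1 →
        Nat.count (Needed x) N = Nat.count (Needed x) p + if Needed x p then 1 else 0 := by
      intro N hN
      rw [count_needed_congr hpos (show _ = Nat.count I.Pos (p + 1) by
        rw [hN, Nat.count_succ, if_pos hp]), Nat.count_succ]
    have hp2 : ∀ p', Needed x p' → p' ≠ p → Nat.count I.Pos p' < Nat.count I.Pos p + 1 →
        Nat.count I.Pos p' < Nat.count I.Pos p := by
      intro p' hp' hne hlt
      have : Nat.count I.Pos p' ≠ Nat.count I.Pos p := fun hc => hne (count_inj (hpos _ hp') hp hc)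
      omega
    simp only [wp_seq, wp_asg, wp_sto, wp_ite, wp_skip, Cn.holds_lt, Cn.holds_eq, Ex.eval_add, Ex.eval_sub,
      Ex.eval_mul, Ex.eval_get, Ex.eval_var, Ex.eval_lit, eval_labE, St.set_r, St.set_a, St.put_r,
      St.put_a, reduceCtorEq, if_true, if_false, true_and, and_true, false_and, and_false, hsi, hndτ]
    refine ⟨fun h0 => ?_, fun h0 => ?_⟩
    · have hnn : ¬ Needed x p := fun hc => (hnd p hp).2 hc h0
      refine ⟨fun N hN => ?_, fun p' hp' hlt => ?_⟩
      · rw [hnext N hN, if_neg hnn, hm, Nat.add_zero]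
      · exact h2 p' hp' (hp2 p' hp' (fun hc => hnn (hc ▸ hp')) hlt)
    · have hnn : Needed x p := (hnd p hp).1 h0
      refine ⟨by omega, by omega, fun N hN => ?_, fun p' hp' hlt => ?_⟩
      · rw [hnext N hN, if_pos hnn, hm]; omega
      · split_ifs with h3
        · rw [count_inj (hpos _ hp') hp h3]; exact hm
        · exact h2 p' hp' (by omega)
  · intro τ ⟨h1, h2⟩ _
    simp only [St.set_r, reduceCtorEq, if_false] at h1 h2
    obtain ⟨N, hN⟩ := hl.exists_count_eq_u
    have hm := h1 N hN
    have hle := count_needed_le hpos N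
    refine ⟨?_, by omega, fun p hp => h2 p hp (hl.count_lt p (hpos p hp))⟩
    rw [hm, vertexCount, count_needed_of_le fun p hp => ?_]
    by_contra hc
    have h3 := Nat.count_monotone I.Pos (Nat.le_of_not_lt hc)
    have h4 := hl.count_lt p (hpos p hp)
    omega

end Cmd
end RAM

/-! ### Writing the canonical circuit -/

namespace RAM

open Ex (var get)

/-- The code of the mark of a vertex of the canonical circuit of value `x`. -/
noncomputable def markCode (x : ℤ) : Option ℕ → ℕ
  | none => if x = 0 then 1 else 0
  | some p => signCode (naf x p)

/-- The code of the label of an edge of a canonical circuit. -/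
def edgeCode : Option ℕ → Option ℕ → ℕ
  | none, _ => 0
  | some p, none => if p = 0 then 1 else 0
  | some p, some q => signCode (naf (p : ℤ) q)

/-- The array `out` holds a circuit. -/
structure Image (m : ℕ) (mk : ℕ → ℕ) (ed : ℕ → ℕ → ℕ) (out : ℕ → ℕ) : Prop where
  size : out 0 = m
  mark : ∀ i < m, out (1 + i) = mk i
  edge : ∀ i j, i < m → j < m → out (1 + m + i * m + j) = ed i j

namespace Image

variable {m : ℕ} {mk mk' : ℕ → ℕ} {ed ed' : ℕ → ℕ → ℕ} {out out' : ℕ → ℕ}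

theorem congr (h : Image m mk ed out) (hmk : ∀ i < m, mk' i = mk i)
    (hed : ∀ i j, i < m → j < m → ed' i j = ed i j) : Image m mk' ed' out :=
  ⟨h.size, fun i hi => by rw [h.mark i hi, hmk i hi],
    fun i j hi hj => by rw [h.edge i j hi hj, hed i j hi hj]⟩

theorem put_mark (h : Image m mk ed out) {i c : ℕ} (hi : i < m)
    (hout : ∀ y, out' y = if y = 1 + i then c else out y)
    (hmk : ∀ i' < m, mk' i' = if i' = i then c else mk i')
    (hed : ∀ i j, i < m → j < m → ed' i j = ed i j) : Image m mk' ed' out' := by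
  refine ⟨?_, fun i' hi' => ?_, fun i' j' hi' hj' => ?_⟩
  · rw [hout, if_neg (by omega), h.size]
  · rw [hout, hmk i' hi', h.mark i' hi']
    by_cases hii : i' = i
    · rw [if_pos (by omega), if_pos hii]
    · rw [if_neg (by omega), if_neg hii]
  · rw [hout, hed i' j' hi' hj', h.edge i' j' hi' hj', if_neg]
    generalize i' * m = z; omega

theorem put_edge (h : Image m mk ed out) {i j c : ℕ} (hj : j < m)
    (hout : ∀ y, out' y = if y = 1 + m + i * m + j then c else out y)
    (hmk : ∀ i < m, mk' i = mk i)
    (hed : ∀ i' j', i' < m → j' < m → ed' i' j' = if i' = i ∧ j' = j then c else ed i' j') :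
    Image m mk' ed' out' := by
  refine ⟨?_, fun i' hi' => ?_, fun i' j' hi' hj' => ?_⟩
  · rw [hout, if_neg (by generalize i * m = z; omega), h.size]
  · rw [hout, hmk i' hi', h.mark i' hi', if_neg]
    generalize i * m = z; omega
  · rw [hout, hed i' j' hi' hj', h.edge i' j' hi' hj']
    have : 1 + m + i' * m + j' = 1 + m + i * m + j ↔ i' = i ∧ j' = j := by
      rw [← index_inj hj' hj]; omega
    simp only [this]

end Image

namespace Inst

/-- The marks written after the first `s` positions have been treated. -/
noncomputable def partialMark (I : Inst) (s i : ℕ) : ℕ :=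
  match vertexExponent (I.rowSum 0) i with
  | none => 0
  | some p => if Nat.count I.Pos p < s then signCode (naf (I.rowSum 0) p) else 0

/-- The labels written after the first `s` rows and `s'` entries of the next row have been
treated. -/
noncomputable def partialEdge (I : Inst) (s s' i j : ℕ) : ℕ :=
  match vertexExponent (I.rowSum 0) i, vertexExponent (I.rowSum 0) j with
  | some p, some q => if Nat.count I.Pos p < s ∨ Nat.count I.Pos p = s ∧ Nat.count I.Pos q < s' then
      signCode (naf (p : ℤ) q) else 0
  | _, _ => 0

end Inst

namespace Cmd

open Inst

variable {V L : ℕ} {I : Inst}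

/-- The array starts with zeros, so labels that are `0` need not be written; `partialMark` and
`partialEdge` describe the half-written circuit. Distinct needed exponents have distinct indices, so
no entry disturbs another. -/
theorem wp_write {σ : St} (hV : 1000 * (I.n * I.n) + 1000 * I.n + 1000 ≤ V)
    (hL : 16 * I.n + 32 ≤ L) (hI : I.Fits) (hl : I.Listed σ) (hd : I.Digits σ)
    (hnd : ∀ p, I.Pos p → (σ.a .nd (Nat.count I.Pos p) ≠ 0 ↔ Needed (I.rowSum 0) p))
    (hm : σ.r .m = vertexCount (I.rowSum 0)) (hmle : σ.r .m ≤ 4 * I.n + 5)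
    (hidx : ∀ p, Needed (I.rowSum 0) p →
      σ.a .idx (Nat.count I.Pos p) = 1 + Nat.count (Needed (I.rowSum 0)) p)
    (h0 : σ.a .out = fun _ => 0) :
    WP V L write σ fun τ => τ.r .sz = 1 + σ.r .m + σ.r .m * σ.r .m ∧
      Image (σ.r .m) (fun i => markCode (I.rowSum 0) (vertexExponent (I.rowSum 0) i))
        (fun i j => edgeCode (vertexExponent (I.rowSum 0) i) (vertexExponent (I.rowSum 0) j))
        (τ.a .out) := by
  have hu := hl.u_le
  set x := I.rowSum 0 with hx
  set m := σ.r .m with hmdef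
  have hpos : ∀ p, Needed x p → I.Pos p := fun p hp => hl.pos_of_needed hI hp
  have hmm : m * m ≤ 16 * (I.n * I.n) + 40 * I.n + 25 := by
    calc m * m ≤ (4 * I.n + 5) * (4 * I.n + 5) := Nat.mul_le_mul hmle hmle
      _ = _ := by ring
  simp only [write, wp_seq, wp_sto, Ex.eval_var, Ex.eval_lit]
  refine ⟨by omega, ?_⟩
  have hinit : Image m (fun _ => 0) (fun _ _ => 0) ((σ.put .out 0 m).a .out) := by
    refine ⟨by simp, fun i _ => by simp [h0], fun i j _ _ => ?_⟩
    rw [St.put_a, if_neg (by generalize i * m = z; omega), h0]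
  have hx0 : m = 1 ↔ x = 0 := by
    rw [hm]
    constructor
    · intro h
      by_contra hc
      obtain ⟨p, hp⟩ := exists_needed_iff.2 hc
      have := index_lt hp
      omega
    · intro h
      simp [vertexCount, h]
  suffices h : WP V L (ite (.eq (var .m) 1) (sto .out 1 1) (
      loop .s .u (
        ite (.eq (get .nd (var .s)) 0) skip (
          sto .out (1 + get .idx (var .s)) (get .dg (var .u * var .u + var .s)) ;;
          loop .i .u (
            ite (.eq (get .dg (var .s * var .u + var .i)) 0) skip
              (sto .out (1 + var .m + get .idx (var .s) * var .m + get .idx (var .i))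
                (get .dg (var .s * var .u + var .i)))))) ;;
      sto .out (1 + var .m + get .idx 0 * var .m) 1)) (σ.put .out 0 m) fun τ =>
        Image m (fun i => markCode x (vertexExponent x i))
          (fun i j => edgeCode (vertexExponent x i) (vertexExponent x j)) (τ.a .out) by
    refine h.frame fun τ hτ hf => ?_
    have hmτ : τ.r .m = m := hf.1 _ rfl
    simp only [wp_seq, wp_asg, wp_sto, wp_ite, wp_skip, Cn.holds_lt, Cn.holds_eq, Ex.eval_add, Ex.eval_sub,
      Ex.eval_mul, Ex.eval_get, Ex.eval_var, Ex.eval_lit, eval_labE, St.set_r, St.set_a, St.put_r,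
      St.put_a, reduceCtorEq, if_true, if_false, true_and, and_true, false_and, and_false, hmτ]
    exact ⟨by omega, hτ⟩
  refine wp_ite.2 ⟨fun h => ?_, fun h => ?_⟩
  · simp only [Cn.holds_eq, Ex.eval_var, Ex.eval_lit, St.put_r] at h
    have hxz := hx0.1 h
    rw [wp_sto]
    refine ⟨by simp; omega, ?_⟩
    refine hinit.put_mark (i := 0) (c := 1) (by omega) (fun y => by simp) ?_ ?_
    · intro i hi
      obtain rfl : i = 0 := by omega
      simp [vertexExponent, markCode, hxz]
    · intro i j hi hj
      obtain rfl : i = 0 := by omega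
      simp [vertexExponent, edgeCode]
  · simp only [Cn.holds_eq, Ex.eval_var, Ex.eval_lit, St.put_r] at h
    have hxz : x ≠ 0 := fun hc => h (hx0.2 hc)
    rw [wp_seq]
    refine wp_loop (fun s τ => Image m (I.partialMark s) (I.partialEdge s 0) (τ.a .out))
      (by decide) (by simp; omega) ?_ ?_ ?_
    · refine hinit.congr (fun i hi => ?_) fun i j hi hj => ?_
      · unfold partialMark
        split <;> simp
      · unfold partialEdge
        split <;> simp
    · intro s τ hs hinv hsi hf
      simp only [St.put_r] at hs
      obtain ⟨p₀, hp₀, rfl⟩ := hl.exists_count s hs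
      set s := Nat.count I.Pos p₀ with hsdef
      have hndτ : τ.a .nd = σ.a .nd := by rw [hf.2 _ rfl]; funext; simp
      have hdgτ : τ.a .dg = σ.a .dg := by rw [hf.2 _ rfl]; funext; simp
      have hidxτ : τ.a .idx = σ.a .idx := by rw [hf.2 _ rfl]; funext; simp
      have huτ : τ.r .u = σ.r .u := by rw [hf.1 _ rfl]; simp
      have hmτ : τ.r .m = m := by rw [hf.1 _ rfl]; simp [hmdef]
      have hcount : ∀ p, Needed x p → (Nat.count I.Pos p = s ↔ p = p₀) := fun p hp =>
        ⟨fun h => count_inj (hpos p hp) hp₀ h, fun h => by rw [h]⟩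
      refine wp_ite.2 ⟨fun hz => ?_, fun hz => ?_⟩
      · simp only [Cn.holds_eq, Ex.eval_get, Ex.eval_var, Ex.eval_lit, hsi, hndτ] at hz
        have hnn : ¬ Needed x p₀ := fun hc => (hnd p₀ hp₀).2 hc hz
        have hlt : ∀ p, Needed x p → (Nat.count I.Pos p < s + 1 ↔ Nat.count I.Pos p < s) := by
          intro p hp
          have : Nat.count I.Pos p ≠ s := fun hc => hnn ((hcount p hp).1 hc ▸ hp)
          omega
        rw [wp_skip]
        refine hinv.congr (fun i hi => ?_) fun i j hi hj => ?_
        · rw [hm] at hi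
          rcases vertexExponent_cases hi with ⟨_, h2⟩ | ⟨p, hp, _, h2⟩
          · simp only [partialMark, ← hx, h2]
          · simp only [partialMark, ← hx, h2, hlt p hp]
        · rw [hm] at hi hj
          rcases vertexExponent_cases hi with ⟨_, h2⟩ | ⟨p, hp, _, h2⟩
          · simp only [partialEdge, ← hx, h2]
          · rcases vertexExponent_cases hj with ⟨_, h4⟩ | ⟨q, hq, _, h4⟩
            · simp only [partialEdge, ← hx, h2, h4]
            · simp only [partialEdge, ← hx, h2, h4, hlt p hp, not_lt_zero, and_false]
      · simp only [Cn.holds_eq, Ex.eval_get, Ex.eval_var, Ex.eval_lit, hsi, hndτ] at hz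
        have hnn : Needed x p₀ := (hnd p₀ hp₀).1 hz
        have hι := hidx p₀ hnn
        rw [← hsdef] at hι
        have hιlt : σ.a .idx s < m := by rw [hι, hm]; exact index_lt hnn
        have hval := hd.value hl hp₀
        rw [← hsdef] at hval
        have hidx' : ∀ p q, Needed x p → Needed x q → (1 + Nat.count (Needed x) p =
            1 + Nat.count (Needed x) q ↔ p = q) := fun p q hp hq =>
          ⟨fun h => Nat.count_injective hp hq (by omega), fun h => by rw [h]⟩
        simp only [wp_seq, wp_sto, Ex.eval_get, Ex.eval_add, Ex.eval_mul, Ex.eval_var,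
          Ex.eval_lit, hsi, hdgτ, hidxτ, huτ, hval]
        refine ⟨by have := signCode_le (naf (I.rowSum 0) p₀); omega, ?_⟩
        refine wp_loop (fun s' τ' => Image m (I.partialMark (s + 1)) (I.partialEdge s s')
          (τ'.a .out)) (by decide) (by simp [huτ]; omega) ?_ ?_ ?_
        · refine hinv.put_mark hιlt (c := signCode (naf x p₀)) (fun y => by simp [hsdef, hx]) ?_
            fun i j _ _ => rfl
          intro i hi
          rw [hm] at hi
          rcases vertexExponent_cases hi with ⟨h1, h2⟩ | ⟨p, hp, h1, h2⟩
          · simp only [partialMark, ← hx, h2]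
            rw [if_neg (by omega)]
          · simp only [partialMark, ← hx, h2]
            rw [hι, h1]
            simp only [hidx' p p₀ hp hnn]
            have := hcount p hp
            by_cases hpp : p = p₀
            · rw [if_pos (by have := this.2 hpp; omega), if_pos hpp, hpp]
            · have h5 : Nat.count I.Pos p ≠ s := fun hc => hpp (this.1 hc)
              rw [if_neg hpp]
              have : Nat.count I.Pos p < s + 1 ↔ Nat.count I.Pos p < s := by omega
              simp only [this]
        · intro s' τ' hs' hinv' hs'i hf'
          simp only [St.put_r, huτ] at hs'
          obtain ⟨q₀, hq₀, rfl⟩ := hl.exists_count s' hs'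
          have hdg' : τ'.a .dg = σ.a .dg := by rw [hf'.2 _ rfl]; funext; simp [hdgτ]
          have hidx'' : τ'.a .idx = σ.a .idx := by rw [hf'.2 _ rfl]; funext; simp [hidxτ]
          have hu' : τ'.r .u = σ.r .u := by rw [hf'.1 _ rfl]; simp [huτ]
          have hm' : τ'.r .m = m := by rw [hf'.1 _ rfl]; simp [hmτ]
          have hs'' : τ'.r .s = s := by rw [hf'.1 _ rfl]; simp [hsi]
          have hval' := hd.pos hl hI hp₀ hq₀
          rw [← hsdef] at hval'
          simp only [wp_seq, wp_asg, wp_sto, wp_ite, wp_skip, Cn.holds_lt, Cn.holds_eq, Ex.eval_add, Ex.eval_sub,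
      Ex.eval_mul, Ex.eval_get, Ex.eval_var, Ex.eval_lit, eval_labE, St.set_r, St.set_a, St.put_r,
      St.put_a, reduceCtorEq, if_true, if_false, true_and, and_true, false_and, and_false, hs'', hs'i, hdg', hidx'', hu', hm', hval', signCode_eq_zero]
          have hcq : ∀ q, Needed x q → (Nat.count I.Pos q < Nat.count I.Pos q₀ + 1 ↔
              Nat.count I.Pos q < Nat.count I.Pos q₀ ∨ q = q₀) := by
            intro q hq
            constructor
            · intro h
              by_cases hc : Nat.count I.Pos q < Nat.count I.Pos q₀
              · exact Or.inl hc
              · exact Or.inr (count_inj (hpos q hq) hq₀ (by omega))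
            · rintro (h | rfl) <;> omega
          refine ⟨fun hz' => ?_, fun hz' => ⟨by have := signCode_le (naf (p₀ : ℤ) q₀); omega, ?_⟩⟩
          · refine hinv'.congr (fun _ _ => rfl) fun i j hi hj => ?_
            rw [hm] at hi hj
            rcases vertexExponent_cases hi with ⟨_, h2⟩ | ⟨p, hp, _, h2⟩
            · simp only [partialEdge, ← hx, h2]
            · rcases vertexExponent_cases hj with ⟨_, h4⟩ | ⟨q, hq, _, h4⟩
              · simp only [partialEdge, ← hx, h2, h4]
              · simp only [partialEdge, ← hx, h2, h4, hcq q hq, hcount p hp]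
                by_cases hpp : p = p₀
                · by_cases hqq : q = q₀
                  · rw [hpp, hqq, hz', signCode_zero, ite_self, ite_self]
                  · simp only [hqq, or_false]
                · simp only [hpp, false_and]
          · have hnq : Needed x q₀ := hnn.step hz'
            refine hinv'.put_edge (i := σ.a .idx s) (j := σ.a .idx (Nat.count I.Pos q₀))
              (c := signCode (naf (p₀ : ℤ) q₀))
              (by rw [hidx q₀ hnq, hm]; exact index_lt hnq) (fun y => by simp) (fun _ _ => rfl) ?_
            intro i j hi hj
            rw [hm] at hi hj
            rw [hι, hidx q₀ hnq]
            rcases vertexExponent_cases hi with ⟨h1, h2⟩ | ⟨p, hp, h1, h2⟩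
            · simp only [partialEdge, ← hx, h2]
              rw [if_neg (by omega)]
            · rcases vertexExponent_cases hj with ⟨h3, h4⟩ | ⟨q, hq, h3, h4⟩
              · simp only [partialEdge, ← hx, h2, h4]
                rw [if_neg (by omega)]
              · simp only [partialEdge, ← hx, h2, h4, hcq q hq, hcount p hp]
                rw [h1, h3]
                simp only [hidx' p p₀ hp hnn, hidx' q q₀ hq hnq]
                by_cases hpp : p = p₀
                · by_cases hqq : q = q₀
                  · simp [hpp, hqq]
                  · simp only [hqq, or_false, and_false, if_false]
                · simp only [hpp, false_and, if_false]
        · intro τ' hinv' hf'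
          simp only [St.put_r, huτ] at hinv'
          refine hinv'.congr (fun _ _ => rfl) fun i j hi hj => ?_
          rw [hm] at hi hj
          rcases vertexExponent_cases hi with ⟨_, h2⟩ | ⟨p, hp, _, h2⟩
          · simp only [partialEdge, ← hx, h2]
          · rcases vertexExponent_cases hj with ⟨_, h4⟩ | ⟨q, hq, _, h4⟩
            · simp only [partialEdge, ← hx, h2, h4]
            · simp only [partialEdge, ← hx, h2, h4, hl.count_lt q (hpos q hq), and_true,
                not_lt_zero, and_false, or_false, Nat.lt_succ_iff, Nat.le_iff_lt_or_eq]
    · intro τ hinv hf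
      simp only [St.put_r] at hinv
      have hidxτ : τ.a .idx = σ.a .idx := by rw [hf.2 _ rfl]; funext; simp
      have hmτ : τ.r .m = m := by rw [hf.1 _ rfl]; simp [hmdef]
      obtain ⟨p, hp⟩ := exists_needed_iff.2 hxz
      have hn0 := hp.zero
      have hi0 := hidx 0 hn0
      rw [Nat.count_zero, Nat.count_zero] at hi0
      simp only [wp_seq, wp_asg, wp_sto, wp_ite, wp_skip, Cn.holds_lt, Cn.holds_eq, Ex.eval_add, Ex.eval_sub,
      Ex.eval_mul, Ex.eval_get, Ex.eval_var, Ex.eval_lit, eval_labE, St.set_r, St.set_a, St.put_r,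
      St.put_a, reduceCtorEq, if_true, if_false, true_and, and_true, false_and, and_false, hidxτ, hmτ, hi0]
      refine ⟨by omega, ?_⟩
      refine hinv.put_edge (i := 1 + 0) (j := 0) (c := 1) (by rw [hm]; unfold vertexCount; omega)
        (fun y => by simp) ?_ ?_
      · intro i hi
        rw [hm] at hi
        rcases vertexExponent_cases hi with ⟨_, h2⟩ | ⟨p, hp, _, h2⟩
        · simp only [partialMark, ← hx, h2, markCode, if_neg hxz]
        · simp only [partialMark, ← hx, h2, markCode, if_pos (hl.count_lt p (hpos p hp))]
      · intro i j hi hj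
        rw [hm] at hi hj
        rcases vertexExponent_cases hi with ⟨h1, h2⟩ | ⟨p, hp, h1, h2⟩
        · simp only [partialEdge, ← hx, h2, edgeCode]
          rw [if_neg (by omega)]
        · rcases vertexExponent_cases hj with ⟨h3, h4⟩ | ⟨q, hq, h3, h4⟩
          · simp only [partialEdge, ← hx, h2, h4, edgeCode]
            have : i = 1 + 0 ↔ p = 0 := by
              rw [h1]
              constructor
              · intro h
                exact Nat.count_injective hp hn0 (by rw [Nat.count_zero]; omega)
              · rintro rfl; simp
            simp only [this, h3, and_true]
          · simp only [partialEdge, ← hx, h2, h4, edgeCode]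
            rw [if_pos (Or.inl (hl.count_lt p (hpos p hp))), if_neg (by omega)]

theorem wp_normalForm {σ : St} (hV : 1000 * (I.n * I.n) + 1000 * I.n + 1000 ≤ V)
    (hL : 16 * I.n + 32 ≤ L) (hI : I.Fits) (hin : I.Input σ)
    (h0 : ∀ b, b ≠ .inp → σ.a b = fun _ => 0) : WP V L normalForm σ fun τ =>
      τ.r .m = vertexCount (I.rowSum 0) ∧ τ.r .sz = 1 + τ.r .m + τ.r .m * τ.r .m ∧
      Image (τ.r .m) (fun i => markCode (I.rowSum 0) (vertexExponent (I.rowSum 0) i))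
        (fun i j => edgeCode (vertexExponent (I.rowSum 0) i) (vertexExponent (I.rowSum 0) j))
        (τ.a .out) := by
  unfold normalForm
  refine wp_seq.2 ((wp_init hV hL hin (h0 _ (by decide)) (h0 _ (by decide))
    (h0 _ (by decide))).frame fun τ₁ hS₁ hf₁ => ?_)
  refine wp_seq.2 ((wp_sort hV hL hS₁ hI (by rw [hf₁.2 _ rfl, h0 _ (by decide)])).frame
    fun τ₂ ⟨hs₂, hall₂, hnz₂⟩ hf₂ => ?_)
  have hS₂ := hS₁.frame hf₂ (by decide)
  refine wp_seq.2 ((wp_positions hV hL hS₂ hI hs₂ hall₂).frame fun τ₃ hl₃ hf₃ => ?_)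
  have hS₃ := hS₂.frame hf₃ (by decide)
  refine wp_seq.2 ((wp_rows hV hL hS₃ hl₃ (by rw [hf₃.2 _ rfl]; exact hnz₂)).frame
    fun τ₄ hd₄ hf₄ => ?_)
  have hl₄ := hl₃.frame hf₄ (by decide)
  refine wp_seq.2 ((wp_need hV hL hI hl₄ hd₄).frame fun τ₅ hnd₅ hf₅ => ?_)
  have hl₅ := hl₄.frame hf₅ (by decide)
  have hd₅ := hd₄.frame hf₅ (by decide) (by decide)
  refine wp_seq.2 ((wp_number hV hL hI hl₅ hnd₅).frame fun τ₆ ⟨hm₆, hmle₆, hidx₆⟩ hf₆ => ?_)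
  have hl₆ := hl₅.frame hf₆ (by decide)
  have hd₆ := hd₅.frame hf₆ (by decide) (by decide)
  refine (wp_write hV hL hI hl₆ hd₆ (by rw [hf₆.2 _ rfl]; exact hnd₅) hm₆ hmle₆ hidx₆
    (by rw [hf₆.2 _ rfl, hf₅.2 _ rfl, hf₄.2 _ rfl, hf₃.2 _ rfl, hf₂.2 _ rfl, hf₁.2 _ rfl,
      h0 _ (by decide)])).frame fun τ₇ ⟨h1, h2⟩ hf₇ => ?_
  have hm₇ : τ₇.r .m = τ₆.r .m := hf₇.1 _ rfl
  rw [hm₇]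
  exact ⟨hm₆, h1, h2⟩

end Cmd
end RAM

/-! ### The bound for the number of vertices -/

namespace RAM
namespace Inst

variable {I : Inst}

/-- A nonzero vertex of least rank has only zero vertices as successors, so its exponent is `0`. -/
theorem mult_zero_pos_of_nz (hI : I.Fits) (h : ∃ v < I.n, I.NZ v) : 0 < I.mult 0 := by
  classical
  obtain ⟨v, hv, hmin⟩ := Finset.exists_min_image ((Finset.range I.n).filter I.NZ) I.ht
    (by obtain ⟨v, hv, hnz⟩ := h; exact ⟨v, by simp [hv, hnz]⟩)
  rw [Finset.mem_filter, Finset.mem_range] at hv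
  have h0 : I.rowSum (v + 1) = 0 := by
    refine Finset.sum_eq_zero fun w hw => ?_
    have hlab : I.lab (v + 1) w = 0 := by
      by_contra hc
      have h1 := hmin w hw
      rw [Finset.mem_filter, Finset.mem_range] at hw
      have h2 := I.ht_lt v w hv.1 hw.1 hc
      omega
    rw [hlab, sgn, if_neg (by omega), if_neg (by omega), zero_mul]
  have h1 := hI v hv.1
  rw [h0] at h1
  have h2 := mult_pos hv.1 hv.2
  rwa [show I.e v = 0 by exact_mod_cast h1] at h2

/-- The closure argument for an arbitrary admissible padding. The program can afford spare
positions; the bound `2 * n` cannot. -/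
theorem carrySupport_of_needed (hI : I.Fits) (h0 : 0 < I.mult 0) {J : ℕ}
    (hJ : ∀ i, I.mult i + 1 ≤ J) {p : ℕ} (hp : Needed (I.rowSum 0) p) :
    CarrySupport (padded I.mult J) p := by
  have key : ∀ {r j p : ℕ}, j ≤ J → naf (I.rowSum r + j) p ≠ 0 →
      CarrySupport (padded I.mult J) p := by
    intro r j p hj hp
    rw [← rest_zero] at hp
    exact carrySupport_of_naf_ne_zero (I.rest_eq r j) (abs_coef_le_padded hj) hp
  induction hp with
  | base hp => exact key (r := 0) (Nat.zero_le J) (by simpa using hp)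
  | @step b p _ hp ih =>
    obtain ⟨e, j, rfl, hj, hμ⟩ := exists_sub_le_of_carrySupport hJ h0 b ih
    classical
    obtain ⟨v, hv⟩ := Finset.card_pos.1 hμ
    rw [Finset.mem_filter, Finset.mem_range] at hv
    refine key (r := v + 1) hj ?_
    rw [← hI v hv.1, hv.2.2]
    exact_mod_cast hp

/-- A normal form has at most twice as many vertices. -/
theorem vertexCount_le (hI : I.Fits) (hz : ∃ v < I.n, ¬ I.NZ v) :
    vertexCount (I.rowSum 0) ≤ 2 * I.n := by
  classical
  have hcard : ((Finset.range I.n).filter I.NZ).card < I.n := by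
    obtain ⟨v, hv, hnz⟩ := hz
    have := Finset.card_lt_card (Finset.filter_ssubset.2 ⟨v, Finset.mem_range.2 hv, hnz⟩)
    simpa using this
  by_cases hx : I.rowSum 0 = 0
  · rw [hx, vertexCount]; simp; omega
  obtain ⟨v, hv, _⟩ := Finset.exists_ne_zero_of_sum_ne_zero hx
  rw [Finset.mem_filter, Finset.mem_range] at hv
  have h0 := mult_zero_pos_of_nz hI ⟨v, hv⟩
  -- Large enough for all needed exponents and for the exponents of all vertices.
  set N := (I.rowSum 0).natAbs + (Finset.range I.n).sup I.e with hN
  -- This exceeds each single multiplicity, as the other summands are nonnegative.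
  set J := ∑ i ∈ Finset.range (N + 1), (I.mult i - 1) + 2 with hJdef
  have hJ : ∀ i, I.mult i + 1 ≤ J := by
    intro i
    by_cases hi : i ∈ Finset.range (N + 1)
    · have := Finset.single_le_sum (f := fun i => I.mult i - 1) (fun _ _ => Nat.zero_le _) hi
      omega
    · have : I.mult i = 0 := by
        rw [mult, Finset.card_eq_zero, Finset.filter_eq_empty_iff]
        rintro w hw ⟨_, rfl⟩
        have := Finset.le_sup (f := I.e) hw
        exact hi (Finset.mem_range.2 (by omega))
      omega
  have h1 := Nat.count_monotone (Needed (I.rowSum 0)) (show (I.rowSum 0).natAbs ≤ N + 1 by omega)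
  have h2 : Nat.count (Needed (I.rowSum 0)) (N + 1) ≤
      Nat.count (CarrySupport (padded I.mult J)) (N + 1) :=
    Nat.count_mono_left fun p _ hp => carrySupport_of_needed hI h0 hJ hp
  have h3 := count_carrySupport_le_two_mul I.mult h0 N
  have h4 := I.sum_mult_le_card (N + 1)
  rw [← hJdef] at h3
  -- With `k` nonzero vertices there are at most `2 * k + 1` needed exponents. Adding the zero
  -- vertex gives `2 * k + 2 ≤ 2 * n`, because `k < n`.
  rw [vertexCount]
  omega

end Inst
end RAM

/-! ### The canonical circuit of an integer -/

namespace RAM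

/-- The mark of a vertex of the canonical circuit of value `x`. -/
def markSign (x : ℤ) : Option ℕ → SignType
  | none => if x = 0 then 1 else 0
  | some p => naf x p

/-- The label of an edge of a canonical circuit. -/
def edgeSign : Option ℕ → Option ℕ → SignType
  | none, _ => 0
  | some p, none => if p = 0 then 1 else 0
  | some p, some q => naf (p : ℤ) q

theorem signCode_markSign (x : ℤ) (o : Option ℕ) : signCode (markSign x o) = markCode x o := by
  rcases o with _ | p
  · simp only [markSign, markCode]; split_ifs <;> rfl
  · rfl

theorem signCode_edgeSign (o o' : Option ℕ) : signCode (edgeSign o o') = edgeCode o o' := by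
  rcases o with _ | p <;> rcases o' with _ | q
  · rfl
  · rfl
  · simp only [edgeSign, edgeCode]; split_ifs <;> rfl
  · rfl

/-- The rank is `0` for the zero vertex and `p + 1` for the exponent `p`; its decrease along edges
yields acyclicity. -/
theorem lt_of_edgeSign_ne_zero {o o' : Option ℕ} (h : edgeSign o o' ≠ 0) :
    o'.elim 0 (· + 1) < o.elim 0 (· + 1) := by
  rcases o with _ | p
  · exact absurd rfl h
  rcases o' with _ | q
  · simp
  · simpa using lt_of_naf_natCast_ne_zero h

/-- The canonical circuit of value `x`. -/
noncomputable def canonical (x : ℤ) : PowerCircuit (Fin (vertexCount x)) where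
  edge v w := edgeSign (vertexExponent x v) (vertexExponent x w)
  mark v := markSign x (vertexExponent x v)
  acyclic := by
    have key : ∀ v w : Fin (vertexCount x), Relation.TransGen
        (fun v w : Fin (vertexCount x) => edgeSign (vertexExponent x v) (vertexExponent x w) ≠ 0) v w →
        (vertexExponent x w).elim 0 (· + 1) < (vertexExponent x v).elim 0 (· + 1) := by
      intro v w h
      induction h with
      | single h => exact lt_of_edgeSign_ne_zero h
      | tail _ h ih => exact (lt_of_edgeSign_ne_zero h).trans ih
    exact fun v h => (key v v h).false
  marked_nonempty := by
    by_cases hx : x = 0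
    · exact ⟨⟨0, by unfold vertexCount; omega⟩, by simp [vertexExponent, markSign, hx]⟩
    · obtain ⟨p, hp⟩ := exists_naf_ne_zero hx
      refine ⟨⟨_, index_lt (.base hp)⟩, ?_⟩
      simpa only [vertexExponent_index (.base hp), markSign] using hp

theorem isCanonical_canonical (x : ℤ) :
    (canonical x).IsCanonical x fun v => vertexExponent x v where
  inj v w h := Fin.ext (vertexExponent_inj v.2 w.2 h)
  range p := by
    constructor
    · rintro ⟨v, hv⟩
      rcases vertexExponent_cases v.2 with ⟨_, h⟩ | ⟨q, hq, _, h⟩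
      · simp [h] at hv
      · simp only [h, Option.some.injEq] at hv
        exact hv ▸ hq
    · exact fun hp => ⟨⟨_, index_lt hp⟩, vertexExponent_index hp⟩
  exists_none := ⟨⟨0, by unfold vertexCount; omega⟩, rfl⟩
  edge_some v w p q hv hw := by
    show edgeSign (vertexExponent x v) (vertexExponent x w) = _
    rw [hv, hw, edgeSign]
  edge_none v w p hv hw := by
    show edgeSign (vertexExponent x v) (vertexExponent x w) ≠ 0 ↔ _
    rw [hv, hw, edgeSign]
    split_ifs with h <;> simp [h]
  none_edge v w hv := by
    show edgeSign (vertexExponent x v) (vertexExponent x w) = _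
    rw [hv, edgeSign]
  mark_some v p hv := by
    show markSign x (vertexExponent x v) = _
    rw [hv, markSign]
  mark_none v hv := by
    show markSign x (vertexExponent x v) ≠ 0 ↔ _
    rw [hv, markSign]
    split_ifs with h <;> simp [h]

theorem zeroSignsPositive_canonical (x : ℤ) : (canonical x).ZeroSignsPositive := by
  intro z hz
  rw [(isCanonical_canonical x).isZero_iff] at hz
  constructor
  · intro v
    show edgeSign (vertexExponent x v) (vertexExponent x z) ≠ -1
    rw [hz]
    rcases vertexExponent x v with _ | p <;> simp only [edgeSign]
    · decide
    · split_ifs <;> decide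
  · show markSign x (vertexExponent x z) ≠ -1
    rw [hz, markSign]
    split_ifs <;> decide

/-! ### Circuits as abstract instances -/

namespace Inst

variable {n : ℕ}

open Classical in
/-- The number of vertices that can be reached by a path of positive length. -/
noncomputable def height (P : PowerCircuit (Fin n)) (v : Fin n) : ℕ :=
  (Finset.univ.filter (Relation.TransGen (fun u w => P.edge u w ≠ 0) v)).card

/-- Whatever lies below `w` lies below `v`, and so does `w`, which by acyclicity does not lie below
itself. -/
theorem height_lt {P : PowerCircuit (Fin n)} {v w : Fin n} (h : P.edge v w ≠ 0) :
    height P w < height P v := by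
  classical
  refine Finset.card_lt_card (Finset.ssubset_iff_of_subset (fun u hu => ?_) |>.2 ⟨w, ?_, ?_⟩)
  · rw [Finset.mem_filter] at hu ⊢
    exact ⟨hu.1, .head h hu.2⟩
  · simpa using Relation.TransGen.single (r := fun u w => P.edge u w ≠ 0) h
  · simpa using P.acyclic w

/-- The codes of the labels and marks of a circuit, and the exponents of its vertices. -/
noncomputable def ofCircuit (P : PowerCircuit (Fin n)) : Inst where
  n := n
  lab r w := if hw : w < n then
      if r = 0 then signCode (P.mark ⟨w, hw⟩)
      else if hr : r - 1 < n then signCode (P.edge ⟨r - 1, hr⟩ ⟨w, hw⟩) else 0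
    else 0
  lab_le r w := by
    split_ifs <;> first | exact signCode_le _ | omega
  ht v := if hv : v < n then height P ⟨v, hv⟩ else 0
  ht_lt v w hv hw h := by
    simp only [hw, Nat.add_eq_zero_iff, one_ne_zero, and_false, Nat.add_sub_cancel, hv, if_false,
      dif_pos, ne_eq, signCode_eq_zero] at h ⊢
    exact height_lt h
  e v := if hv : v < n then (P.exponent? ⟨v, hv⟩).getD 0 else 0

variable {P : PowerCircuit (Fin n)}

theorem ofCircuit_n : (ofCircuit P).n = n := rfl

theorem ofCircuit_lab_zero (w : Fin n) : (ofCircuit P).lab 0 w = signCode (P.mark w) := by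
  simp [ofCircuit]

theorem ofCircuit_lab_succ (v w : Fin n) :
    (ofCircuit P).lab (v + 1) w = signCode (P.edge v w) := by
  simp [ofCircuit]

theorem ofCircuit_e (v : Fin n) : (ofCircuit P).e v = (P.exponent? v).getD 0 := by
  simp [ofCircuit]

theorem ofCircuit_nz (v : Fin n) : (ofCircuit P).NZ v ↔ ¬ P.IsZero v := by
  unfold NZ PowerCircuit.IsZero
  push Not
  constructor
  · rintro ⟨w, hw, h⟩
    rw [ofCircuit_lab_succ v ⟨w, hw⟩, Ne, signCode_eq_zero] at h
    exact ⟨_, h⟩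
  · rintro ⟨w, hw⟩
    exact ⟨w, w.2, by rwa [ofCircuit_lab_succ, Ne, signCode_eq_zero]⟩

/-- The link between real values of vertices and the integer sums of the program: properness makes
each value `0` or a natural power of `2`. -/
theorem ofCircuit_rowSum (hP : P.Proper) {r : ℕ} {s : Fin n → SignType}
    (hs : ∀ w : Fin n, (ofCircuit P).lab r w = signCode (s w)) :
    ((ofCircuit P).rowSum r : ℝ) = ∑ w, ((s w : SignType) : ℝ) * P.eval w := by
  classical
  rw [rowSum, Finset.sum_filter, ofCircuit_n, Finset.sum_range, Int.cast_sum]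
  refine Finset.sum_congr rfl fun w _ => ?_
  rw [hs, sgn_signCode, ofCircuit_nz, ofCircuit_e, PowerCircuit.eval_eq_powOrZero hP]
  rcases h : P.exponent? w with _ | p
  · rw [if_neg (not_not.2 (PowerCircuit.exponent?_eq_none.1 h))]
    simp [powOrZero]
  · rw [if_pos (fun hc => by simp [PowerCircuit.exponent?_eq_none.2 hc] at h)]
    simp [powOrZero]

theorem ofCircuit_value (hP : P.Proper) : ((ofCircuit P).rowSum 0 : ℝ) = P.value :=
  ofCircuit_rowSum hP ofCircuit_lab_zero

/-- For a zero vertex the default exponent `0` agrees with its empty sum. -/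
theorem ofCircuit_fits (hP : P.Proper) : (ofCircuit P).Fits := by
  intro v hv
  have h := ofCircuit_rowSum hP (ofCircuit_lab_succ (P := P) ⟨v, hv⟩)
  have he := ofCircuit_e (P := P) ⟨v, hv⟩
  simp only at h he
  rw [he]
  by_cases hz : P.IsZero ⟨v, hv⟩
  · simp only [hz _, SignType.coe_zero, zero_mul, Finset.sum_const_zero, Int.cast_eq_zero] at h
    rw [h, PowerCircuit.exponent?_eq_none.2 hz]
    rfl
  · obtain ⟨p, h1, h2⟩ := hP.exists_exponent hz
    rw [h2] at h
    rw [(PowerCircuit.exponent?_eq_some hP).2 h1]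
    exact_mod_cast h.symm

theorem vertexCount_ofCircuit_le (hP : P.Proper) :
    vertexCount ((ofCircuit P).rowSum 0) ≤ 2 * n := by
  obtain ⟨v, hv⟩ := P.exists_isZero
  exact vertexCount_le (ofCircuit_fits hP) ⟨v, v.2, by rw [ofCircuit_nz]; exact not_not.2 hv⟩

end Inst
end RAM

namespace RAM

/-! ### Input and output -/

variable {n : ℕ}

theorem encode_zero (P : PowerCircuit (Fin n)) : encode P 0 = n := by simp [encode]

theorem encode_mark (P : PowerCircuit (Fin n)) (v : Fin n) :
    encode P (1 + v) = signCode (P.mark v) := by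
  simp [encode]

theorem encode_edge (P : PowerCircuit (Fin n)) (v w : Fin n) :
    encode P (1 + n + v * n + w) = signCode (P.edge v w) := by
  have h : (v : ℕ) * n + w = finProdFinEquiv (v, w) := by
    rw [finProdFinEquiv_apply_val]; ring
  have hlt : (v : ℕ) * n + w < n * n := by
    rw [h]; exact (finProdFinEquiv (v, w)).2
  have h1 : 1 + n + (v : ℕ) * n + w - 1 - n = v * n + w := by omega
  have h2 : (⟨(v : ℕ) * n + w, hlt⟩ : Fin (n * n)) = finProdFinEquiv (v, w) := Fin.ext h
  rw [encode, if_neg (by omega), dif_neg (by omega)]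
  simp only [h1, h2, hlt, dif_pos, Equiv.symm_apply_apply]

theorem encode_eq_zero (P : PowerCircuit (Fin n)) {a : ℕ} (ha : 1 + n + n * n ≤ a) :
    encode P a = 0 := by
  rw [encode, if_neg (by omega), dif_neg (by omega), dif_neg (by omega)]

theorem encode_le (P : PowerCircuit (Fin n)) (a : ℕ) : encode P a ≤ n + 2 := by
  unfold encode
  dsimp only
  split_ifs
  · omega
  · exact (signCode_le _).trans (by omega)
  · exact (signCode_le _).trans (by omega)
  · omega

theorem Image.eq_encode {Q : PowerCircuit (Fin n)} {mk : ℕ → ℕ} {ed : ℕ → ℕ → ℕ} {out : ℕ → ℕ}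
    (h : Image n mk ed out) (hmk : ∀ v : Fin n, mk v = signCode (Q.mark v))
    (hed : ∀ v w : Fin n, ed v w = signCode (Q.edge v w)) {a : ℕ} (ha : a ≤ n + n * n) :
    out a = encode Q a := by
  rcases Nat.eq_zero_or_pos a with rfl | hpos
  · rw [h.size, encode_zero]
  by_cases han : a < 1 + n
  · obtain ⟨v, rfl⟩ := Nat.exists_eq_add_of_le hpos
    rw [h.mark v (by omega), hmk ⟨v, by omega⟩, ← encode_mark]
  · obtain ⟨k, rfl⟩ := Nat.exists_eq_add_of_le (Nat.le_of_not_lt han)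
    have hn : 0 < n := by
      rcases Nat.eq_zero_or_pos n with rfl | h
      · omega
      · exact h
    have hi : k / n < n := (Nat.div_lt_iff_lt_mul hn).2 (by omega)
    have hj : k % n < n := Nat.mod_lt _ hn
    have hk : 1 + n + k = 1 + n + k / n * n + k % n := by
      have := Nat.div_add_mod' k n; omega
    rw [hk, h.edge _ _ hi hj, hed ⟨_, hi⟩ ⟨_, hj⟩, ← encode_edge]

namespace Prog

/-- One round of `copyLoop`. -/
def copyStep : Prog :=
  .seq (.load 70 67) (.seq (.store 68 70) (.seq (.plus 67 67 69) (.seq (.plus 68 68 71)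
    (.plus 65 65 64))))

/-- Copy cells at arithmetically progressing addresses. The registers `65` and `66` hold the counter
and its bound, `67` and `68` the addresses, `69` and `71` their increments, and `64` holds `1`. -/
def copyLoop : Prog := .loop (.lt 65 66) copyStep

/-- Source and target may interleave; the last hypothesis says that no cell is overwritten before it
has been read. -/
theorem exec_copyLoop {B a b : ℕ} (hb : 0 < b) (m : ℕ) : ∀ s : Config, s.reg 64 = 1 →
    s.reg 69 = a → s.reg 71 = b → s.reg 65 + m = s.reg 66 → s.reg 66 ≤ B →
    s.reg 67 + a * m ≤ B → s.reg 68 + b * m ≤ B →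
    (∀ j j', j < j' → j' < m → s.reg 68 + b * j ≠ s.reg 67 + a * j') →
    ∃ s', Exec B copyLoop s s' (6 * m + 1) ∧ (∀ r < 64, s'.reg r = s.reg r) ∧
      (∀ j < m, s'.mem (s.reg 68 + b * j) = s.mem (s.reg 67 + a * j)) ∧
      ∀ x, (∀ j < m, x ≠ s.reg 68 + b * j) → s'.mem x = s.mem x := by
  induction m with
  | zero =>
    intro s _ _ _ h _ _ _ _
    exact ⟨s, .loop_false (by simp only [Test.Holds]; omega), fun _ _ => rfl, by simp,
      fun _ _ => rfl⟩
  | succ m ih =>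
    intro s h64 h69 h71 h65 h66 h67 h68 hdis
    rw [Nat.mul_add, Nat.mul_one] at h67 h68
    set s₁ : Config := ⟨fun r => if r = 65 then s.reg 65 + 1 else if r = 68 then s.reg 68 + b else
      if r = 67 then s.reg 67 + a else if r = 70 then s.mem (s.reg 67) else s.reg r,
      Function.update s.mem (s.reg 68) (s.mem (s.reg 67))⟩ with hs₁
    have hstep : Exec B copyStep s s₁ 5 := by
      have h := (Exec.load (B := B) s 70 67).seq ((Exec.store _ 68 70).seq ((Exec.plus _ 67 67 69
        (by simp [Config.setReg, Config.setMem, h69]; omega)).seq ((Exec.plus _ 68 68 71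
        (by simp [Config.setReg, Config.setMem, h71]; omega)).seq (Exec.plus _ 65 65 64
        (by simp [Config.setReg, Config.setMem, h64]; omega)))))
      convert h using 1
      · rfl
      · simp [Config.setReg, Config.setMem, hs₁, h64, h69, h71]
        funext r
        simp only [Function.update_apply]
    obtain ⟨s', hex, hr, hw, hk⟩ := ih s₁ (by simp [hs₁, h64]) (by simp [hs₁, h69])
      (by simp [hs₁, h71]) (by simp [hs₁]; omega) (by simp [hs₁]; omega) (by simp [hs₁]; omega)
      (by simp [hs₁]; omega) (by
        intro j j' hj hj'
        have := hdis (j + 1) (j' + 1) (by omega) (by omega)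
        simp only [hs₁, Nat.mul_add, Nat.mul_one] at this ⊢
        simp
        omega)
    have e67 : s₁.reg 67 = s.reg 67 + a := by simp [hs₁]
    have e68 : s₁.reg 68 = s.reg 68 + b := by simp [hs₁]
    have emem : s₁.mem = Function.update s.mem (s.reg 68) (s.mem (s.reg 67)) := rfl
    rw [e67, e68] at hw
    rw [e68] at hk
    refine ⟨s', ?_, fun r hr' => ?_, fun j hj => ?_, fun x hx => ?_⟩
    · have := Exec.loop_true (b := .lt 65 66) (by simp only [Test.Holds]; omega) hstep hex
      convert this using 1
      · rfl
      · omega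
    · rw [hr r hr', hs₁]
      simp only
      rw [if_neg (by omega), if_neg (by omega), if_neg (by omega), if_neg (by omega)]
    · rcases j with _ | j
      · rw [Nat.mul_zero, Nat.add_zero, Nat.mul_zero, Nat.add_zero, hk _ (fun j _ => by omega), emem,
          Function.update_self]
      · rw [Nat.mul_add, Nat.mul_one, Nat.mul_add, Nat.mul_one, Nat.add_comm (b * j),
          Nat.add_comm (a * j), ← Nat.add_assoc, ← Nat.add_assoc, hw j (by omega), emem,
          Function.update_of_ne]
        have := hdis 0 (j + 1) (by omega) hj
        rw [Nat.mul_add] at this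
        omega
    · rw [hk x (fun j hj => ?_), emem, Function.update_of_ne]
      · simpa using hx 0 (by omega)
      · have := hx (j + 1) (by omega)
        rw [Nat.mul_add] at this
        omega

/-- Set up the constants and copy the input to the array `inp`. -/
def prologue : Prog :=
  .seq (.const 64 1) (.seq (.load 2 0) (.seq (.times 1 2 2) (.seq (.plus 1 1 2)
    (.seq (.plus 1 1 64) (.seq (.const 65 0) (.seq (.copy 66 1) (.seq (.const 67 0)
    (.seq (.copy 68 1) (.seq (.const 69 1) (.seq (.const 71 32) copyLoop))))))))))

/-- Copy the array `out` to the beginning of the memory. -/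
def epilogue : Prog :=
  .seq (.const 64 1) (.seq (.const 65 0) (.seq (.copy 66 Reg.sz.code) (.seq (.const 67 Arr.out.code)
    (.seq (.plus 67 1 67) (.seq (.const 68 0) (.seq (.const 69 32) (.seq (.const 71 1) copyLoop)))))))

end Prog

/-- The values of the variables when the input has been copied. -/
def inputSt (P : PowerCircuit (Fin n)) : St :=
  ⟨fun x => if x = .n then n else 0, fun b => if b = .inp then encode P else fun _ => 0⟩

theorem bdd_inputSt (P : PowerCircuit (Fin n)) {V : ℕ} (hV : n + 2 ≤ V) : (inputSt P).Bdd V := by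
  refine ⟨fun x => ?_, fun b i => ?_⟩ <;> simp only [inputSt]
  · split_ifs <;> omega
  · split_ifs
    · exact (encode_le P i).trans hV
    · exact Nat.zero_le _

theorem input_inputSt (P : PowerCircuit (Fin n)) : (Inst.ofCircuit P).Input (inputSt P) where
  n_eq := by simp [inputSt, Inst.ofCircuit_n]
  inp_eq r w hr hw := by
    rw [Inst.ofCircuit_n] at *
    simp only [inputSt, if_true]
    rcases r with _ | v
    · rw [Inst.ofCircuit_lab_zero ⟨w, hw⟩, ← encode_mark]; simp
    · rw [Inst.ofCircuit_lab_succ ⟨v, by omega⟩ ⟨w, hw⟩, ← encode_edge]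
      congr 1
      simp only
      ring

/-- The arrays begin right behind the input, at `N = 1 + n + n * n`. The memory there is zero, so
all arrays but `inp` start out empty. -/
theorem Prog.exec_prologue (P : PowerCircuit (Fin n)) {B : ℕ} (hB : 34 * (1 + n + n * n) + 32 ≤ B) :
    ∃ s, Exec B prologue (input P) s (6 * (1 + n + n * n) + 12) ∧
      Rel (1 + n + n * n) (inputSt P) s := by
  set N := 1 + n + n * n with hN
  have e0 : encode P 0 = n := encode_zero P
  set s₀ : Config := ⟨fun r => if r = 71 then 32 else if r = 69 then 1 else if r = 68 then N else
    if r = 66 then N else if r = 1 then N else if r = 2 then n else if r = 64 then 1 else 0,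
    encode P⟩ with hs₀
  obtain ⟨s, hex, hr, hw, hk⟩ := exec_copyLoop (B := B) (a := 1) (b := 32) (by omega) N s₀
    (by simp [hs₀]) (by simp [hs₀]) (by simp [hs₀]) (by simp [hs₀]) (by simp [hs₀]; omega)
    (by simp [hs₀]; omega) (by simp [hs₀]; omega) (by simp [hs₀]; omega)
  refine ⟨s, ?_, ?_⟩
  · have h : ∀ s', s' = s₀ → Exec B copyLoop s' s (6 * N + 1) := fun s' h => h ▸ hex
    have h := (Exec.const (B := B) (input P) 64 1 (by omega)).seq ((Exec.load _ 2 0).seq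
      ((Exec.times _ 1 2 2 (by simp [Config.setReg, input, e0]; omega)).seq
      ((Exec.plus _ 1 1 2 (by simp [Config.setReg, input, e0]; omega)).seq
      ((Exec.plus _ 1 1 64 (by simp [Config.setReg, input, e0]; omega)).seq
      ((Exec.const _ 65 0 (by omega)).seq ((Exec.copy _ 66 1).seq ((Exec.const _ 67 0 (by omega)).seq
      ((Exec.copy _ 68 1).seq ((Exec.const _ 69 1 (by omega)).seq ((Exec.const _ 71 32 (by omega)).seq
      (h _ (by
        simp [Config.setReg, input, e0, hs₀]
        funext r
        simp only [Function.update_apply, show n * n + n + 1 = N by omega]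
        split_ifs <;> first | rfl | omega))))))))))))
    convert h using 1
    · rfl
    · omega
  · have r67 : s₀.reg 67 = 0 := by simp [hs₀]
    have r68 : s₀.reg 68 = N := by simp [hs₀]
    rw [r67, r68] at hw
    rw [r68] at hk
    refine ⟨by rw [hr 0 (by omega)]; simp [hs₀], by rw [hr 1 (by omega)]; simp [hs₀], fun x => ?_,
      fun b i => ?_⟩
    · have h1 := x.code_lt
      have h2 := x.two_le_code
      rw [hr _ h1]
      simp only [hs₀, inputSt]
      have h3 : x.code = 2 ↔ x = .n := ⟨fun h => Reg.code_inj (h.trans rfl), fun h => by rw [h]; rfl⟩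
      rw [if_neg (by omega), if_neg (by omega), if_neg (by omega), if_neg (by omega),
        if_neg (by omega), if_neg (c := x.code = 64) (by omega)]
      simp only [h3]
    · have h1 := b.code_lt
      have h3 : b.code = 0 ↔ b = .inp := ⟨fun h => Arr.code_inj (h.trans rfl), fun h => by rw [h]; rfl⟩
      simp only [inputSt]
      split_ifs with hb
      · rw [h3.2 hb, Nat.add_zero]
        by_cases hi : i < N
        · rw [hw i hi]; simp [hs₀]
        · rw [hk _ (by omega), encode_eq_zero P (a := i) (by omega)]
          exact encode_eq_zero P (by omega)
      · rw [← h3] at hb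
        rw [hk _ (by omega)]
        exact encode_eq_zero P (by omega)

/-- The target cell `i` lies below every cell of `out` still to be read, so overwriting the arrays
on the way does no harm. -/
theorem Prog.exec_epilogue {B N : ℕ} {τ : St} {s : Config} (h : Rel N τ s)
    (hB : N + 32 * τ.r .sz + 100 ≤ B) :
    ∃ s', Exec B epilogue s s' (6 * τ.r .sz + 9) ∧ s'.reg 0 = 0 ∧
      ∀ i < τ.r .sz, s'.mem i = τ.a .out i := by
  have hsz := h.reg .sz
  have h1 := h.base
  have hc : Arr.out.code = 16 := rfl
  have hc' : Reg.sz.code < 64 := Reg.code_lt _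
  set s₀ : Config := ⟨fun r => if r = 71 then 1 else if r = 69 then 32 else if r = 68 then 0 else
    if r = 67 then N + 16 else if r = 66 then τ.r .sz else if r = 65 then 0 else
    if r = 64 then 1 else s.reg r, s.mem⟩ with hs₀
  obtain ⟨s', hex, hr, hw, -⟩ := exec_copyLoop (B := B) (a := 32) (b := 1) (by omega) (τ.r .sz) s₀
    (by simp [hs₀]) (by simp [hs₀]) (by simp [hs₀]) (by simp [hs₀]) (by simp [hs₀]; omega)
    (by simp [hs₀]; omega) (by simp [hs₀]; omega) (by simp [hs₀]; omega)
  refine ⟨s', ?_, ?_, fun i hi => ?_⟩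
  · have hx : ∀ s'', s'' = s₀ → Exec B copyLoop s'' s' (6 * τ.r .sz + 1) := fun s' h => h ▸ hex
    have hx := (Exec.const (B := B) s 64 1 (by omega)).seq ((Exec.const _ 65 0 (by omega)).seq
      ((Exec.copy _ 66 Reg.sz.code).seq ((Exec.const _ 67 Arr.out.code (by omega)).seq
      ((Exec.plus _ 67 1 67 (by simp [Config.setReg, h1]; omega)).seq
      ((Exec.const _ 68 0 (by omega)).seq ((Exec.const _ 69 32 (by omega)).seq
      ((Exec.const _ 71 1 (by omega)).seq (hx _ (by
        simp [Config.setReg, hs₀, h1, hc, Function.update_of_ne (show Reg.sz.code ≠ 65 by omega),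
          Function.update_of_ne (show Reg.sz.code ≠ 64 by omega), hsz]
        funext r
        simp only [Function.update_apply])))))))))
    convert hx using 1
    · rfl
    · omega
  · rw [hr 0 (by omega)]; simp [hs₀, h.out]
  · have r67 : s₀.reg 67 = N + 16 := by simp [hs₀]
    have r68 : s₀.reg 68 = 0 := by simp [hs₀]
    have := hw i hi
    rw [r67, r68] at this
    rw [show i = 0 + 1 * i by omega, this, ← h.mem, hc]
    show s.mem _ = _
    congr 1
    omega

/-- The program that computes normal forms. -/
def Prog.normalForm : Prog := .seq .prologue (.seq Cmd.normalForm.comp .epilogue)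

/-- The numbers that occur in the computation are polynomially bounded. -/
theorem exists_wordBound : ∃ K : ℕ, ∀ n : ℕ, 0 < n → ∀ V N : ℕ, V ≤ 3000 * (n * n) →
    N ≤ 3 * (n * n) → N + 64 * (V + 2) ^ 40 + 64 + 200 * (V + N) ≤ K * n ^ K := by
  -- From `V + 2 ≤ 3002 * (n * n)` the fortieth power is at most `3002 ^ 40 * n ^ 80`. The same
  -- constant serves as factor and as exponent, where anything from `80` on would do.
  refine ⟨64 * 3002 ^ 40 + 1000000, fun n hn V N hV hN => ?_⟩
  have h1 : 0 < n * n := Nat.mul_pos hn hn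
  have h2 : (V + 2) ^ 40 ≤ 3002 ^ 40 * n ^ 80 := by
    rw [show n ^ 80 = (n * n) ^ 40 by ring, ← Nat.mul_pow]
    exact Nat.pow_le_pow_left (by omega) 40
  have h3 : n * n ≤ n ^ 80 := by
    rw [← pow_two]; exact Nat.pow_le_pow_right hn (by omega)
  generalize 3002 ^ 40 = c at *
  have h4 : n ^ 80 ≤ n ^ (64 * c + 1000000) := Nat.pow_le_pow_right hn (by omega)
  refine le_trans ?_ (Nat.mul_le_mul_left _ h4)
  rw [Nat.add_mul, Nat.mul_assoc]
  omega

theorem Prog.exec_normalForm : ∃ C K : ℕ, ∀ (n : ℕ) (P : PowerCircuit (Fin n)), P.Proper →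
    ∃ (s : Config) (t : ℕ), Exec (K * n ^ K) normalForm (input P) s t ∧ t ≤ C * n ^ 3 ∧
      IsOutput (canonical ((Inst.ofCircuit P).rowSum 0)) s := by
  obtain ⟨c, hc⟩ := Cmd.normalForm.exists_time_le
  obtain ⟨K, hK⟩ := exists_wordBound
  -- `117649 = 49 ^ 3`, since `16 * n + 33 ≤ 49 * n`; the `100` pays for copying input and output.
  refine ⟨117649 * c + 100, K, fun n P hP => ?_⟩
  have hn : 0 < n := by
    obtain ⟨v, -⟩ := P.marked_nonempty
    exact v.pos
  have hnn : n ≤ n * n := Nat.le_mul_of_pos_left n hn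
  set x := (Inst.ofCircuit P).rowSum 0 with hx
  set V := 1000 * (n * n) + 1000 * n + 1000 with hV
  have hB := hK n hn V (1 + n + n * n) (by omega) (by omega)
  obtain ⟨s₁, hex₁, hrel₁⟩ := exec_prologue P (B := K * n ^ K) (by omega)
  obtain ⟨hok, hm, hsz, himg⟩ := Cmd.wp_normalForm (I := Inst.ofCircuit P) (σ := inputSt P) (V := V)
    (L := 16 * n + 32) le_rfl le_rfl (Inst.ofCircuit_fits hP) (input_inputSt P)
    (fun b hb => by simp [inputSt, hb])
  obtain ⟨s₂, t₂, hex₂, ht₂, hrel₂, hbdd⟩ := Cmd.exec_comp (B := K * n ^ K) (V := V) (by omega)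
    (by omega) Cmd.normalForm (inputSt P) s₁ Cmd.normalForm_wf (bdd_inputSt P (by omega)) hok hrel₁
  obtain ⟨s₃, hex₃, h0, hout⟩ := exec_epilogue (B := K * n ^ K) hrel₂ (by
    have := hbdd.1 .sz; omega)
  refine ⟨s₃, _, hex₁.seq (hex₂.seq hex₃), ?_, fun a ha => ?_⟩
  · have h1 : vertexCount x ≤ 2 * n := Inst.vertexCount_ofCircuit_le hP
    have h2 : vertexCount x * vertexCount x ≤ 2 * n * (2 * n) := Nat.mul_le_mul h1 h1
    have h3 : 2 * n * (2 * n) = 4 * (n * n) := by ring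
    have h4 : (16 * n + 32 + 1) ^ 3 ≤ 117649 * n ^ 3 :=
      (Nat.pow_le_pow_left (show 16 * n + 32 + 1 ≤ 49 * n by omega) 3).trans (by
        rw [Nat.mul_pow])
    have h5 := hc (16 * n + 32)
    rw [Cmd.normalForm_depth] at h5
    have h6 := Nat.mul_le_mul_left c h4
    have h7 : n * n ≤ n ^ 3 := by
      rw [← pow_two]; exact Nat.pow_le_pow_right hn (by omega)
    rw [hsz, hm, ← hx, Nat.add_mul, Nat.mul_assoc, Nat.mul_left_comm]
    omega
  · rw [h0, Nat.zero_add, hout a (by rw [hsz, hm, ← hx]; omega)]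
    rw [hm] at himg
    exact himg.eq_encode (fun v => (signCode_markSign _ _).symm)
      (fun v w => (signCode_edgeSign _ _).symm) ha

end RAM

/-! ### The main theorem -/

theorem mainTheorem3 :
    ∃ (A : RAM.Prog) (C K : ℕ), ∀ (n : ℕ) (P : PowerCircuit (Fin n)), P.Proper →
      ∃ (m : ℕ) (Q : PowerCircuit (Fin m)),
        (∃ (s : RAM.Config) (t : ℕ),
          RAM.Exec (K * n ^ K) A (RAM.input P) s t ∧ t ≤ C * n ^ 3 ∧ RAM.IsOutput Q s) ∧
        Q.Normal ∧ Q.ZeroSignsPositive ∧ Q.Equivalent P ∧ m ≤ 2 * n ∧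
        ∀ (W : Type) [Fintype W] (R : PowerCircuit W), R.Normal → R.Equivalent P →
          R.IsomorphicUpToZeroSigns Q ∧ (R.ZeroSignsPositive → R.Isomorphic Q) := by
  obtain ⟨C, K, h⟩ := RAM.Prog.exec_normalForm
  refine ⟨RAM.Prog.normalForm, C, K, fun n P hP => ?_⟩
  set x := (RAM.Inst.ofCircuit P).rowSum 0
  have hx : (x : ℝ) = P.value := RAM.Inst.ofCircuit_value hP
  have hQ := RAM.isCanonical_canonical x
  have hpos := RAM.zeroSignsPositive_canonical x
  refine ⟨_, RAM.canonical x, h n P hP, hQ.normal, hpos, hQ.value_eq.trans hx,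
    RAM.Inst.vertexCount_ofCircuit_le hP, fun W _ R hR hRP => ?_⟩
  -- An equivalent normal circuit has the same integer value `x`, so it is canonical for `x`, too.
  have hiso := (hR.isCanonical (hRP.trans hx.symm)).isomorphic hQ
  exact ⟨hiso.1, fun h => hiso.2 h hpos⟩
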